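/- Let $d\ge 1$, let $\mathbb{R}^d_+=(0,\infty)^d$ be equipped with Lebesgue measure, and let $L_n^a$ denote the Laguerre polynomial of degree $n$ and order $a>-1$. For $\beta\in(-1,\infty)^d$ and $k\in\mathbb{N}^d$ let $$\varphi_k^\beta(x)=\prod_{i=1}^d \sqrt2\,\Big(\frac{\Gamma(k_i+1)}{\Gamma(k_i+\beta_i+1)}\Big)^{1/2}L_{k_i}^{\beta_i}(x_i^2)\,x_i^{\beta_i+1/2}e^{-x_i^2/2},\qquad x\in\mathbb{R}^d_+ ,$$ be the Laguerre functions of Hermite type. Put $\lambda_k^\beta=4|k|+2|\beta|+2d$, where $|k|=\sum_i k_i$ and $|\beta|=\sum_i\beta_i$; let $L_\beta^\varphi$ be the self-adjoint operator on $L^2(\mathbb{R}^d_+)$ with eigenfunctions $\varphi_k^\beta$ and eigenvalues $\lambda_k^\beta$, and let $$G_t^{\beta,\varphi}(x,y)=\sum_{k\in\mathbb{N}^d}e^{-t\lambda_k^\beta}\varphi_k^\beta(x)\varphi_k^\beta(y),\qquad t>0 .$$ Fix $j\in\{1,\dots,d\}$, let $e_j$ be the $j$th coordinate vector, and let $\alpha\in\mathbb{R}^d$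 satisfy $\alpha_j\ge-3/2$ and $\alpha_i\ge-1/2$ for $i\ne j$. On $L^2(\mathbb{R}^d_+)$ the modified semigroup is $$\exp\big(-t(L_{\alpha+e_j}^\varphi+2)\big)f=e^{-2t}\sum_{k\in\mathbb{N}^d}e^{-t\lambda_k^{\alpha+e_j}}\langle f,\varphi_k^{\alpha+e_j}\rangle\,\varphi_k^{\alpha+e_j},\qquad t\ge 0 .$$ Let $\widetilde T_0^{\alpha,\varphi,j}=\mathrm{Id}$ and $$\widetilde T_t^{\alpha,\varphi,j}f(x)=e^{-2t}\int_{\mathbb{R}^d_+}G_t^{\alpha+e_j,\varphi}(x,y)f(y)\,dy,\qquad t>0,\ x\in\mathbb{R}^d_+ .$$ For $t>0$ the series defining $G_t^{\alpha+e_j,\varphi}(x,y)$ and, for all $f\in L^1+L^\infty$, the integrals converge for all $x,y\in\mathbb{R}^d_+$, and $\widetilde T_t^{\alpha,\varphi,j}=\exp(-t(L_{\alpha+e_j}^\varphi+2))$ on $L^2(\mathbb{R}^d_+)$ for all $t\ge 0$. A symmetric diffusion semigroup is a family of linear operators $\{T_t\}_{t\ge0}$ from $L^1+L^\infty$ to measurable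 functions, with $T_0=\mathrm{Id}$, which are contractions and form a semigroup on each $L^p$, $1\le p\le\infty$, are self-adjoint on $L^2$, and satisfy $T_tf\to f$ in $L^2$ as $t\to0^+$ for $f\in L^2$. If in addition $T_tf\ge0$ whenever $f\ge 0$, it is called submarkovian if $T_t\mathbf 1\le\mathbf 1$ for all $t$, and Markovian if $T_t\mathbf 1=\mathbf 1$ for all $t$. A semigroup $\{S_t\}_{t\ge0}$ on $L^2$ is called $L^p$-contractive if $\|S_tf\|_p\le\|f\|_p$ for all $1\le p\le\infty$, $t\ge0$ and $f\in L^2\cap L^p$. (1) If $\alpha_j\in\{-3/2\}\cup[-1/2,\infty)$ and $\alpha_i\in\{-1/2\}\cup[1/2,\infty)$ for all $i\neq j$, then $\{\widetilde T_t^{\alpha,\varphi,j}\}$ is a submarkovian, but not Markovian, symmetric diffusion semigroup, and for all $1\le p\le\infty$ $$\|\widetilde T_t^{\alpha,\varphi,j}\|_{p\to p}\le e^{-2t}(\cosh 2t)^{-d/2},\qquad t>0 .$$ (2) If $\alpha_j\notin\{-3/2\}\cup[-1/2,\infty)$ or $\alpha_i\notin\{-1/2\}\cup[1/2,\infty)$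 for some $i\ne j$, then $\{\exp(-t(L_{\alpha+e_j}^\varphi+2))\}$ is not $L^p$-contractive, but there is a constant $c=c(\alpha)>1$ such that for all $1\le p\le\infty$ $$\|\widetilde T_t^{\alpha,\varphi,j}\|_{p\to p}\le c\,e^{-2t}(\cosh 2t)^{-d/2},\qquad t>0 .$$ -/

import Mathlib

open MeasureTheory Filter Topology Set
open scoped ENNReal ComplexOrder

noncomputable section

/-! ### Symmetric diffusion semigroups on a measure space

Operators act on functions `X → 𝕜`; all requirements are stated modulo almost everywhere equality.
The time parameter is real, and only `0 ≤ t` is used. -/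

section Diffusion

variable {X : Type*} [MeasurableSpace X] {𝕜 : Type*} [RCLike 𝕜]

/-- `f` belongs to `L¹ + L^∞`. -/
def MemL1AddLinfty (μ : Measure X) (f : X → 𝕜) : Prop :=
  ∃ g h : X → 𝕜, MemLp g 1 μ ∧ MemLp h ∞ μ ∧ f =ᵐ[μ] g + h

/-- A symmetric diffusion semigroup with domain `𝓓 = L¹ + L^∞` (which is `L¹` if `μ` is finite):
linear operators from `𝓓` to (classes of) measurable functions, with `T₀ = Id`, contractive and a
semigroup on each `L^p`, `1 ≤ p ≤ ∞`, self-adjoint on `L²`, and strongly continuous on `L²`. -/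
structure IsSymmetricDiffusionSemigroup (μ : Measure X) (T : ℝ → (X → 𝕜) → (X → 𝕜)) : Prop where
  congr_ae : ∀ t, 0 ≤ t → ∀ f g, MemL1AddLinfty μ f → f =ᵐ[μ] g → T t f =ᵐ[μ] T t g
  aestronglyMeasurable : ∀ t, 0 ≤ t → ∀ f, MemL1AddLinfty μ f → AEStronglyMeasurable (T t f) μ
  map_add : ∀ t, 0 ≤ t → ∀ f g, MemL1AddLinfty μ f → MemL1AddLinfty μ g →
    T t (f + g) =ᵐ[μ] T t f + T t g
  map_smul : ∀ t, 0 ≤ t → ∀ (c : 𝕜) (f), MemL1AddLinfty μ f → T t (c • f) =ᵐ[μ] c • T t f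
  map_zero_time : ∀ f, MemL1AddLinfty μ f → T 0 f =ᵐ[μ] f
  contraction : ∀ p : ℝ≥0∞, 1 ≤ p → ∀ t, 0 ≤ t → ∀ f, MemLp f p μ →
    eLpNorm (T t f) p μ ≤ eLpNorm f p μ
  semigroup : ∀ p : ℝ≥0∞, 1 ≤ p → ∀ s t, 0 ≤ s → 0 ≤ t → ∀ f, MemLp f p μ →
    T (s + t) f =ᵐ[μ] T s (T t f)
  selfAdjoint : ∀ t, 0 ≤ t → ∀ f g, MemLp f 2 μ → MemLp g 2 μ →
    ∫ x, inner 𝕜 (T t f x) (g x) ∂μ = ∫ x, inner 𝕜 (f x) (T t g x) ∂μ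
  continuous_zero : ∀ f, MemLp f 2 μ →
    Tendsto (fun t => eLpNorm (T t f - f) 2 μ) (𝓝[>] 0) (𝓝 0)

/-- Positive symmetric diffusion semigroup with `T_t 1 ≤ 1` for all `t`. -/
structure IsSubmarkovian (μ : Measure X) (T : ℝ → (X → 𝕜) → (X → 𝕜)) : Prop
    extends IsSymmetricDiffusionSemigroup μ T where
  positive : ∀ t, 0 ≤ t → ∀ f, MemL1AddLinfty μ f → (∀ᵐ x ∂μ, 0 ≤ f x) → ∀ᵐ x ∂μ, 0 ≤ T t f x
  map_one_le : ∀ t, 0 ≤ t → ∀ᵐ x ∂μ, T t (fun _ => 1) x ≤ 1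

/-- Positive symmetric diffusion semigroup with `T_t 1 = 1` for all `t`. -/
structure IsMarkovian (μ : Measure X) (T : ℝ → (X → 𝕜) → (X → 𝕜)) : Prop
    extends IsSymmetricDiffusionSemigroup μ T where
  positive : ∀ t, 0 ≤ t → ∀ f, MemL1AddLinfty μ f → (∀ᵐ x ∂μ, 0 ≤ f x) → ∀ᵐ x ∂μ, 0 ≤ T t f x
  map_one : ∀ t, 0 ≤ t → ∀ᵐ x ∂μ, T t (fun _ => 1) x = 1

/-- `L^p`-contractivity of a semigroup `S` of operators on `L²`: for every `1 ≤ p ≤ ∞` and every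
`t ≥ 0` one has `‖S_t f‖_p ≤ ‖f‖_p` for all `f ∈ L² ∩ L^p`. -/
def IsLpContractive (μ : Measure X) (S : ℝ → Lp 𝕜 2 μ → Lp 𝕜 2 μ) : Prop :=
  ∀ p : ℝ≥0∞, 1 ≤ p → ∀ t, 0 ≤ t → ∀ f : Lp 𝕜 2 μ, MemLp f p μ →
    eLpNorm (S t f) p μ ≤ eLpNorm f p μ

/-- The operator `A` maps `L^p` into `L^p` with `‖A‖_{p → p} ≤ C`. -/
def LpOpNormLE (μ : Measure X) (p : ℝ≥0∞) (A : (X → 𝕜) → (X → 𝕜)) (C : ℝ) : Prop :=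
  ∀ f, MemLp f p μ → MemLp (A f) p μ ∧ eLpNorm (A f) p μ ≤ ENNReal.ofReal C * eLpNorm f p μ

end Diffusion

/-! ### Laguerre functions of Hermite type -/

/-- The Laguerre polynomial `L_n^a(x)`, for `a > -1`. -/
def laguerrePoly (a : ℝ) (n : ℕ) (x : ℝ) : ℝ :=
  ∑ i ∈ Finset.range (n + 1),
    (-1) ^ i * Real.Gamma (n + a + 1) /
      (Real.Gamma (i + a + 1) * (n - i).factorial * i.factorial) * x ^ i

/-- The normalized Laguerre polynomial `(Γ(n+1) / Γ(n+a+1))^{1/2} L_n^a(x)`. -/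
def laguerrePolyNormalized (a : ℝ) (n : ℕ) (x : ℝ) : ℝ :=
  √(Real.Gamma (n + 1) / Real.Gamma (n + a + 1)) * laguerrePoly a n x

/-- The one-dimensional Laguerre function of Hermite type, for `x > 0`. -/
def hermiteFun₁ (a : ℝ) (n : ℕ) (x : ℝ) : ℝ :=
  √2 * laguerrePolyNormalized a n (x ^ 2) * x ^ (a + 1 / 2) * Real.exp (-x ^ 2 / 2)

variable {d : ℕ}

/-- The Laguerre function of Hermite type `φ_k^α(x) = ∏ φ_{k_i}^{α_i}(x_i)`. -/
def hermiteFun (α : Fin d → ℝ) (k : Fin d → ℕ) (x : Fin d → ℝ) : ℝ :=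
  ∏ i, hermiteFun₁ (α i) (k i) (x i)

/-- The open orthant `ℝ_+^d = (0, ∞)^d`. -/
def orthant (d : ℕ) : Set (Fin d → ℝ) := {x | ∀ i, 0 < x i}

/-- Lebesgue measure on `ℝ_+^d`. -/
def orthantMeasure (d : ℕ) : Measure (Fin d → ℝ) := volume.restrict (orthant d)

/-- The eigenvalue `4|k| + 2|α| + 2d` of the Hermite type Laguerre operator at `φ_k^α`. -/
def hermiteEigenvalue (α : Fin d → ℝ) (k : Fin d → ℕ) : ℝ :=
  4 * (∑ i, (k i : ℝ)) + 2 * (∑ i, α i) + 2 * d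

lemma memLp_hermiteFun₁ {a : ℝ} (ha : -1 < a) (n : ℕ) :
    MemLp (hermiteFun₁ a n) 2 (volume.restrict (Ioi 0)) := by
  have key : ∀ i : ℕ, MemLp (fun x : ℝ => (x ^ 2) ^ i * x ^ (a + 1 / 2) * Real.exp (-x ^ 2 / 2)) 2
      (volume.restrict (Ioi 0)) := by
    intro i
    rw [memLp_two_iff_integrable_sq (by fun_prop)]
    have h := integrableOn_rpow_mul_exp_neg_mul_sq (b := 1) one_pos (s := 4 * i + (2 * a + 1))
      (by have : (0 : ℝ) ≤ i := i.cast_nonneg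
          linarith)
    refine IntegrableOn.congr_fun h ?_ measurableSet_Ioi
    intro x hx
    have hx : 0 < x := hx
    have e0 : x ^ (4 * (i : ℝ)) = (x ^ 2) ^ i * (x ^ 2) ^ i := by
      rw [show (4 * (i : ℝ)) = ((4 * i : ℕ) : ℝ) by push_cast; ring, Real.rpow_natCast]
      ring
    have e1 : x ^ (4 * (i : ℝ) + (2 * a + 1)) = (x ^ 2) ^ i * (x ^ 2) ^ i *
        (x ^ (a + 1 / 2) * x ^ (a + 1 / 2)) := by
      rw [Real.rpow_add hx, e0, ← Real.rpow_add hx]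
      congr 2
      ring
    have e2 : Real.exp (-1 * x ^ 2) = Real.exp (-x ^ 2 / 2) * Real.exp (-x ^ 2 / 2) := by
      rw [← Real.exp_add]
      congr 1
      ring
    simp only [e1, e2]
    ring
  have hsum : hermiteFun₁ a n = fun x => ∑ i ∈ Finset.range (n + 1),
      (√2 * √(Real.Gamma (n + 1) / Real.Gamma (n + a + 1)) *
        ((-1) ^ i * Real.Gamma (n + a + 1) /
          (Real.Gamma (i + a + 1) * (n - i).factorial * i.factorial))) *
        ((x ^ 2) ^ i * x ^ (a + 1 / 2) * Real.exp (-x ^ 2 / 2)) := by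
    funext x
    simp only [hermiteFun₁, laguerrePolyNormalized, laguerrePoly, Finset.mul_sum, Finset.sum_mul]
    refine Finset.sum_congr rfl fun i _ => ?_
    ring
  rw [hsum]
  exact memLp_finsetSum _ fun i _ => (key i).const_mul _

lemma orthantMeasure_eq_pi (d : ℕ) :
    orthantMeasure d = Measure.pi fun _ : Fin d => volume.restrict (Ioi (0 : ℝ)) := by
  rw [← Measure.restrict_pi_pi]
  have : orthant d = univ.pi fun _ => Ioi (0 : ℝ) := by
    ext x
    simp [orthant]
  rw [orthantMeasure, this]
  rfl

lemma memLp_hermiteFun {α : Fin d → ℝ} (hα : ∀ i, -1 < α i) (k : Fin d → ℕ) :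
    MemLp (hermiteFun α k) 2 (orthantMeasure d) := by
  have hm : Measurable (hermiteFun α k) := by
    unfold hermiteFun hermiteFun₁ laguerrePolyNormalized laguerrePoly
    fun_prop
  rw [memLp_two_iff_integrable_sq hm.aestronglyMeasurable, orthantMeasure_eq_pi]
  have := Integrable.fintype_prod (μ := fun _ : Fin d => volume.restrict (Ioi (0 : ℝ)))
    (f := fun i x => hermiteFun₁ (α i) (k i) x ^ 2)
    fun i => (memLp_hermiteFun₁ (hα i) (k i)).integrable_sq
  simpa only [hermiteFun, Finset.prod_pow] using this

variable (𝕜 : Type*) [RCLike 𝕜]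

lemma memLp_ofReal_hermiteFun {α : Fin d → ℝ} (hα : ∀ i, -1 < α i) (k : Fin d → ℕ) :
    MemLp (fun x => (hermiteFun α k x : 𝕜)) 2 (orthantMeasure d) :=
  (memLp_hermiteFun hα k).ofReal

open Classical in
/-- The function `φ_k^α` as an element of `L²(ℝ_+^d)`. By `memLp_ofReal_hermiteFun` the first branch
applies whenever `α ∈ (-1, ∞)^d`. -/
def hermiteVec (α : Fin d → ℝ) (k : Fin d → ℕ) : Lp 𝕜 2 (orthantMeasure d) :=
  if h : MemLp (fun x => (hermiteFun α k x : 𝕜)) 2 (orthantMeasure d) then h.toLp else 0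

variable {𝕜}

/-- The heat semigroup `exp(-t L_α^φ)` on `L²(ℝ_+^d)`, `α ∈ (-1, ∞)^d`, where `L_α^φ` is the
self-adjoint operator with spectral decomposition given by the orthonormal basis `φ_k^α` and the
eigenvalues `4|k| + 2|α| + 2d`. -/
def hermiteHeat (α : Fin d → ℝ) (t : ℝ) (f : Lp 𝕜 2 (orthantMeasure d)) :
    Lp 𝕜 2 (orthantMeasure d) :=
  ∑' k : Fin d → ℕ, ((Real.exp (-t * hermiteEigenvalue α k) : 𝕜) *
    inner 𝕜 (hermiteVec 𝕜 α k) f) • hermiteVec 𝕜 α k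

/-- The `j`-th modified semigroup on `L²(ℝ_+^d)`, with generator `L_{α+e_j}^φ + 2`. -/
def modifiedHermiteHeat (α : Fin d → ℝ) (j : Fin d) (t : ℝ) (f : Lp 𝕜 2 (orthantMeasure d)) :
    Lp 𝕜 2 (orthantMeasure d) :=
  (Real.exp (-2 * t) : 𝕜) • hermiteHeat (α + Pi.single j 1) t f

/-- The term `e^{-t(4|k|+2|α|+2d)} φ_k^α(x) φ_k^α(y)` of the heat kernel. -/
def hermiteKernelTerm (α : Fin d → ℝ) (t : ℝ) (x y : Fin d → ℝ) (k : Fin d → ℕ) : ℝ :=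
  Real.exp (-t * hermiteEigenvalue α k) * (hermiteFun α k x * hermiteFun α k y)

/-- The heat kernel `G_t^{α,φ}(x, y)`, `t > 0`. -/
def hermiteKernel (α : Fin d → ℝ) (t : ℝ) (x y : Fin d → ℝ) : ℝ :=
  ∑' k, hermiteKernelTerm α t x y k

/-- The `j`-th modified semigroup acting on functions: the integral operators with kernels
`e^{-2t} G_t^{α+e_j,φ}(x, y)` for `t > 0`, and the identity for `t = 0`. -/
def modifiedHermiteSemigroup (α : Fin d → ℝ) (j : Fin d) (t : ℝ) (f : (Fin d → ℝ) → 𝕜)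
    (x : Fin d → ℝ) : 𝕜 :=
  if t = 0 then f x
  else (Real.exp (-2 * t) : 𝕜) *
    ∫ y, (hermiteKernel (α + Pi.single j 1) t x y : 𝕜) * f y ∂(orthantMeasure d)

/-- The admissible parameters: `α_j ≥ -3/2` and `α_i ≥ -1/2` for `i ≠ j`. -/
def hermiteAdmissible (j : Fin d) : Set (Fin d → ℝ) :=
  {α | -3 / 2 ≤ α j ∧ ∀ i, i ≠ j → -1 / 2 ≤ α i}

end

noncomputable section

variable {d : ℕ}

/-! ### Double series -/

/-! Put β = α + e_j. Then β_i ≥ -1/2 for all i, and the two cases of the theorem are: every β_i lies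
in {-1/2} ∪ [1/2, ∞), or some β_i lies in (-1/2, 1/2). The Hille–Hardy formula (`hasSum_hilleHardy`)
sums the kernel in closed form, as a product of nonnegative symmetric one-dimensional kernels.
Everything then depends on the mass, the integral of the kernel in one variable. By the Schur test
(`IsSchurKernel.eLpNorm_kernelOp_le`) its supremum bounds all L^p norms; by positivity and symmetry,
the L¹ norm of the image of the indicator of E is the integral of the mass over E.

Termwise integration (`lintegral_laguerreKernel₁`) gives the one-dimensional mass cosh(2t)^(-1/2)
exp(-w sinh²(2t)) M_a(w), where a = β/2 + 1/4, w = x²/(2 sinh 2t cosh 2t) and M_a is `laguerreMass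
a`. One has M_0 = 1, and for a > 0 a Beta integral yields M_a(w) = Γ(a)⁻¹ ∫₀¹ w^a e^(-ws) s^(a-1)
(1-s)^(a-1/2) ds (`laguerreMass_eq_lintegral`). If a ≥ 1/2, the last factor is at most 1 and
comparison with the Gamma integral gives M_a ≤ 1: the contractive case. If 0 < a < 1/2, M_a is still
bounded, but (1-s)^(a-1/2) ≥ 1 + (1/2-a)s gives M_a(w) ≥ 1 + (1/2-a)a/w up to an exponentially small
error, so M_a(w) > 1 for large w. When w is held fixed and t → 0, all other factors tend to 1. The
remaining coordinates cost only factors close to 1, so the mass exceeds 1 on a box and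
L¹-contractivity fails.

The integral operators agree with the spectral semigroup because the φ_k form an orthonormal basis.
Orthogonality is a statement about n-th finite differences of polynomials. For completeness, the
generating function expands φ_0 ∏ exp(-N_i x_i²) in the φ_k, and these Gaussians determine finite
measures on the orthant. Termwise integration then gives the eigenfunction property and the
Chapman–Kolmogorov equation, and Parseval gives continuity on L². -/

lemma hasSum_antidiagonal_of_summable {f : ℕ × ℕ → ℝ} (hf : Summable f) {g : ℕ → ℝ} {s : ℝ}
    (hg : ∀ i, HasSum (fun k => f (i, k)) (g i)) (hs : HasSum g s) :
    HasSum (fun n => ∑ p ∈ Finset.HasAntidiagonal.antidiagonal n, f p) s := by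
  have h1 : HasSum f s := by
    have := hf.hasSum.prod_fiberwise hg
    rw [hs.unique this]
    exact hf.hasSum
  have h2 := (Finset.HasAntidiagonal.sigmaAntidiagonalEquivProd (A := ℕ)).hasSum_iff.mpr h1
  refine h2.sigma fun n => ?_
  have := hasSum_fintype (fun c : Finset.HasAntidiagonal.antidiagonal n => f c)
  rw [Finset.sum_coe_sort (Finset.HasAntidiagonal.antidiagonal n) f] at this
  exact this

/-- Converse direction of the rearrangement: the antidiagonal sum is the known one, and it is
transferred to the row sums. -/
lemma hasSum_fiberwise_of_summable_antidiagonal {f : ℕ × ℕ → ℝ} (hf : Summable f) {g : ℕ → ℝ}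
    {s : ℝ} (hg : ∀ i, HasSum (fun k => f (i, k)) (g i))
    (hs : HasSum (fun n => ∑ p ∈ Finset.HasAntidiagonal.antidiagonal n, f p) s) : HasSum g s := by
  have h := hf.hasSum.prod_fiberwise hg
  rwa [← hs.unique (hasSum_antidiagonal_of_summable hf hg h)] at h

lemma summable_of_summable_antidiagonal_abs {f : ℕ × ℕ → ℝ}
    (hf : Summable fun n => ∑ p ∈ Finset.HasAntidiagonal.antidiagonal n, |f p|) : Summable f := by
  rw [← summable_abs_iff,
    ← (Finset.HasAntidiagonal.sigmaAntidiagonalEquivProd (A := ℕ)).summable_iff]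
  refine (summable_sigma_of_nonneg (fun _ => abs_nonneg _)).2 ⟨fun n => (hasSum_fintype _).summable, ?_⟩
  convert! hf with n
  rw [tsum_fintype]
  exact Finset.sum_coe_sort (Finset.HasAntidiagonal.antidiagonal n) (fun p => |f p|)

lemma eq_of_hasSum_powerSeries {a b : ℕ → ℝ} {f : ℝ → ℝ} {ε : ℝ} (hε : 0 < ε)
    (ha : ∀ h, |h| < ε → HasSum (fun n => a n * h ^ n) (f h))
    (hb : ∀ h, |h| < ε → HasSum (fun n => b n * h ^ n) (f h)) : a = b := by
  have key : ∀ c : ℕ → ℝ, (∀ h, |h| < ε → HasSum (fun n => c n * h ^ n) (f h)) →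
      HasFPowerSeriesAt f (FormalMultilinearSeries.ofScalars ℝ c) 0 := by
    intro c hc
    rw [hasFPowerSeriesAt_iff]
    filter_upwards [Metric.ball_mem_nhds (0 : ℝ) hε] with z hz
    have := hc z (by simpa using hz)
    simpa [FormalMultilinearSeries.coeff_ofScalars, mul_comm] using this
  have h := (key a ha).eq_formalMultilinearSeries (key b hb)
  exact FormalMultilinearSeries.ofScalars_series_injective ℝ ℝ h

/-! ### Binomial series -/

lemma Gamma_add_natCast {c : ℝ} (hc : 0 < c) (n : ℕ) :
    Real.Gamma (n + c) = (ascPochhammer ℝ n).eval c * Real.Gamma c := by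
  induction n with
  | zero => simp
  | succ n ih =>
    rw [ascPochhammer_succ_eval, Nat.cast_succ, show (n : ℝ) + 1 + c = (n + c) + 1 by ring,
      Real.Gamma_add_one (by positivity), ih]
    ring

/-- Newton's series for (1 - r)^(-c): the generalized binomial coefficient is a rising factorial
over k!, and the rising factorial is the quotient Γ(k + c) / Γ(c). -/
lemma hasSum_binomial_Gamma {c r : ℝ} (hc : 0 < c) (hr : |r| < 1) :
    HasSum (fun k : ℕ => Real.Gamma (k + c) / (Real.Gamma c * k.factorial) * r ^ k)
      ((1 - r) ^ (-c)) := by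
  have h := (Real.one_div_one_sub_rpow_hasFPowerSeriesOnBall_zero c).hasSum (y := r)
    (by simpa [enorm_eq_nnnorm, ← NNReal.coe_lt_coe] using hr)
  rw [zero_add, one_div, ← Real.rpow_neg (by linarith [(abs_lt.1 hr).2])] at h
  convert! h using 2 with k
  have hk : (Ring.choose (c + k - 1) k : ℝ) * k.factorial = (ascPochhammer ℝ k).eval c := by
    have := Ring.factorial_nsmul_multichoose_eq_ascPochhammer c k
    rw [Polynomial.ascPochhammer_smeval_eq_eval] at this
    rw [← this, nsmul_eq_mul, Ring.choose, mul_comm]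
    congr 2
    ring
  rw [Gamma_add_natCast hc, ← hk]
  have := (Real.Gamma_pos_of_pos hc).ne'
  simp only [FormalMultilinearSeries.ofScalars_apply_eq, smul_eq_mul]
  field_simp

/-! ### The generating function of the Laguerre polynomials -/

/-- The coefficients of the Laguerre polynomials, indexed over the antidiagonal. -/
def laguerreTerm (β x : ℝ) (p : ℕ × ℕ) : ℝ :=
  (-x) ^ p.1 / p.1.factorial *
    (Real.Gamma (p.2 + (p.1 + β + 1)) / (Real.Gamma (p.1 + β + 1) * p.2.factorial))

lemma laguerrePoly_eq_sum_antidiagonal (β x : ℝ) (n : ℕ) :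
    laguerrePoly β n x = ∑ p ∈ Finset.HasAntidiagonal.antidiagonal n, laguerreTerm β x p := by
  rw [laguerrePoly, Finset.Nat.sum_antidiagonal_eq_sum_range_succ_mk]
  refine Finset.sum_congr rfl fun i hi => ?_
  have hi : i ≤ n := Nat.lt_succ_iff.1 (Finset.mem_range.1 hi)
  rw [laguerreTerm, neg_pow x]
  push_cast [Nat.cast_sub hi]
  rw [show (n : ℝ) - i + (i + β + 1) = n + β + 1 by ring]
  ring

lemma laguerreTerm_neg_nonneg {β x : ℝ} (hβ : -1 < β) (hx : 0 ≤ x) (p : ℕ × ℕ) :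
    0 ≤ laguerreTerm β (-x) p := by
  have h1 : 0 < (p.1 : ℝ) + β + 1 := by have := p.1.cast_nonneg (α := ℝ); linarith
  have h2 : 0 < (p.2 : ℝ) + (p.1 + β + 1) := by positivity
  have := Real.Gamma_pos_of_pos h1
  have := Real.Gamma_pos_of_pos h2
  rw [laguerreTerm, neg_neg]
  positivity

/-- For β > -1 the sign of a term comes only from the power of -x, so evaluation at -|x| adds up
absolute values. This is the majorant behind the absolute convergence arguments below. -/
lemma abs_laguerreTerm {β : ℝ} (hβ : -1 < β) (x : ℝ) (p : ℕ × ℕ) :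
    |laguerreTerm β x p| = laguerreTerm β (-|x|) p := by
  have h := laguerreTerm_neg_nonneg hβ (abs_nonneg x) p
  rw [← abs_of_nonneg h]
  simp only [laguerreTerm, abs_mul, abs_div, abs_pow, abs_neg, abs_abs]

lemma laguerrePoly_neg_nonneg {β x : ℝ} (hβ : -1 < β) (hx : 0 ≤ x) (n : ℕ) :
    0 ≤ laguerrePoly β n (-x) := by
  rw [laguerrePoly_eq_sum_antidiagonal]
  exact Finset.sum_nonneg fun p _ => laguerreTerm_neg_nonneg hβ hx p

lemma abs_laguerrePoly_le {β : ℝ} (hβ : -1 < β) (x : ℝ) (n : ℕ) :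
    |laguerrePoly β n x| ≤ laguerrePoly β n (-|x|) := by
  simp only [laguerrePoly_eq_sum_antidiagonal]
  refine (Finset.abs_sum_le_sum_abs _ _).trans_eq ?_
  exact Finset.sum_congr rfl fun p _ => abs_laguerreTerm hβ x p

/-- For fixed i this is the binomial series with exponent i + β + 1; the extra i factors of 1/(1 -
r) combine with (-x r)^i. -/
lemma hasSum_laguerreTerm_fiber {β r : ℝ} (hβ : -1 < β) (x : ℝ) (hr : |r| < 1) (i : ℕ) :
    HasSum (fun k => laguerreTerm β x (i, k) * r ^ (i + k))
      ((1 - r) ^ (-(β + 1)) * ((-(x * r / (1 - r))) ^ i / i.factorial)) := by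
  have h1 : 0 < (i : ℝ) + β + 1 := by have := i.cast_nonneg (α := ℝ); linarith
  have hr1 : 0 < 1 - r := by linarith [(abs_lt.1 hr).2]
  convert! (hasSum_binomial_Gamma h1 hr).mul_left ((-x) ^ i / i.factorial * r ^ i) using 1
  · funext k
    simp only [laguerreTerm, pow_add]
    ring
  · rw [show -((i : ℝ) + β + 1) = -(β + 1) - i by ring, Real.rpow_sub hr1, Real.rpow_natCast,
      show -(x * r / (1 - r)) = (-x) * r / (1 - r) by ring, div_pow, mul_pow]
    ring

lemma hasSum_pow_div_factorial (x : ℝ) :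
    HasSum (fun i : ℕ => x ^ i / i.factorial) (Real.exp x) := by
  rw [Real.exp_eq_exp_ℝ]
  exact NormedSpace.expSeries_div_hasSum_exp x

lemma summable_laguerreTerm {β r : ℝ} (hβ : -1 < β) (x : ℝ) (hr : |r| < 1) :
    Summable fun p : ℕ × ℕ => laguerreTerm β x p * r ^ (p.1 + p.2) := by
  rw [← summable_abs_iff]
  have e : (fun p : ℕ × ℕ => |laguerreTerm β x p * r ^ (p.1 + p.2)|) =
      fun p : ℕ × ℕ => laguerreTerm β (-|x|) p * |r| ^ (p.1 + p.2) := by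
    funext p
    rw [abs_mul, abs_laguerreTerm hβ, abs_pow]
  have hr' : |(|r|)| < 1 := by rwa [abs_abs]
  rw [e, summable_prod_of_nonneg fun p =>
    mul_nonneg (laguerreTerm_neg_nonneg hβ (abs_nonneg x) p) (pow_nonneg (abs_nonneg r) _)]
  refine ⟨fun i => (hasSum_laguerreTerm_fiber hβ _ hr' i).summable, ?_⟩
  simp_rw [(hasSum_laguerreTerm_fiber hβ _ hr' _).tsum_eq]
  exact (hasSum_pow_div_factorial _).summable.mul_left _

/-- The rows of the double series sum to the terms of an exponential series, while its antidiagonals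
collect the Laguerre polynomials. -/
lemma hasSum_laguerrePoly {β r : ℝ} (hβ : -1 < β) (x : ℝ) (hr : |r| < 1) :
    HasSum (fun n => laguerrePoly β n x * r ^ n)
      ((1 - r) ^ (-(β + 1)) * Real.exp (-(x * r / (1 - r)))) := by
  convert! hasSum_antidiagonal_of_summable (summable_laguerreTerm hβ x hr)
    (hasSum_laguerreTerm_fiber hβ x hr) ((hasSum_pow_div_factorial _).mul_left _) using 2 with n
  rw [laguerrePoly_eq_sum_antidiagonal, Finset.sum_mul]
  exact Finset.sum_congr rfl fun p hp => by rw [Finset.HasAntidiagonal.mem_antidiagonal.1 hp]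

/-! ### Sequences of subexponential growth -/

/-- The sequence `a` grows more slowly than any exponential. -/
def IsSubexp (a : ℕ → ℝ) : Prop := ∀ ρ : ℝ, 0 < ρ → ρ < 1 → Summable fun n => |a n| * ρ ^ n

/-- Write ρ = √ρ · √ρ and give one root to each factor: one product stays bounded, the other is
summable. -/
lemma IsSubexp.mul {a b : ℕ → ℝ} (ha : IsSubexp a) (hb : IsSubexp b) :
    IsSubexp fun n => a n * b n := by
  intro ρ h0 h1
  have hs0 : 0 < √ρ := Real.sqrt_pos.2 h0
  have hs1 : √ρ < 1 := by rw [Real.sqrt_lt' one_pos]; simpa using h1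
  have hA := ha _ hs0 hs1
  have hB := hb _ hs0 hs1
  obtain ⟨C, hC⟩ := hA.tendsto_atTop_zero.bddAbove_range
  refine (hB.mul_left C).of_nonneg_of_le (fun n => by positivity) fun n => ?_
  have hn : |a n| * √ρ ^ n ≤ C := hC ⟨n, rfl⟩
  have e : ρ ^ n = √ρ ^ n * √ρ ^ n := by rw [← mul_pow, Real.mul_self_sqrt h0.le]
  rw [abs_mul, e, show |a n| * |b n| * (√ρ ^ n * √ρ ^ n) =
    (|a n| * √ρ ^ n) * (|b n| * √ρ ^ n) by ring]
  gcongr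

lemma IsSubexp.mono {a b : ℕ → ℝ} (ha : IsSubexp a) (h : ∀ n, |b n| ≤ |a n|) : IsSubexp b :=
  fun ρ h0 h1 => (ha ρ h0 h1).of_nonneg_of_le (fun n => by positivity) fun n =>
    mul_le_mul_of_nonneg_right (h n) (by positivity)

lemma isSubexp_one : IsSubexp fun _ => 1 := by
  intro ρ h0 h1
  simpa using summable_geometric_of_lt_one h0.le h1

lemma IsSubexp.sqrt {a : ℕ → ℝ} (ha : IsSubexp a) : IsSubexp fun n => √(a n) := by
  intro ρ h0 h1
  refine ((isSubexp_one ρ h0 h1).add (ha ρ h0 h1)).of_nonneg_of_le (fun n => by positivity)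
    fun n => ?_
  rw [← add_mul]
  gcongr
  rw [abs_of_nonneg (Real.sqrt_nonneg _), abs_one, Real.sqrt_le_iff]
  have := abs_nonneg (a n)
  have := le_abs_self (a n)
  constructor <;> nlinarith

/-- The weight `Γ(n + 1) / Γ(n + β + 1)`. -/
def laguerreWeight (β : ℝ) (n : ℕ) : ℝ := Real.Gamma (n + 1) / Real.Gamma (n + β + 1)

lemma laguerreWeight_pos {β : ℝ} (hβ : -1 < β) (n : ℕ) : 0 < laguerreWeight β n := by
  have h1 : 0 < (n : ℝ) + β + 1 := by have := n.cast_nonneg (α := ℝ); linarith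
  exact div_pos (Real.Gamma_pos_of_pos (by positivity)) (Real.Gamma_pos_of_pos h1)

lemma laguerreWeight_succ {β : ℝ} (hβ : -1 < β) (n : ℕ) :
    laguerreWeight β (n + 1) = laguerreWeight β n * ((n + 1) / (n + β + 1)) := by
  have h1 : 0 < (n : ℝ) + β + 1 := by have := n.cast_nonneg (α := ℝ); linarith
  simp only [laguerreWeight, Nat.cast_succ]
  rw [Real.Gamma_add_one (by positivity : (n : ℝ) + 1 ≠ 0),
    show (n : ℝ) + 1 + β + 1 = (n + β + 1) + 1 by ring, Real.Gamma_add_one h1.ne']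
  have := Real.Gamma_pos_of_pos h1
  field_simp

lemma isSubexp_of_ratio {a : ℕ → ℝ} (ha : ∀ n, 0 < a n)
    (h : Tendsto (fun n => a (n + 1) / a n) atTop (𝓝 1)) : IsSubexp a := by
  intro ρ h0 h1
  refine summable_of_ratio_test_tendsto_lt_one h1
    (Eventually.of_forall fun n => by have := ha n; positivity) ?_
  have := h.mul_const ρ
  rw [one_mul] at this
  refine this.congr fun n => ?_
  have h1 := ha n
  have h2 := ha (n + 1)
  rw [Real.norm_of_nonneg (by positivity), Real.norm_of_nonneg (by positivity),
    abs_of_pos h1, abs_of_pos h2, pow_succ]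
  field_simp

lemma tendsto_natCast_add_div (β : ℝ) :
    Tendsto (fun n : ℕ => ((n : ℝ) + 1) / (n + β + 1)) atTop (𝓝 1) := by
  have := tendsto_add_mul_div_add_mul_atTop_nhds (1 : ℝ) (β + 1) 1 one_ne_zero
  simp only [one_mul, div_one] at this
  refine this.congr fun n => ?_
  ring_nf

lemma isSubexp_laguerreWeight {β : ℝ} (hβ : -1 < β) : IsSubexp (laguerreWeight β) := by
  refine isSubexp_of_ratio (laguerreWeight_pos hβ) ((tendsto_natCast_add_div β).congr fun n => ?_)
  rw [laguerreWeight_succ hβ, mul_div_cancel_left₀ _ (laguerreWeight_pos hβ n).ne']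

lemma isSubexp_inv_laguerreWeight {β : ℝ} (hβ : -1 < β) :
    IsSubexp fun n => (laguerreWeight β n)⁻¹ := by
  refine isSubexp_of_ratio (fun n => inv_pos.2 (laguerreWeight_pos hβ n)) ?_
  have := (tendsto_natCast_add_div β).inv₀ one_ne_zero
  rw [inv_one] at this
  refine this.congr fun n => ?_
  have := (laguerreWeight_pos hβ n).ne'
  rw [laguerreWeight_succ hβ, mul_inv]
  field_simp

/-- The generating function converges on the whole unit disc, and at -|x| its terms are nonnegative
and dominate. -/
lemma isSubexp_laguerrePoly {β : ℝ} (hβ : -1 < β) (x : ℝ) :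
    IsSubexp fun n => laguerrePoly β n x := by
  refine IsSubexp.mono (a := fun n => laguerrePoly β n (-|x|)) ?_ fun n =>
    (abs_laguerrePoly_le hβ x n).trans (le_abs_self _)
  intro ρ h0 h1
  simp_rw [abs_of_nonneg (laguerrePoly_neg_nonneg hβ (abs_nonneg x) _)]
  exact (hasSum_laguerrePoly hβ _ (by rwa [abs_of_pos h0])).summable

/-! ### The Hille–Hardy formula -/

/-- The entire function `∑ v ^ m / (m! Γ(m + β + 1))`, a normalized modified Bessel function. -/
def besselSeries (β v : ℝ) : ℝ := ∑' m : ℕ, v ^ m / (m.factorial * Real.Gamma (m + β + 1))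

/-- Γ(n+1)/Γ(n+β+1) grows more slowly than 2^n, so the terms are dominated by those of exp(2|v|).
Convergence without the extra m! also yields the bound by exp(εv) for every ε in
`exists_besselSeries_le`. -/
lemma summable_pow_div_Gamma {β : ℝ} (hβ : -1 < β) (v : ℝ) :
    Summable fun m : ℕ => v ^ m / Real.Gamma (m + β + 1) := by
  have h := isSubexp_laguerreWeight hβ
  rw [← summable_abs_iff]
  obtain ⟨C, hC⟩ := (h (1 / 2) (by norm_num) (by norm_num)).tendsto_atTop_zero.bddAbove_range
  refine ((hasSum_pow_div_factorial (2 * |v|)).summable.mul_left C).of_nonneg_of_le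
    (fun n => abs_nonneg _) fun n => ?_
  have hn : |laguerreWeight β n| * (1 / 2) ^ n ≤ C := hC ⟨n, rfl⟩
  rw [abs_of_pos (laguerreWeight_pos hβ n)] at hn
  have h1 : 0 < (n : ℝ) + β + 1 := by have := n.cast_nonneg (α := ℝ); linarith
  have hG := Real.Gamma_pos_of_pos h1
  calc |v ^ n / Real.Gamma (n + β + 1)|
      = laguerreWeight β n * (1 / 2) ^ n * ((2 * |v|) ^ n / n.factorial) := by
        rw [abs_div, abs_pow, abs_of_pos hG, laguerreWeight, Real.Gamma_nat_eq_factorial, mul_pow,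
          div_pow, one_pow]
        have : (n.factorial : ℝ) ≠ 0 := by positivity
        field_simp
    _ ≤ _ := by gcongr

lemma summable_besselSeries {β : ℝ} (hβ : -1 < β) (v : ℝ) :
    Summable fun m : ℕ => v ^ m / (m.factorial * Real.Gamma (m + β + 1)) := by
  rw [← summable_abs_iff]
  refine (summable_abs_iff.2 (summable_pow_div_Gamma hβ v)).of_nonneg_of_le
    (fun n => abs_nonneg _) fun n => ?_
  have h1 : 0 < (n : ℝ) + β + 1 := by have := n.cast_nonneg (α := ℝ); linarith
  have hG := Real.Gamma_pos_of_pos h1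
  rw [abs_div, abs_div, abs_mul, Nat.abs_cast]
  have : (1 : ℝ) ≤ n.factorial := by exact_mod_cast n.factorial_pos
  have : 0 < |Real.Gamma (n + β + 1)| := abs_pos.2 hG.ne'
  gcongr
  nlinarith

/-- With n = m + k, the weight 1/Γ(n+β+1) cancels the Gamma factor in the numerator of the Laguerre
term, and what is left separates into a function of m times a function of k. -/
lemma besselSeries_mul_exp_term {β : ℝ} (hβ : -1 < β) (ξ z : ℝ) (m k : ℕ) :
    (-ξ) ^ (m + k) / Real.Gamma ((m + k : ℕ) + β + 1) * laguerreTerm β z (m, k) =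
      (ξ * z) ^ m / (m.factorial * Real.Gamma (m + β + 1)) * ((-ξ) ^ k / k.factorial) := by
  have h1 : 0 < (m : ℝ) + β + 1 := by have := m.cast_nonneg (α := ℝ); linarith
  have h2 : 0 < (m : ℝ) + k + β + 1 := by have := k.cast_nonneg (α := ℝ); linarith
  have h3 := (Real.Gamma_pos_of_pos h1).ne'
  have h4 := (Real.Gamma_pos_of_pos h2).ne'
  rw [laguerreTerm]
  push_cast
  rw [show (k : ℝ) + (m + β + 1) = m + k + β + 1 by ring, pow_add,
    show (ξ * z) ^ m = (-ξ) ^ m * (-z) ^ m by rw [← mul_pow]; ring_nf]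
  field_simp

/-- The right-hand side is a Cauchy product of two entire series, whose antidiagonals reassemble the
Laguerre polynomials. -/
lemma hasSum_laguerrePoly_div_Gamma {β : ℝ} (hβ : -1 < β) (ξ z : ℝ) :
    HasSum (fun n : ℕ => (-ξ) ^ n / Real.Gamma (n + β + 1) * laguerrePoly β n z)
      (Real.exp (-ξ) * besselSeries β (ξ * z)) := by
  have hB : HasSum (fun m : ℕ => (ξ * z) ^ m / (m.factorial * Real.Gamma (m + β + 1)))
    (besselSeries β (ξ * z)) := (summable_besselSeries hβ (ξ * z)).hasSum
  have hE := hasSum_pow_div_factorial (-ξ)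
  have hsum : Summable fun p : ℕ × ℕ => (ξ * z) ^ p.1 /
      (p.1.factorial * Real.Gamma (p.1 + β + 1)) * ((-ξ) ^ p.2 / p.2.factorial) := by
    rw [← summable_abs_iff]
    have := Summable.mul_of_nonneg (summable_abs_iff.2 hB.summable)
      (summable_abs_iff.2 hE.summable) (fun _ => abs_nonneg _) (fun _ => abs_nonneg _)
    simpa only [abs_mul] using this
  have h := hasSum_antidiagonal_of_summable hsum (fun i => hE.mul_left ((ξ * z) ^ i /
    (i.factorial * Real.Gamma (i + β + 1)))) (hB.mul_right (Real.exp (-ξ)))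
  have e : (fun n : ℕ => (-ξ) ^ n / Real.Gamma (n + β + 1) * laguerrePoly β n z) = fun n : ℕ =>
      ∑ p ∈ Finset.HasAntidiagonal.antidiagonal n, (ξ * z) ^ p.1 /
        (p.1.factorial * Real.Gamma (p.1 + β + 1)) * ((-ξ) ^ p.2 / p.2.factorial) := by
    funext n
    rw [laguerrePoly_eq_sum_antidiagonal, Finset.mul_sum]
    refine Finset.sum_congr rfl fun p hp => ?_
    rw [← Finset.HasAntidiagonal.mem_antidiagonal.1 hp]
    exact besselSeries_mul_exp_term hβ ξ z p.1 p.2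
  rw [e, mul_comm (Real.exp (-ξ))]
  exact h

/-- The Taylor expansion of the generating function of the Laguerre polynomials. -/
lemma hasSum_choose_mul_laguerrePoly {β r : ℝ} (hβ : -1 < β) (y : ℝ) (h0 : 0 ≤ r) (h1 : r < 1)
    (i : ℕ) :
    HasSum (fun j => ((i + j).choose i : ℝ) * r ^ j * laguerrePoly β (i + j) y)
      ((1 - r) ^ (-(β + 1)) * Real.exp (-(y * r / (1 - r))) *
        (laguerrePoly β i (y / (1 - r)) / (1 - r) ^ i)) := by
  have hr : 0 < 1 - r := by linarith
  -- By the binomial theorem the absolute values on the n-th antidiagonal add up to at most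
  -- |L_n(-|y|)| (|h| + r)^n, and |h| + r < 1.
  have hsum : ∀ h, |h| < 1 - r → Summable fun p : ℕ × ℕ =>
      ((p.1 + p.2).choose p.1 : ℝ) * r ^ p.2 * laguerrePoly β (p.1 + p.2) y * h ^ p.1 := by
    intro h hh
    have hρ : |(|h| + r)| < 1 := by rw [abs_of_nonneg (by positivity)]; linarith
    apply summable_of_summable_antidiagonal_abs
    refine (summable_abs_iff.2 (hasSum_laguerrePoly hβ (-|y|) hρ).summable).of_nonneg_of_le
      (fun n => Finset.sum_nonneg fun _ _ => abs_nonneg _) fun n => ?_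
    rw [abs_mul, abs_pow, abs_of_nonneg (by positivity : 0 ≤ |h| + r),
      (Commute.all |h| r).add_pow' n, Finset.mul_sum]
    refine Finset.sum_le_sum fun p hp => ?_
    rw [abs_mul, abs_mul, abs_mul, Nat.abs_cast, abs_pow, abs_pow, abs_of_nonneg h0,
      Finset.HasAntidiagonal.mem_antidiagonal.1 hp, nsmul_eq_mul]
    have := (abs_laguerrePoly_le hβ y n).trans (le_abs_self _)
    calc _ = |laguerrePoly β n y| * ((n.choose p.1 : ℝ) * (|h| ^ p.1 * r ^ p.2)) := by ring
      _ ≤ _ := by gcongr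
  have hfib : ∀ i, Summable fun j =>
      ((i + j).choose i : ℝ) * r ^ j * laguerrePoly β (i + j) y := by
    intro i
    -- Any nonzero point of the disc would do: the factor h^i is divided out.
    have h := (hsum ((1 - r) / 2) (by rw [abs_of_pos (by positivity)]; linarith)).prod_factor i
    have h2 := h.mul_right (((1 - r) / 2) ^ i)⁻¹
    refine h2.congr fun j => ?_
    exact mul_inv_cancel_right₀ (by positivity) _
  -- Coefficients of h^i are compared in two expansions of the generating function at h + r: the
  -- binomial expansion of (h + r)^n, and the factorization 1 - (h + r) = (1 - r)(1 - h/(1 - r)),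
  -- which produces a generating function at y/(1 - r) in the variable h/(1 - r).
  have key : (fun i => ∑' j, ((i + j).choose i : ℝ) * r ^ j * laguerrePoly β (i + j) y) =
      fun i => (1 - r) ^ (-(β + 1)) * Real.exp (-(y * r / (1 - r))) *
        (laguerrePoly β i (y / (1 - r)) / (1 - r) ^ i) := by
    refine eq_of_hasSum_powerSeries (f := fun h => (1 - (h + r)) ^ (-(β + 1)) *
      Real.exp (-(y * (h + r) / (1 - (h + r))))) hr (fun h hh => ?_) fun h hh => ?_
    · have hρ : |h + r| < 1 := by
        refine (abs_add_le _ _).trans_lt ?_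
        rw [abs_of_nonneg h0]
        linarith
      refine hasSum_fiberwise_of_summable_antidiagonal (hsum h hh)
        (fun i => (hfib i).hasSum.mul_right (h ^ i)) ?_
      convert! hasSum_laguerrePoly hβ y hρ using 2 with n
      rw [(Commute.all h r).add_pow' n, Finset.mul_sum]
      refine Finset.sum_congr rfl fun p hp => ?_
      rw [Finset.HasAntidiagonal.mem_antidiagonal.1 hp, nsmul_eq_mul]
      ring
    · have hη : |h / (1 - r)| < 1 := by rwa [abs_div, abs_of_pos hr, div_lt_one hr]
      have hlt := (abs_lt.1 hh).2
      have h3 : 0 < 1 - (h + r) := by linarith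
      have e1 : 1 - h / (1 - r) = (1 - (h + r)) / (1 - r) := by field_simp; ring
      convert! (hasSum_laguerrePoly hβ (y / (1 - r)) hη).mul_left
        ((1 - r) ^ (-(β + 1)) * Real.exp (-(y * r / (1 - r)))) using 1
      · funext n
        rw [div_pow]
        ring
      · have e2 : (1 - (h + r)) ^ (-(β + 1)) =
            (1 - r) ^ (-(β + 1)) * ((1 - (h + r)) / (1 - r)) ^ (-(β + 1)) := by
          rw [← Real.mul_rpow hr.le (by positivity), mul_div_cancel₀ _ hr.ne']
        have e3 : -(y * (h + r) / (1 - (h + r))) = -(y * r / (1 - r)) +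
            -(y / (1 - r) * (h / (1 - r)) / ((1 - (h + r)) / (1 - r))) := by
          field_simp
          ring
        rw [e1, e2, e3, Real.exp_add]
        ring
  have := (hfib i).hasSum
  rwa [congrFun key i] at this

lemma summable_laguerreWeight_mul {β r : ℝ} (hβ : -1 < β) (x y : ℝ) (h0 : 0 < r) (h1 : r < 1) :
    Summable fun n => |laguerreWeight β n * (laguerrePoly β n x * laguerrePoly β n y)| * r ^ n :=
  ((isSubexp_laguerreWeight hβ).mul
    ((isSubexp_laguerrePoly hβ x).mul (isSubexp_laguerrePoly hβ y))) r h0 h1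

/-- The **Hille–Hardy formula**. -/
theorem hasSum_hilleHardy {β r : ℝ} (hβ : -1 < β) (x y : ℝ) (h0 : 0 < r) (h1 : r < 1) :
    HasSum (fun n => r ^ n * laguerreWeight β n * (laguerrePoly β n x * laguerrePoly β n y))
      ((1 - r) ^ (-(β + 1)) * Real.exp (-(r * (x + y) / (1 - r))) *
        besselSeries β (x * y * r / (1 - r) ^ 2)) := by
  have hr : 0 < 1 - r := by linarith
  -- Only the polynomial in x is expanded. Row i then sums to a multiple of L_i(y/(1-r)), and the
  -- sum over rows is the series of `hasSum_laguerrePoly_div_Gamma` with ξ = rx/(1-r) and z =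
  -- y/(1-r).
  set f : ℕ × ℕ → ℝ := fun p => (-(r * x)) ^ p.1 / Real.Gamma (p.1 + β + 1) *
    (((p.1 + p.2).choose p.1 : ℝ) * r ^ p.2 * laguerrePoly β (p.1 + p.2) y) with hf
  have hterm : ∀ n, ∀ p ∈ Finset.HasAntidiagonal.antidiagonal n, f p =
      r ^ n * laguerreWeight β n * laguerrePoly β n y * laguerreTerm β x p := by
    intro n p hp
    rw [Finset.HasAntidiagonal.mem_antidiagonal] at hp
    subst hp
    simp only [hf, laguerreTerm, laguerreWeight]
    push_cast
    have h1 : 0 < (p.1 : ℝ) + β + 1 := by have := p.1.cast_nonneg (α := ℝ); linarith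
    have h2 : 0 < (p.1 : ℝ) + p.2 + β + 1 := by have := p.2.cast_nonneg (α := ℝ); linarith
    have := (Real.Gamma_pos_of_pos h1).ne'
    have := (Real.Gamma_pos_of_pos h2).ne'
    have hg : Real.Gamma ((p.1 : ℝ) + p.2 + 1) = (p.1 + p.2).factorial := by
      rw [← Nat.cast_add, Real.Gamma_nat_eq_factorial]
    rw [show (p.2 : ℝ) + (p.1 + β + 1) = p.1 + p.2 + β + 1 by ring, hg,
      ← Nat.add_choose_mul_factorial_mul_factorial, Nat.choose_symm_add,
      pow_add, neg_pow, mul_pow, neg_pow x]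
    push_cast
    field_simp
  have hsum : Summable f := by
    apply summable_of_summable_antidiagonal_abs
    refine (summable_laguerreWeight_mul hβ (-|x|) (-|y|) h0 h1).of_nonneg_of_le
      (fun n => Finset.sum_nonneg fun _ _ => abs_nonneg _) fun n => ?_
    have e : ∑ p ∈ Finset.HasAntidiagonal.antidiagonal n, |f p| = laguerreWeight β n *
        (laguerrePoly β n (-|x|) * |laguerrePoly β n y|) * r ^ n := by
      rw [laguerrePoly_eq_sum_antidiagonal β (-|x|), Finset.sum_mul, Finset.mul_sum,
        Finset.sum_mul]
      refine Finset.sum_congr rfl fun p hp => ?_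
      rw [hterm n p hp, abs_mul, abs_laguerreTerm hβ, abs_mul, abs_mul, abs_pow, abs_of_pos h0,
        abs_of_pos (laguerreWeight_pos hβ n)]
      ring
    have hx := laguerrePoly_neg_nonneg hβ (abs_nonneg x) n
    have hy := laguerrePoly_neg_nonneg hβ (abs_nonneg y) n
    have hw := laguerreWeight_pos hβ n
    have hpos : 0 ≤ laguerreWeight β n * (laguerrePoly β n (-|x|) * laguerrePoly β n (-|y|)) := by
      positivity
    rw [e, abs_of_nonneg hpos]
    gcongr
    exact abs_laguerrePoly_le hβ y n
  have hfib := fun i => (hasSum_choose_mul_laguerrePoly hβ y h0.le h1 i).mul_left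
    ((-(r * x)) ^ i / Real.Gamma (i + β + 1))
  have htot := (hasSum_laguerrePoly_div_Gamma hβ (r * x / (1 - r)) (y / (1 - r))).mul_left
    ((1 - r) ^ (-(β + 1)) * Real.exp (-(y * r / (1 - r))))
  have := hasSum_antidiagonal_of_summable hsum hfib (s := _) (by
    convert! htot using 2 with i
    rw [show -(r * x / (1 - r)) = -(r * x) / (1 - r) by ring, div_pow]
    ring)
  convert! this using 1
  · funext n
    rw [Finset.sum_congr rfl (hterm n), ← Finset.mul_sum, ← laguerrePoly_eq_sum_antidiagonal]
    ring
  · rw [show -(r * (x + y) / (1 - r)) = -(y * r / (1 - r)) + -(r * x / (1 - r)) by ring,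
      Real.exp_add, show x * y * r / (1 - r) ^ 2 = r * x / (1 - r) * (y / (1 - r)) by
        field_simp]
    ring

/-! ### The one-dimensional heat kernel -/

/-- The closed form of the one-dimensional heat kernel. -/
def laguerreKernel₁ (β t x y : ℝ) : ℝ :=
  2 * (2 * Real.sinh (2 * t)) ^ (-(β + 1)) * (x ^ (β + 1 / 2) * y ^ (β + 1 / 2)) *
    Real.exp (-(Real.cosh (2 * t) / (2 * Real.sinh (2 * t)) * (x ^ 2 + y ^ 2))) *
    besselSeries β ((x * y / (2 * Real.sinh (2 * t))) ^ 2)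

lemma hermiteFun₁_mul {β : ℝ} (hβ : -1 < β) (n : ℕ) (x y : ℝ) :
    hermiteFun₁ β n x * hermiteFun₁ β n y =
      2 * (x ^ (β + 1 / 2) * y ^ (β + 1 / 2)) * Real.exp (-((x ^ 2 + y ^ 2) / 2)) *
        (laguerreWeight β n * (laguerrePoly β n (x ^ 2) * laguerrePoly β n (y ^ 2))) := by
  have h2 : √(2 : ℝ) * √2 = 2 := Real.mul_self_sqrt zero_le_two
  have hw := Real.mul_self_sqrt (laguerreWeight_pos hβ n).le
  have he : Real.exp (-((x ^ 2 + y ^ 2) / 2)) = Real.exp (-x ^ 2 / 2) * Real.exp (-y ^ 2 / 2) := by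
    rw [← Real.exp_add]
    ring_nf
  simp only [hermiteFun₁, laguerrePolyNormalized]
  rw [laguerreWeight] at hw ⊢
  rw [he]
  linear_combination (√(Real.Gamma (n + 1) / Real.Gamma (n + β + 1)) *
    √(Real.Gamma (n + 1) / Real.Gamma (n + β + 1)) * laguerrePoly β n (x ^ 2) *
    laguerrePoly β n (y ^ 2) * (x ^ (β + 1 / 2) * y ^ (β + 1 / 2)) * Real.exp (-x ^ 2 / 2) *
    Real.exp (-y ^ 2 / 2)) * h2 + (2 * laguerrePoly β n (x ^ 2) *
    laguerrePoly β n (y ^ 2) * (x ^ (β + 1 / 2) * y ^ (β + 1 / 2)) * Real.exp (-x ^ 2 / 2) *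
    Real.exp (-y ^ 2 / 2)) * hw

/-- Hille–Hardy at (x², y²) with r = u², u = e^(-2t). The identity 1 - u² = 2u sinh(2t) turns the
result into hyperbolic functions, and the powers of u cancel. -/
lemma hasSum_laguerreKernel₁ {β t : ℝ} (hβ : -1 < β) (ht : 0 < t) (x y : ℝ) :
    HasSum (fun n : ℕ => Real.exp (-t * (4 * n + 2 * β + 2)) *
      (hermiteFun₁ β n x * hermiteFun₁ β n y)) (laguerreKernel₁ β t x y) := by
  have hs : 0 < Real.sinh (2 * t) := Real.sinh_pos_iff.2 (by linarith)
  set s := Real.sinh (2 * t) with hs'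
  set c := Real.cosh (2 * t) with hc'
  set u := Real.exp (-(2 * t)) with hu'
  have hu : 0 < u := Real.exp_pos _
  have hu1 : u < 1 := (Real.exp_lt_exp.2 (by linarith : -(2 * t) < 0)).trans_eq Real.exp_zero
  have huinv : Real.exp (2 * t) * u = 1 := by rw [hu', ← Real.exp_add]; simp
  have e1 : 1 - u ^ 2 = u * (2 * s) := by
    rw [hs', Real.sinh_eq, ← hu']; linear_combination -huinv
  have hr1 : u ^ 2 < 1 := by nlinarith
  have h := (hasSum_hilleHardy hβ (x ^ 2) (y ^ 2) (by positivity : 0 < u ^ 2) hr1).mul_left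
    (u ^ (β + 1) * (2 * (x ^ (β + 1 / 2) * y ^ (β + 1 / 2)) * Real.exp (-((x ^ 2 + y ^ 2) / 2))))
  convert! h using 1
  · funext n
    rw [hermiteFun₁_mul hβ]
    have : Real.exp (-t * (4 * n + 2 * β + 2)) = u ^ (β + 1) * (u ^ 2) ^ n := by
      rw [hu', ← Real.exp_mul, ← Real.exp_nat_mul, ← Real.exp_nat_mul, ← Real.exp_add]
      push_cast
      ring_nf
    rw [this]
    ring
  · rw [e1, laguerreKernel₁, ← hs', ← hc', Real.mul_rpow hu.le (by positivity)]
    have e3 : u ^ (β + 1) * u ^ (-(β + 1)) = 1 := by rw [← Real.rpow_add hu]; simp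
    have e4 : Real.exp (-(c / (2 * s) * (x ^ 2 + y ^ 2))) = Real.exp (-((x ^ 2 + y ^ 2) / 2)) *
        Real.exp (-(u ^ 2 * (x ^ 2 + y ^ 2) / (u * (2 * s)))) := by
      rw [← Real.exp_add]
      congr 1
      field_simp
      linear_combination -(x ^ 2 + y ^ 2) * Real.cosh_sub_sinh (2 * t)
    have e5 : (x * y / (2 * s)) ^ 2 = x ^ 2 * y ^ 2 * u ^ 2 / (u * (2 * s)) ^ 2 := by
      field_simp
    rw [e4, e5]
    linear_combination -(2 * (2 * s) ^ (-(β + 1)) * (x ^ (β + 1 / 2) * y ^ (β + 1 / 2)) *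
      (Real.exp (-((x ^ 2 + y ^ 2) / 2)) *
        Real.exp (-(u ^ 2 * (x ^ 2 + y ^ 2) / (u * (2 * s))))) *
      besselSeries β (x ^ 2 * y ^ 2 * u ^ 2 / (u * (2 * s)) ^ 2)) * e3

lemma isSubexp_hermiteFun₁ {β : ℝ} (hβ : -1 < β) (x : ℝ) :
    IsSubexp fun n => hermiteFun₁ β n x := by
  have h := (isSubexp_laguerreWeight hβ).sqrt.mul (isSubexp_laguerrePoly hβ (x ^ 2))
  intro ρ h0 h1
  refine ((h ρ h0 h1).mul_left |√2 * x ^ (β + 1 / 2) * Real.exp (-x ^ 2 / 2)|).congr fun n => ?_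
  rw [← mul_assoc, ← abs_mul]
  congr 2
  simp only [hermiteFun₁, laguerrePolyNormalized, laguerreWeight]
  ring

lemma laguerreKernel₁_comm (β t x y : ℝ) : laguerreKernel₁ β t x y = laguerreKernel₁ β t y x := by
  simp only [laguerreKernel₁, mul_comm x y, add_comm (x ^ 2), mul_comm (x ^ (β + 1 / 2))]

lemma besselSeries_nonneg {β v : ℝ} (hβ : -1 < β) (hv : 0 ≤ v) : 0 ≤ besselSeries β v := by
  refine tsum_nonneg fun m => ?_
  have h1 : 0 < (m : ℝ) + β + 1 := by have := m.cast_nonneg (α := ℝ); linarith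
  have := Real.Gamma_pos_of_pos h1
  positivity

lemma laguerreKernel₁_nonneg {β t x y : ℝ} (hβ : -1 < β) (ht : 0 < t) (hx : 0 ≤ x) (hy : 0 ≤ y) :
    0 ≤ laguerreKernel₁ β t x y := by
  have hs : 0 < Real.sinh (2 * t) := Real.sinh_pos_iff.2 (by linarith)
  have := besselSeries_nonneg hβ (sq_nonneg (x * y / (2 * Real.sinh (2 * t))))
  rw [laguerreKernel₁]
  positivity

lemma measurable_besselSeries {β : ℝ} (hβ : -1 < β) : Measurable (besselSeries β) := by
  refine measurable_of_tendsto_metrizable (f := fun n v => ∑ m ∈ Finset.range n,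
    v ^ m / (m.factorial * Real.Gamma (m + β + 1))) (fun n => by fun_prop) ?_
  rw [tendsto_pi_nhds]
  exact fun v => (summable_besselSeries hβ v).hasSum.tendsto_sum_nat

lemma measurable_laguerreKernel₁ {β : ℝ} (hβ : -1 < β) (t : ℝ) :
    Measurable fun p : ℝ × ℝ => laguerreKernel₁ β t p.1 p.2 := by
  have h := measurable_besselSeries hβ
  unfold laguerreKernel₁
  fun_prop

/-- The quantities ε^(-m)/Γ(m+β+1) are bounded in m, so the series is dominated termwise by C
exp(εv). Arbitrarily small ε is needed because v is quadratic in y, and the bound has to be absorbed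
by a Gaussian in y. -/
lemma exists_besselSeries_le {β ε : ℝ} (hβ : -1 < β) (hε : 0 < ε) :
    ∃ C, 0 ≤ C ∧ ∀ v, 0 ≤ v → besselSeries β v ≤ C * Real.exp (ε * v) := by
  obtain ⟨C, hC⟩ := (summable_pow_div_Gamma hβ ε⁻¹).tendsto_atTop_zero.bddAbove_range
  have hC' : ∀ m : ℕ, ε⁻¹ ^ m / Real.Gamma (m + β + 1) ≤ C := fun m => hC ⟨m, rfl⟩
  have hG : ∀ m : ℕ, 0 < Real.Gamma (m + β + 1) := fun m =>
    Real.Gamma_pos_of_pos (by have := m.cast_nonneg (α := ℝ); linarith)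
  refine ⟨C, (div_pos (pow_pos (inv_pos.2 hε) 0) (hG 0)).le.trans (hC' 0), fun v hv => ?_⟩
  have h := (hasSum_pow_div_factorial (ε * v)).mul_left C
  rw [besselSeries, ← h.tsum_eq]
  refine (summable_besselSeries hβ v).tsum_le_tsum (fun m => ?_) h.summable
  calc v ^ m / (m.factorial * Real.Gamma (m + β + 1))
      = ε⁻¹ ^ m / Real.Gamma (m + β + 1) * ((ε * v) ^ m / m.factorial) := by
        have := (hG m).ne'
        rw [mul_pow, inv_pow]
        field_simp
    _ ≤ _ := by gcongr; exact hC' m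

lemma exists_rpow_mul_exp_le {p κ : ℝ} (hp : 0 ≤ p) (hκ : 0 < κ) :
    ∃ M, ∀ y : ℝ, 0 < y → y ^ p * Real.exp (-(κ * y ^ 2)) ≤ M := by
  obtain ⟨k, hk⟩ := exists_nat_ge p
  refine ⟨1 + k.factorial / κ ^ k, fun y hy => ?_⟩
  have h1 : y ^ p ≤ 1 + (y ^ 2) ^ k := by
    rcases le_total y 1 with h | h
    · have := Real.rpow_le_one hy.le h hp
      have : 0 ≤ (y ^ 2) ^ k := by positivity
      linarith
    · calc y ^ p ≤ y ^ ((2 * k : ℕ) : ℝ) := by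
            apply Real.rpow_le_rpow_of_exponent_le h
            push_cast
            linarith
        _ = (y ^ 2) ^ k := by rw [Real.rpow_natCast, pow_mul]
        _ ≤ _ := by linarith
  have h2 : (y ^ 2) ^ k ≤ k.factorial / κ ^ k * Real.exp (κ * y ^ 2) := by
    have := Real.pow_div_factorial_le_exp (x := κ * y ^ 2) (by positivity) k
    rw [mul_pow, div_le_iff₀ (by positivity)] at this
    rw [div_mul_eq_mul_div, le_div_iff₀ (by positivity)]
    linarith
  have h3 : Real.exp (-(κ * y ^ 2)) ≤ 1 := by
    rw [Real.exp_le_one_iff]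
    have : 0 ≤ κ * y ^ 2 := by positivity
    linarith
  have h4 : Real.exp (κ * y ^ 2) * Real.exp (-(κ * y ^ 2)) = 1 := by rw [← Real.exp_add]; simp
  calc y ^ p * Real.exp (-(κ * y ^ 2))
      ≤ (1 + k.factorial / κ ^ k * Real.exp (κ * y ^ 2)) * Real.exp (-(κ * y ^ 2)) := by
        gcongr
        linarith
    _ = Real.exp (-(κ * y ^ 2)) + k.factorial / κ ^ k := by rw [add_mul, mul_assoc, h4]; ring
    _ ≤ _ := by linarith

lemma exists_laguerreKernel₁_le {β t x : ℝ} (hβ : -1 / 2 ≤ β) (ht : 0 < t) (hx : 0 < x) :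
    ∃ M, 0 ≤ M ∧ ∀ y, 0 < y → laguerreKernel₁ β t x y ≤ M := by
  have hs : 0 < Real.sinh (2 * t) := Real.sinh_pos_iff.2 (by linarith)
  have hc := Real.cosh_pos (2 * t)
  set s := Real.sinh (2 * t) with hs'
  set c := Real.cosh (2 * t) with hc'
  -- This ε makes ε (xy/(2s))² equal to (c/(4s)) y², half of the Gaussian exponent in y. The other
  -- half controls y^(β+1/2), whose exponent is nonnegative since β ≥ -1/2.
  obtain ⟨C, hC0, hC⟩ := exists_besselSeries_le (β := β) (by linarith)
    (by positivity : 0 < c / (4 * s) / (x / (2 * s)) ^ 2)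
  obtain ⟨M, hM⟩ := exists_rpow_mul_exp_le (p := β + 1 / 2) (by linarith)
    (by positivity : 0 < c / (4 * s))
  have hM0 : 0 ≤ M := le_trans (by positivity) (hM 1 one_pos)
  refine ⟨2 * (2 * s) ^ (-(β + 1)) * x ^ (β + 1 / 2) * C * M, by positivity, fun y hy => ?_⟩
  have h1 := hC ((x * y / (2 * s)) ^ 2) (by positivity)
  have h2 : Real.exp (-(c / (2 * s) * (x ^ 2 + y ^ 2))) *
      Real.exp (c / (4 * s) / (x / (2 * s)) ^ 2 * (x * y / (2 * s)) ^ 2) ≤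
      Real.exp (-(c / (4 * s) * y ^ 2)) := by
    rw [← Real.exp_add, Real.exp_le_exp]
    have e : c / (4 * s) / (x / (2 * s)) ^ 2 * (x * y / (2 * s)) ^ 2 = c / (4 * s) * y ^ 2 := by
      field_simp
    have e2 : c / (2 * s) = 2 * (c / (4 * s)) := by field_simp; norm_num
    rw [e, e2]
    have : 0 ≤ c / (4 * s) * x ^ 2 := by positivity
    nlinarith
  rw [laguerreKernel₁, ← hs', ← hc']
  calc _ ≤ 2 * (2 * s) ^ (-(β + 1)) * (x ^ (β + 1 / 2) * y ^ (β + 1 / 2)) *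
        Real.exp (-(c / (2 * s) * (x ^ 2 + y ^ 2))) *
        (C * Real.exp (c / (4 * s) / (x / (2 * s)) ^ 2 * (x * y / (2 * s)) ^ 2)) := by gcongr
    _ = 2 * (2 * s) ^ (-(β + 1)) * x ^ (β + 1 / 2) * C * (y ^ (β + 1 / 2) *
        (Real.exp (-(c / (2 * s) * (x ^ 2 + y ^ 2))) *
        Real.exp (c / (4 * s) / (x / (2 * s)) ^ 2 * (x * y / (2 * s)) ^ 2))) := by ring
    _ ≤ 2 * (2 * s) ^ (-(β + 1)) * x ^ (β + 1 / 2) * C * (y ^ (β + 1 / 2) *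
        Real.exp (-(c / (4 * s) * y ^ 2))) := by gcongr
    _ ≤ _ := by
      gcongr
      exact hM y hy

/-! ### The mass of the kernel -/

/-- The function `e^{-w} ∑ w^{m+a} Γ(m + a + 1/2) / (m! Γ(m + 2a + 1/2))`. -/
def laguerreMass (a w : ℝ) : ℝ≥0∞ :=
  ∑' m : ℕ, ENNReal.ofReal (Real.exp (-w) * w ^ (m + a) * Real.Gamma (m + a + 1 / 2) /
    (m.factorial * Real.Gamma (m + 2 * a + 1 / 2)))

lemma lintegral_rpow_mul_exp_neg_mul_sq {q b : ℝ} (hq : -1 < q) (hb : 0 < b) :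
    ∫⁻ y in Ioi (0 : ℝ), ENNReal.ofReal (y ^ q * Real.exp (-(b * y ^ 2))) =
      ENNReal.ofReal (b ^ (-((q + 1) / 2)) * (1 / 2) * Real.Gamma ((q + 1) / 2)) := by
  have h := integral_rpow_mul_exp_neg_mul_rpow (p := 2) two_pos hq hb
  have hi := integrableOn_rpow_mul_exp_neg_mul_sq hb hq
  rw [← ofReal_integral_eq_lintegral_ofReal]
  · rw [← neg_div, ← h]
    congr 1
    refine setIntegral_congr_fun measurableSet_Ioi fun y _ => ?_
    simp [neg_mul]
  · simpa [neg_mul, IntegrableOn] using hi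
  · filter_upwards [ae_restrict_mem measurableSet_Ioi] with y hy
    have : 0 < y := hy
    positivity

/-- Here w = x²/(2sc) appears as the natural variable: c x²/(2s) = c² w, and c² = 1 + s² splits the
Gaussian into e^(-w) and the correction e^(-s² w). -/
lemma laguerreKernel₁_mass_term {a s c x : ℝ} (hs : 0 < s) (hc : 0 < c) (hsc : c ^ 2 = 1 + s ^ 2)
    (hx : 0 < x) (m : ℕ) :
    2 * (2 * s) ^ (-(2 * a + 1 / 2)) * x ^ (2 * a) * Real.exp (-(c / (2 * s) * x ^ 2)) *
      (x / (2 * s)) ^ (2 * m) * ((c / (2 * s)) ^ (-(m + a + 1 / 2)) * (1 / 2)) =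
    c ^ (-1 / 2 : ℝ) * Real.exp (-(s ^ 2 * (x ^ 2 / (2 * s * c)))) *
      (Real.exp (-(x ^ 2 / (2 * s * c))) * (x ^ 2 / (2 * s * c)) ^ (m + a)) := by
  have hS : 0 < 2 * s := by positivity
  have e : Real.exp (-(c / (2 * s) * x ^ 2)) = Real.exp (-(s ^ 2 * (x ^ 2 / (2 * s * c)))) *
      Real.exp (-(x ^ 2 / (2 * s * c))) := by
    rw [← Real.exp_add]
    congr 1
    field_simp
    linear_combination -hsc
  have e2 : 2 * (2 * s) ^ (-(2 * a + 1 / 2)) * x ^ (2 * a) * (x / (2 * s)) ^ (2 * m) *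
      ((c / (2 * s)) ^ (-(m + a + 1 / 2)) * (1 / 2)) =
      c ^ (-1 / 2 : ℝ) * (x ^ 2 / (2 * s * c)) ^ (m + a) := by
    -- With every power written as the exponential of a logarithm, the claim becomes a polynomial
    -- identity in log x, log(2s), log c, m and a.
    rw [← Real.rpow_natCast (x / (2 * s)), Real.rpow_def_of_pos hS, Real.rpow_def_of_pos hx,
      Real.rpow_def_of_pos (by positivity : 0 < x / (2 * s)),
      Real.rpow_def_of_pos (by positivity : 0 < c / (2 * s)),
      Real.rpow_def_of_pos (by positivity : 0 < x ^ 2 / (2 * s * c)), Real.rpow_def_of_pos hc,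
      Real.log_div hx.ne' hS.ne', Real.log_div hc.ne' hS.ne',
      Real.log_div (by positivity) (by positivity), Real.log_mul hS.ne' hc.ne', Real.log_pow]
    rw [show ∀ A B C D : ℝ, 2 * Real.exp A * Real.exp B * Real.exp C * (Real.exp D * (1 / 2)) =
      Real.exp (A + B + C + D) by intros; simp only [Real.exp_add]; ring, ← Real.exp_add]
    congr 1
    push_cast
    ring
  rw [e]
  linear_combination Real.exp (-(s ^ 2 * (x ^ 2 / (2 * s * c)))) *
    Real.exp (-(x ^ 2 / (2 * s * c))) * e2

/-- All terms of the Bessel series are nonnegative, so each is integrated separately against the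
Gaussian. For fixed w the prefactor tends to 1 as t → 0, so `laguerreMass` alone decides
contractivity. -/
lemma lintegral_laguerreKernel₁ {β t x : ℝ} (hβ : -1 / 2 ≤ β) (ht : 0 < t) (hx : 0 < x) :
    ∫⁻ y in Ioi (0 : ℝ), ENNReal.ofReal (laguerreKernel₁ β t x y) =
      ENNReal.ofReal (Real.cosh (2 * t) ^ (-1 / 2 : ℝ) * Real.exp (-(Real.sinh (2 * t) ^ 2 *
        (x ^ 2 / (2 * Real.sinh (2 * t) * Real.cosh (2 * t)))))) *
      laguerreMass (β / 2 + 1 / 4) (x ^ 2 / (2 * Real.sinh (2 * t) * Real.cosh (2 * t))) := by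
  have hs : 0 < Real.sinh (2 * t) := Real.sinh_pos_iff.2 (by linarith)
  have hc := Real.cosh_pos (2 * t)
  have hsc := Real.cosh_sq' (2 * t)
  set s := Real.sinh (2 * t) with hs'
  set c := Real.cosh (2 * t) with hc'
  have hG : ∀ m : ℕ, 0 < Real.Gamma (m + β + 1) := fun m =>
    Real.Gamma_pos_of_pos (by have := m.cast_nonneg (α := ℝ); linarith)
  set A := 2 * (2 * s) ^ (-(β + 1)) * x ^ (β + 1 / 2) * Real.exp (-(c / (2 * s) * x ^ 2)) with hA
  have hA0 : 0 ≤ A := by positivity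
  have h1 : ∀ y ∈ Ioi (0 : ℝ), ENNReal.ofReal (laguerreKernel₁ β t x y) =
      ∑' m : ℕ, ENNReal.ofReal (A * ((x / (2 * s)) ^ (2 * m) /
        (m.factorial * Real.Gamma (m + β + 1)))) *
        ENNReal.ofReal (y ^ (2 * m + β + 1 / 2) * Real.exp (-(c / (2 * s) * y ^ 2))) := by
    intro y hy
    have hy : 0 < y := hy
    have hsum := (summable_besselSeries (by linarith : -1 < β) ((x * y / (2 * s)) ^ 2)).mul_left
      (2 * (2 * s) ^ (-(β + 1)) * (x ^ (β + 1 / 2) * y ^ (β + 1 / 2)) *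
    Real.exp (-(c / (2 * s) * (x ^ 2 + y ^ 2))))
    rw [laguerreKernel₁, ← hs', ← hc', besselSeries, ← tsum_mul_left,
      ENNReal.ofReal_tsum_of_nonneg (fun m => by have := hG m; positivity) hsum]
    refine tsum_congr fun m => ?_
    rw [← ENNReal.ofReal_mul (by have := hG m; positivity)]
    congr 1
    have e1 : y ^ (2 * m + β + 1 / 2) = y ^ (β + 1 / 2) * y ^ (2 * m) := by
      rw [show (2 * (m : ℝ) + β + 1 / 2) = (β + 1 / 2) + ((2 * m : ℕ) : ℝ) by push_cast; ring,
        Real.rpow_add hy, Real.rpow_natCast]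
    have e2 : Real.exp (-(c / (2 * s) * (x ^ 2 + y ^ 2))) =
        Real.exp (-(c / (2 * s) * x ^ 2)) * Real.exp (-(c / (2 * s) * y ^ 2)) := by
      rw [← Real.exp_add]
      ring_nf
    have e3 : ((x * y / (2 * s)) ^ 2) ^ m = (x / (2 * s)) ^ (2 * m) * y ^ (2 * m) := by
      rw [← pow_mul, ← mul_pow]
      ring_nf
    rw [e1, e2, e3, hA]
    ring
  rw [setLIntegral_congr_fun measurableSet_Ioi h1, lintegral_tsum fun m => by fun_prop,
    laguerreMass, ← ENNReal.tsum_mul_left]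
  refine tsum_congr fun m => ?_
  rw [lintegral_const_mul _ (by fun_prop), lintegral_rpow_mul_exp_neg_mul_sq
    (by have := m.cast_nonneg (α := ℝ); linarith) (by positivity),
    ← ENNReal.ofReal_mul (by have := hG m; positivity), ← ENNReal.ofReal_mul (by positivity)]
  congr 1
  have key := laguerreKernel₁_mass_term (a := β / 2 + 1 / 4) hs hc hsc hx m
  rw [show 2 * (β / 2 + 1 / 4) + 1 / 2 = β + 1 by ring,
    show 2 * (β / 2 + 1 / 4) = β + 1 / 2 by ring] at key
  rw [show (2 * (m : ℝ) + β + 1 / 2 + 1) / 2 = m + (β / 2 + 1 / 4) + 1 / 2 by ring,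
    show (m : ℝ) + 2 * (β / 2 + 1 / 4) + 1 / 2 = m + β + 1 by ring, hA]
  linear_combination Real.Gamma (m + (β / 2 + 1 / 4) + 1 / 2) /
    (m.factorial * Real.Gamma (m + β + 1)) * key

/-! ### Estimates of the mass -/

/-- This is the case β = -1/2: the Gamma factors cancel and the exponential series remains. -/
lemma laguerreMass_zero {w : ℝ} (hw : 0 ≤ w) : laguerreMass 0 w = 1 := by
  have h := (hasSum_pow_div_factorial w).mul_left (Real.exp (-w))
  have hG : ∀ m : ℕ, 0 < Real.Gamma (m + 1 / 2) := fun m => Real.Gamma_pos_of_pos (by positivity)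
  have e : laguerreMass 0 w = ∑' m : ℕ, ENNReal.ofReal (Real.exp (-w) * (w ^ m / m.factorial)) := by
    refine tsum_congr fun m => ?_
    congr 1
    have := (hG m).ne'
    simp only [mul_zero, add_zero, Real.rpow_natCast]
    field_simp
  rw [e, ← ENNReal.ofReal_tsum_of_nonneg (fun m => by positivity) h.summable, h.tsum_eq,
    ← Real.exp_add]
  simp

/-- Obtained from the normalization of the Beta probability density. -/
lemma lintegral_beta {a b : ℝ} (ha : 0 < a) (hb : 0 < b) :
    ∫⁻ s in Ioo (0 : ℝ) 1, ENNReal.ofReal (s ^ (a - 1) * (1 - s) ^ (b - 1)) =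
      ENNReal.ofReal (ProbabilityTheory.beta a b) := by
  have h := ProbabilityTheory.lintegral_betaPDF_eq_one ha hb
  have hB := ProbabilityTheory.beta_pos ha hb
  rw [ProbabilityTheory.lintegral_betaPDF] at h
  simp_rw [mul_assoc, ENNReal.ofReal_mul (one_div_pos.2 hB).le] at h
  rw [lintegral_const_mul _ (by fun_prop)] at h
  rw [one_div, ENNReal.ofReal_inv_of_pos hB] at h
  have := ENNReal.eq_inv_of_mul_eq_one_left ((mul_comm _ _).trans h)
  rwa [inv_inv] at this

/-- Γ(a)Γ(m+a+1/2)/Γ(m+2a+1/2) is the Beta integral B(a, m+a+1/2); summing over m under the integral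
rebuilds exp(w(1-s)). The sign of a - 1/2 now decides whether the last factor is below or above 1.
-/
lemma laguerreMass_eq_lintegral {a w : ℝ} (ha : 0 < a) (hw : 0 < w) :
    laguerreMass a w = ENNReal.ofReal (Real.Gamma a)⁻¹ * ∫⁻ s in Ioo (0 : ℝ) 1,
      ENNReal.ofReal (w ^ a * Real.exp (-(w * s)) * s ^ (a - 1) * (1 - s) ^ (a - 1 / 2)) := by
  have hGa := Real.Gamma_pos_of_pos ha
  have h1 : ∀ s ∈ Ioo (0 : ℝ) 1,
      ENNReal.ofReal (w ^ a * Real.exp (-(w * s)) * s ^ (a - 1) * (1 - s) ^ (a - 1 / 2)) =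
      ∑' m : ℕ, ENNReal.ofReal (Real.exp (-w) * w ^ (m + a) / m.factorial) *
        ENNReal.ofReal (s ^ (a - 1) * (1 - s) ^ (m + a + 1 / 2 - 1)) := by
    intro s hs
    have hs0 : 0 < s := hs.1
    have hs1 : 0 < 1 - s := by linarith [hs.2]
    have h := (hasSum_pow_div_factorial (w * (1 - s))).mul_left
      (w ^ a * Real.exp (-w) * s ^ (a - 1) * (1 - s) ^ (a - 1 / 2))
    rw [show w ^ a * Real.exp (-(w * s)) * s ^ (a - 1) * (1 - s) ^ (a - 1 / 2) =
      w ^ a * Real.exp (-w) * s ^ (a - 1) * (1 - s) ^ (a - 1 / 2) * Real.exp (w * (1 - s)) by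
        rw [show -(w * s) = -w + w * (1 - s) by ring, Real.exp_add]; ring, ← h.tsum_eq,
      ENNReal.ofReal_tsum_of_nonneg (fun m => by positivity) h.summable]
    refine tsum_congr fun m => ?_
    rw [← ENNReal.ofReal_mul (by positivity)]
    congr 1
    rw [show (m : ℝ) + a + 1 / 2 - 1 = (a - 1 / 2) + m by ring, Real.rpow_add_natCast hs1.ne',
      show (m : ℝ) + a = a + m by ring, Real.rpow_add_natCast hw.ne', mul_pow]
    ring
  rw [setLIntegral_congr_fun measurableSet_Ioo h1, lintegral_tsum fun m => by fun_prop,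
    laguerreMass, ← ENNReal.tsum_mul_left]
  refine tsum_congr fun m => ?_
  rw [lintegral_const_mul _ (by fun_prop), lintegral_beta ha (by positivity),
    ← ENNReal.ofReal_mul (by positivity), ← ENNReal.ofReal_mul (by positivity),
    ProbabilityTheory.beta, show a + (m + a + 1 / 2) = m + 2 * a + 1 / 2 by ring]
  congr 1
  have : 0 < Real.Gamma (m + 2 * a + 1 / 2) := Real.Gamma_pos_of_pos (by positivity)
  field_simp

lemma integrableOn_rpow_mul_exp_neg_mul {a w : ℝ} (ha : 0 < a) (hw : 0 < w) :
    IntegrableOn (fun s : ℝ => s ^ (a - 1) * Real.exp (-(w * s))) (Ioi 0) := by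
  have := integrableOn_rpow_mul_exp_neg_mul_rpow (p := 1) (s := a - 1) (by linarith) one_pos hw
  simpa [neg_mul] using this

lemma lintegral_rpow_mul_exp_neg_mul {a w : ℝ} (ha : 0 < a) (hw : 0 < w) :
    ∫⁻ s in Ioi (0 : ℝ), ENNReal.ofReal (w ^ a * Real.exp (-(w * s)) * s ^ (a - 1)) =
      ENNReal.ofReal (Real.Gamma a) := by
  have h := Real.integral_rpow_mul_exp_neg_mul_Ioi ha hw
  rw [← ofReal_integral_eq_lintegral_ofReal]
  · simp_rw [show ∀ s : ℝ, w ^ a * Real.exp (-(w * s)) * s ^ (a - 1) =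
      w ^ a * (s ^ (a - 1) * Real.exp (-(w * s))) by intro s; ring]
    rw [integral_const_mul, h, one_div, ← mul_assoc, ← Real.mul_rpow hw.le (by positivity),
      mul_inv_cancel₀ hw.ne', Real.one_rpow, one_mul]
  · refine ((integrableOn_rpow_mul_exp_neg_mul ha hw).const_mul (w ^ a)).congr ?_
    exact Eventually.of_forall fun s => by ring
  · filter_upwards [ae_restrict_mem measurableSet_Ioi] with s hs
    have : 0 < s := hs
    positivity

/-- For a ≥ 1/2 the factor (1-s)^(a-1/2) can be dropped, and enlarging the domain to (0, ∞) gives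
exactly the integral for Γ(a). -/
lemma laguerreMass_le_one {a w : ℝ} (ha : 1 / 2 ≤ a) (hw : 0 < w) : laguerreMass a w ≤ 1 := by
  have ha0 : 0 < a := by linarith
  have hGa := Real.Gamma_pos_of_pos ha0
  rw [laguerreMass_eq_lintegral ha0 hw]
  calc _ ≤ ENNReal.ofReal (Real.Gamma a)⁻¹ * ∫⁻ s in Ioi (0 : ℝ),
        ENNReal.ofReal (w ^ a * Real.exp (-(w * s)) * s ^ (a - 1)) := by
        refine mul_le_mul_right ?_ _
        refine (setLIntegral_mono' measurableSet_Ioo fun s hs => ?_).trans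
          (lintegral_mono_set (Ioo_subset_Ioi_self (α := ℝ) (b := 0) (a := 1)))
        have hs0 : 0 < s := hs.1
        apply ENNReal.ofReal_le_ofReal
        apply mul_le_of_le_one_right (by positivity)
        exact Real.rpow_le_one (by linarith [hs.2]) (by linarith) (by linarith)
    _ = 1 := by
        rw [lintegral_rpow_mul_exp_neg_mul ha0 hw, ← ENNReal.ofReal_mul (by positivity),
          inv_mul_cancel₀ hGa.ne', ENNReal.ofReal_one]

lemma rpow_mul_exp_neg_le_one {a v : ℝ} (ha0 : 0 ≤ a) (ha1 : a ≤ 1) (hv : 0 < v) :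
    v ^ a * Real.exp (-v) ≤ 1 := by
  have h1 : v ^ a ≤ Real.exp v := by
    refine le_trans ?_ (Real.add_one_le_exp v)
    rcases le_total v 1 with h | h
    · have := Real.rpow_le_one hv.le h ha0
      linarith
    · have := Real.rpow_le_rpow_of_exponent_le h ha1
      rw [Real.rpow_one] at this
      linarith
  rw [Real.exp_neg, ← div_eq_mul_inv, div_le_one (Real.exp_pos v)]
  exact h1

lemma exists_laguerreMass_le {a : ℝ} (ha : 0 ≤ a) :
    ∃ C : ℝ, 1 ≤ C ∧ ∀ w, 0 < w → laguerreMass a w ≤ ENNReal.ofReal C := by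
  rcases ha.eq_or_lt with rfl | ha
  · exact ⟨1, le_rfl, fun w hw => by simp [laguerreMass_zero hw.le]⟩
  rcases le_total (1 / 2) a with h2 | h2
  · exact ⟨1, le_rfl, fun w hw => by simpa using laguerreMass_le_one h2 hw⟩
  have hGa := Real.Gamma_pos_of_pos ha
  have hB := ProbabilityTheory.beta_pos one_pos (by positivity : 0 < a + 1 / 2)
  -- The 1 is the contribution of the Gamma integral; the Beta term pays for the singularity of
  -- (1-s)^(a-1/2) at s = 1.
  refine ⟨1 + (Real.Gamma a)⁻¹ * ProbabilityTheory.beta 1 (a + 1 / 2),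
    le_add_of_nonneg_right (by positivity), fun w hw => ?_⟩
  rw [laguerreMass_eq_lintegral ha hw, show 1 + (Real.Gamma a)⁻¹ *
    ProbabilityTheory.beta 1 (a + 1 / 2) = (Real.Gamma a)⁻¹ * (Real.Gamma a +
    ProbabilityTheory.beta 1 (a + 1 / 2)) by field_simp, ENNReal.ofReal_mul (by positivity),
    ENNReal.ofReal_add hGa.le hB.le]
  refine mul_le_mul_right ?_ _
  rw [← lintegral_beta one_pos (by positivity), ← lintegral_rpow_mul_exp_neg_mul ha hw]
  refine le_trans ?_ (add_le_add_left (lintegral_mono_set (Ioo_subset_Ioi_self (α := ℝ) (b := 0) (a := 1))) _)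
  rw [← lintegral_add_left (by fun_prop)]
  refine setLIntegral_mono' measurableSet_Ioo fun s hs => ?_
  have hs0 : 0 < s := hs.1
  have hs1 : 0 < 1 - s := by linarith [hs.2]
  rw [← ENNReal.ofReal_add (by positivity) (by positivity)]
  apply ENNReal.ofReal_le_ofReal
  rw [sub_self, Real.rpow_zero, one_mul, show a + 1 / 2 - 1 = a - 1 / 2 by ring]
  -- The singular part acquires a factor s, which turns w^a s^(a-1) e^(-ws) into (ws)^a e^(-ws) ≤ 1,
  -- uniformly in w.
  have h3 : (1 - s) ^ (a - 1 / 2) ≤ 1 + s * (1 - s) ^ (a - 1 / 2) := by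
    have : (1 - s) * (1 - s) ^ (a - 1 / 2) ≤ 1 := by
      rw [mul_comm, ← Real.rpow_add_one hs1.ne']
      exact Real.rpow_le_one hs1.le (by linarith) (by linarith)
    linarith
  have h4 := rpow_mul_exp_neg_le_one ha.le (by linarith : a ≤ 1) (mul_pos hw hs0)
  have h5 : s ^ (a - 1) * s = s ^ a := by rw [← Real.rpow_add_one hs0.ne']; ring_nf
  rw [Real.mul_rpow hw.le hs0.le] at h4
  have h6 : 0 ≤ (1 - s) ^ (a - 1 / 2) := by positivity
  calc _ ≤ w ^ a * Real.exp (-(w * s)) * s ^ (a - 1) * (1 + s * (1 - s) ^ (a - 1 / 2)) := by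
        gcongr
    _ = w ^ a * Real.exp (-(w * s)) * s ^ (a - 1) +
        w ^ a * (s ^ (a - 1) * s) * Real.exp (-(w * s)) * (1 - s) ^ (a - 1 / 2) := by ring
    _ ≤ _ := by
        rw [h5]
        have := mul_le_mul_of_nonneg_right h4 h6
        linarith

/-- From log(1-s) ≤ -s and e^u ≥ 1 + u. For q < 0 the slope is positive, which is what pushes the
mass above 1. -/
lemma one_sub_mul_le_one_sub_rpow {q s : ℝ} (hq : q ≤ 0) (hs : s < 1) :
    1 + -q * s ≤ (1 - s) ^ q := by
  have h1 : 0 < 1 - s := by linarith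
  rw [Real.rpow_def_of_pos h1]
  have h2 := Real.log_le_sub_one_of_pos h1
  have h3 := Real.add_one_le_exp (Real.log (1 - s) * q)
  nlinarith

/-- Bernoulli's inequality needs an exponent at least 1, so it is applied to q + 1; only some linear
minorant matters here. -/
lemma one_sub_add_one_mul_le_one_sub_rpow {q s : ℝ} (hq : 0 ≤ q) (hs0 : 0 ≤ s) (hs : s < 1) :
    1 + -(q + 1) * s ≤ (1 - s) ^ q := by
  have h1 : 0 < 1 - s := by linarith
  have h2 := one_add_mul_self_le_rpow_one_add (s := -s) (by linarith) (p := q + 1) (by linarith)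
  have h3 : (1 - s) ^ (q + 1) ≤ (1 - s) ^ q :=
    Real.rpow_le_rpow_of_exponent_ge h1 (by linarith) (by linarith)
  rw [← sub_eq_add_neg 1 s] at h2
  linarith

lemma ofReal_integral_le_lintegral {X : Type*} [MeasurableSpace X] {μ : Measure X} {f : X → ℝ}
    (hf : Integrable f μ) : ENNReal.ofReal (∫ x, f x ∂μ) ≤ ∫⁻ x, ENNReal.ofReal (f x) ∂μ := by
  apply ENNReal.ofReal_le_of_le_toReal
  rw [integral_eq_lintegral_pos_part_sub_lintegral_neg_part hf]
  exact sub_le_self _ ENNReal.toReal_nonneg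

/-- Replace (1-s)^(a-1/2) by the minorant 1 + ks. Over all of (0, ∞) this integrates to Γ(a)(1 +
ka/w), and the part over [1, ∞) that has to be removed is exponentially small in w. -/
lemma le_laguerreMass {a k w : ℝ} (ha : 0 < a) (hw : 1 < w)
    (hk : ∀ s : ℝ, 0 < s → s < 1 → 1 + k * s ≤ (1 - s) ^ (a - 1 / 2)) :
    ENNReal.ofReal (1 + k * a / w - (1 + |k| * a) * (w ^ a * Real.exp (-(w - 1)))) ≤
      laguerreMass a w := by
  have hw0 : 0 < w := by linarith
  have hGa := Real.Gamma_pos_of_pos ha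
  set f : ℝ → ℝ := fun s => w ^ a * (s ^ (a - 1) * Real.exp (-(w * s))) +
    w ^ a * k * (s ^ (a + 1 - 1) * Real.exp (-(w * s))) with hf
  have hi1 := integrableOn_rpow_mul_exp_neg_mul ha hw0
  have hi2 := integrableOn_rpow_mul_exp_neg_mul (by linarith : 0 < a + 1) hw0
  have hfi : IntegrableOn f (Ioi 0) := (hi1.const_mul _).add (hi2.const_mul _)
  have hI : ∫ s in Ioi (0 : ℝ), f s = Real.Gamma a * (1 + k * a / w) := by
    rw [hf, integral_add (hi1.const_mul _) (hi2.const_mul _), integral_const_mul,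
      integral_const_mul, Real.integral_rpow_mul_exp_neg_mul_Ioi ha hw0,
      Real.integral_rpow_mul_exp_neg_mul_Ioi (by linarith) hw0, Real.Gamma_add_one ha.ne',
      Real.rpow_add_one (by positivity), one_div, Real.inv_rpow hw0.le]
    have := Real.rpow_pos_of_pos hw0 a
    field_simp
  have hj1 := integrableOn_rpow_mul_exp_neg_mul ha one_pos
  have hj2 := integrableOn_rpow_mul_exp_neg_mul (by linarith : 0 < a + 1) one_pos
  set g : ℝ → ℝ := fun s => s ^ (a - 1) * Real.exp (-(1 * s)) +
    |k| * (s ^ (a + 1 - 1) * Real.exp (-(1 * s))) with hg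
  have hgi : IntegrableOn g (Ioi 0) := hj1.add (hj2.const_mul _)
  have hgI : ∫ s in Ioi (0 : ℝ), g s = Real.Gamma a * (1 + |k| * a) := by
    rw [hg, integral_add hj1 (hj2.const_mul _), integral_const_mul,
      Real.integral_rpow_mul_exp_neg_mul_Ioi ha one_pos,
      Real.integral_rpow_mul_exp_neg_mul_Ioi (by linarith) one_pos, Real.Gamma_add_one ha.ne']
    simp
    ring
  have hsub : Ici (1 : ℝ) ⊆ Ioi 0 := fun s (hs : 1 ≤ s) => zero_lt_one.trans_le hs
  have htail : ∫ s in Ici (1 : ℝ), f s ≤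
      w ^ a * Real.exp (-(w - 1)) * (Real.Gamma a * (1 + |k| * a)) := by
    rw [← hgI, ← integral_const_mul]
    calc ∫ s in Ici (1 : ℝ), f s ≤ ∫ s in Ici (1 : ℝ), w ^ a * Real.exp (-(w - 1)) * g s := by
          refine setIntegral_mono_on (hfi.mono_set hsub) ((hgi.mono_set hsub).const_mul _)
            measurableSet_Ici fun s hs => ?_
          have hs1 : 1 ≤ s := hs
          have hs0 : 0 < s := by linarith
          -- This is (w - 1)(s - 1) ≥ 0. It detaches the decay in w from an integral independent of
          -- w.
          have he : Real.exp (-(w * s)) ≤ Real.exp (-(w - 1)) * Real.exp (-(1 * s)) := by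
            rw [← Real.exp_add, Real.exp_le_exp]
            nlinarith
          have hk1 := le_abs_self k
          calc f s ≤ w ^ a * (s ^ (a - 1) * Real.exp (-(w * s))) +
                w ^ a * |k| * (s ^ (a + 1 - 1) * Real.exp (-(w * s))) := by
                simp only [hf]
                gcongr
            _ = w ^ a * (s ^ (a - 1) + |k| * s ^ (a + 1 - 1)) * Real.exp (-(w * s)) := by ring
            _ ≤ w ^ a * (s ^ (a - 1) + |k| * s ^ (a + 1 - 1)) *
                (Real.exp (-(w - 1)) * Real.exp (-(1 * s))) := by gcongr
            _ = _ := by simp only [hg]; ring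
      _ ≤ _ := by
          refine setIntegral_mono_set (hgi.const_mul _) ?_ (Eventually.of_forall hsub)
          filter_upwards [ae_restrict_mem measurableSet_Ioi] with s hs
          have : 0 < s := hs
          simp only [hg, Pi.zero_apply]
          positivity
  have hsplit : ∫ s in Ioi (0 : ℝ), f s = (∫ s in Ioo (0 : ℝ) 1, f s) + ∫ s in Ici (1 : ℝ), f s := by
    rw [← setIntegral_union _ measurableSet_Ici (hfi.mono_set Ioo_subset_Ioi_self)
      (hfi.mono_set hsub), Ioo_union_Ici_eq_Ioi one_pos]
    exact disjoint_left.2 fun s hs hs' => not_lt.2 hs' hs.2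
  rw [laguerreMass_eq_lintegral ha hw0]
  have hlow : ENNReal.ofReal (∫ s in Ioo (0 : ℝ) 1, f s) ≤ ∫⁻ s in Ioo (0 : ℝ) 1,
      ENNReal.ofReal (w ^ a * Real.exp (-(w * s)) * s ^ (a - 1) * (1 - s) ^ (a - 1 / 2)) := by
    refine (ofReal_integral_le_lintegral (hfi.mono_set Ioo_subset_Ioi_self)).trans
      (setLIntegral_mono' measurableSet_Ioo fun s hs => ENNReal.ofReal_le_ofReal ?_)
    have hs0 : 0 < s := hs.1
    have h5 : s ^ (a + 1 - 1) = s ^ (a - 1) * s := by rw [← Real.rpow_add_one hs0.ne']; ring_nf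
    calc f s = w ^ a * Real.exp (-(w * s)) * s ^ (a - 1) * (1 + k * s) := by
          simp only [hf, h5]; ring
      _ ≤ _ := by
          gcongr
          exact hk s hs.1 hs.2
  refine le_trans ?_ (mul_le_mul_right hlow _)
  rw [← ENNReal.ofReal_mul (by positivity)]
  apply ENNReal.ofReal_le_ofReal
  rw [inv_mul_eq_div, le_div_iff₀ hGa]
  linarith

lemma eventually_rpow_mul_exp_le (a D : ℝ) {δ : ℝ} (hδ : 0 < δ) :
    ∀ᶠ w : ℝ in atTop, D * (w ^ a * Real.exp (-(w - 1))) ≤ δ / w := by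
  have h := (tendsto_rpow_mul_exp_neg_mul_atTop_nhds_zero (a + 1) 1 one_pos).const_mul
    (D * Real.exp 1)
  rw [mul_zero] at h
  filter_upwards [h.eventually (gt_mem_nhds hδ), eventually_gt_atTop 0] with w h1 h2
  rw [le_div_iff₀ h2]
  rw [Real.rpow_add_one h2.ne'] at h1
  have : Real.exp (-(w - 1)) = Real.exp 1 * Real.exp (-1 * w) := by
    rw [← Real.exp_add]; ring_nf
  rw [this]
  linarith

/-- For large w the lower bound is 1 - O(1/w). An interval of values of w, not a single one, is
needed to obtain a test set of positive measure. -/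
lemma exists_Icc_le_laguerreMass {a ε : ℝ} (ha : 0 ≤ a) (hε : 0 < ε) :
    ∃ A B : ℝ, 0 < A ∧ A < B ∧ ∀ w ∈ Icc A B, ENNReal.ofReal (1 - ε) ≤ laguerreMass a w := by
  rcases ha.eq_or_lt with rfl | ha
  · refine ⟨1, 2, one_pos, one_lt_two, fun w hw => ?_⟩
    rw [laguerreMass_zero (zero_le_one.trans hw.1), ENNReal.ofReal_le_one]
    linarith
  obtain ⟨k, hk⟩ : ∃ k : ℝ, ∀ s : ℝ, 0 < s → s < 1 → 1 + k * s ≤ (1 - s) ^ (a - 1 / 2) := by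
    rcases le_total a (1 / 2) with h | h
    · exact ⟨_, fun s _ h1 => one_sub_mul_le_one_sub_rpow (by linarith) h1⟩
    · exact ⟨_, fun s h0 h1 => one_sub_add_one_mul_le_one_sub_rpow (by linarith) h0.le h1⟩
  have h1 : Tendsto (fun w : ℝ => (|k| * a + 1) / w) atTop (𝓝 0) := tendsto_const_nhds.div_atTop tendsto_id
  have hev := ((eventually_rpow_mul_exp_le a (1 + |k| * a) one_pos).and
    ((h1.eventually (gt_mem_nhds hε)).and (eventually_gt_atTop 1))).exists_forall_of_atTop
  obtain ⟨W, hW⟩ := hev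
  have hW1 := (hW W le_rfl).2.2
  refine ⟨W, W + 1, by linarith, by linarith, fun w hw => ?_⟩
  obtain ⟨h2, h3, h4⟩ := hW w hw.1
  refine le_trans (ENNReal.ofReal_le_ofReal ?_) (le_laguerreMass ha h4 hk)
  have hw0 : 0 < w := by linarith
  have h5 : -(|k| * a / w) ≤ k * a / w := by
    rw [← neg_div, ← neg_mul]
    gcongr
    exact neg_abs_le k
  rw [add_div] at h3
  linarith

/-- With k = 1/2 - a > 0 the gain ka/w eventually exceeds twice the exponential error. Half of it is
kept, evaluated at the right end W + 1 of the interval. -/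
lemma exists_Icc_lt_laguerreMass {a : ℝ} (ha : 0 < a) (ha2 : a < 1 / 2) :
    ∃ h A B : ℝ, 1 < h ∧ 0 < A ∧ A < B ∧ ∀ w ∈ Icc A B, ENNReal.ofReal h ≤ laguerreMass a w := by
  set k := -(a - 1 / 2) with hkdef
  have hk0 : 0 < k := by rw [hkdef]; linarith
  have hk : ∀ s : ℝ, 0 < s → s < 1 → 1 + k * s ≤ (1 - s) ^ (a - 1 / 2) :=
    fun s _ h1 => one_sub_mul_le_one_sub_rpow (by linarith) h1
  obtain ⟨W, hW⟩ := ((eventually_rpow_mul_exp_le a (1 + |k| * a)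
    (by positivity : 0 < k * a / 2)).and (eventually_gt_atTop 1)).exists_forall_of_atTop
  have hW1 := (hW W le_rfl).2
  have hW0 : 0 < W := by linarith
  refine ⟨1 + k * a / 2 / (W + 1), W, W + 1, lt_add_of_pos_right _ (by positivity), hW0,
    by linarith, fun w hw => ?_⟩
  obtain ⟨h2, h4⟩ := hW w hw.1
  refine le_trans (ENNReal.ofReal_le_ofReal ?_) (le_laguerreMass ha h4 hk)
  have hw0 : 0 < w := by linarith
  have h5 : k * a / 2 / (W + 1) ≤ k * a / 2 / w := by
    gcongr
    exact hw.2
  have h6 : k * a / w = k * a / 2 / w + k * a / 2 / w := by ring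
  linarith

/-! ### Orthonormality of the Laguerre functions -/

/-- The coefficient of `x ^ i` in the Laguerre polynomial. -/
def laguerreCoeff (β : ℝ) (n i : ℕ) : ℝ :=
  (-1) ^ i * Real.Gamma (n + β + 1) / (Real.Gamma (i + β + 1) * (n - i).factorial * i.factorial)

lemma laguerrePoly_eq_sum_laguerreCoeff (β : ℝ) (n : ℕ) (x : ℝ) :
    laguerrePoly β n x = ∑ i ∈ Finset.range (n + 1), laguerreCoeff β n i * x ^ i := rfl

/-- The weighted monomial `2 x ^ (2 i) x ^ (2 β + 1) e ^ (-x²)`. -/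
def laguerreMonomial (β : ℝ) (i : ℕ) (x : ℝ) : ℝ :=
  2 * (x ^ 2) ^ i * x ^ (2 * β + 1) * Real.exp (-x ^ 2)

lemma laguerreMonomial_eq {β x : ℝ} (i : ℕ) (hx : 0 < x) :
    laguerreMonomial β i x = 2 * (x ^ (2 * i + (2 * β + 1)) * Real.exp (-1 * x ^ 2)) := by
  rw [laguerreMonomial, Real.rpow_add hx (2 * i) (2 * β + 1), show (2 * (i : ℝ)) = ((2 * i : ℕ) : ℝ) by push_cast; ring,
    Real.rpow_natCast, pow_mul]
  ring_nf

lemma integrableOn_laguerreMonomial {β : ℝ} (hβ : -1 < β) (i : ℕ) :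
    IntegrableOn (laguerreMonomial β i) (Ioi 0) := by
  have := (integrableOn_rpow_mul_exp_neg_mul_sq one_pos
    (by have := i.cast_nonneg (α := ℝ); linarith : -1 < 2 * (i : ℝ) + (2 * β + 1))).const_mul 2
  exact IntegrableOn.congr_fun this (fun x hx => (laguerreMonomial_eq i hx).symm) measurableSet_Ioi

lemma integral_laguerreMonomial {β : ℝ} (hβ : -1 < β) (i : ℕ) :
    ∫ x in Ioi (0 : ℝ), laguerreMonomial β i x = Real.Gamma (i + β + 1) := by
  have h := integral_rpow_mul_exp_neg_mul_rpow (p := 2) (q := 2 * (i : ℝ) + (2 * β + 1)) two_pos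
    (by have := i.cast_nonneg (α := ℝ); linarith) one_pos
  rw [setIntegral_congr_fun measurableSet_Ioi fun x hx => laguerreMonomial_eq (β := β) i hx,
    integral_const_mul]
  simp only [Real.rpow_two] at h
  rw [h, Real.one_rpow, show (2 * (i : ℝ) + (2 * β + 1) + 1) / 2 = i + β + 1 by ring]
  ring

/-- Γ(i+j+β+1)/Γ(i+β+1) is a monic polynomial of degree j in i, and up to a common constant the
coefficients are (-1)^(n-i) times binomial coefficients. The sum is thus an n-th forward difference
at 0, which kills degree below n and gives n! in degree n. -/
lemma sum_laguerreCoeff_mul_Gamma {β : ℝ} (hβ : -1 < β) {n j : ℕ} (hj : j ≤ n) :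
    ∑ i ∈ Finset.range (n + 1), laguerreCoeff β n i * Real.Gamma ((i + j : ℕ) + β + 1) =
      if j = n then (-1) ^ n * Real.Gamma (n + β + 1) else 0 := by
  have hG : ∀ i : ℕ, 0 < (i : ℝ) + β + 1 := fun i => by
    have := i.cast_nonneg (α := ℝ); linarith
  set P : Polynomial ℝ := (ascPochhammer ℝ j).comp (Polynomial.X + Polynomial.C (β + 1)) with hP
  have hmonic : P.Monic := (monic_ascPochhammer ℝ j).comp_X_add_C _
  have hdeg : P.natDegree = j := by
    rw [hP, Polynomial.natDegree_comp, ascPochhammer_natDegree, Polynomial.natDegree_X_add_C,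
      mul_one]
  have hsum : ∑ i ∈ Finset.range (n + 1), laguerreCoeff β n i * Real.Gamma ((i + j : ℕ) + β + 1) =
      (-1) ^ n * Real.Gamma (n + β + 1) / n.factorial * (fwdDiff (1 : ℝ))^[n] P.eval 0 := by
    rw [fwdDiff_iter_eq_sum_shift, Finset.mul_sum]
    refine Finset.sum_congr rfl fun i hi => ?_
    have hi : i ≤ n := Nat.lt_succ_iff.1 (Finset.mem_range.1 hi)
    have h1 : Real.Gamma ((i + j : ℕ) + β + 1) = P.eval (i : ℝ) * Real.Gamma (i + β + 1) := by
      rw [show ((i + j : ℕ) : ℝ) + β + 1 = j + (i + β + 1) by push_cast; ring,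
        Gamma_add_natCast (hG i), hP]
      simp [add_assoc]
    have h2 := (Real.Gamma_pos_of_pos (hG i)).ne'
    have h3 : (n.choose i : ℝ) = n.factorial / (i.factorial * (n - i).factorial) :=
      Nat.cast_choose ℝ hi
    have h4 : (-1 : ℝ) ^ n * (-1) ^ (n - i) = (-1) ^ i := by
      obtain ⟨k, rfl⟩ := Nat.exists_eq_add_of_le hi
      rw [Nat.add_sub_cancel_left, pow_add, mul_assoc, ← pow_add, ← two_mul, pow_mul]
      simp
    rw [h1, laguerreCoeff, ← h4]
    simp only [zsmul_eq_mul, nsmul_eq_mul, mul_one, zero_add]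
    push_cast
    rw [h3]
    field_simp
  rw [hsum]
  split_ifs with h
  · subst h
    have := P.fwdDiff_iter_degree_eq_factorial
    rw [hdeg, hmonic.leadingCoeff] at this
    rw [this]
    simp
    field_simp
  · rw [Polynomial.fwdDiff_iter_eq_zero_of_degree_lt (by omega)]
    simp

lemma laguerrePoly_mul_laguerreMonomial (β : ℝ) (n j : ℕ) (x : ℝ) :
    laguerrePoly β n (x ^ 2) * laguerreMonomial β j x =
      ∑ i ∈ Finset.range (n + 1), laguerreCoeff β n i * laguerreMonomial β (i + j) x := by
  rw [laguerrePoly_eq_sum_laguerreCoeff, Finset.sum_mul]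
  refine Finset.sum_congr rfl fun i _ => ?_
  simp only [laguerreMonomial, pow_add]
  ring

lemma integrableOn_laguerrePoly_mul_laguerreMonomial {β : ℝ} (hβ : -1 < β) (n j : ℕ) :
    IntegrableOn (fun x => laguerrePoly β n (x ^ 2) * laguerreMonomial β j x) (Ioi 0) := by
  simp_rw [laguerrePoly_mul_laguerreMonomial]
  exact integrable_finsetSum _ fun i _ => (integrableOn_laguerreMonomial hβ _).const_mul _

lemma integral_laguerrePoly_mul_laguerreMonomial {β : ℝ} (hβ : -1 < β) {n j : ℕ} (hj : j ≤ n) :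
    ∫ x in Ioi (0 : ℝ), laguerrePoly β n (x ^ 2) * laguerreMonomial β j x =
      if j = n then (-1) ^ n * Real.Gamma (n + β + 1) else 0 := by
  simp_rw [laguerrePoly_mul_laguerreMonomial]
  rw [integral_finsetSum _ fun i _ => (integrableOn_laguerreMonomial hβ _).const_mul _,
    ← sum_laguerreCoeff_mul_Gamma hβ hj]
  refine Finset.sum_congr rfl fun i _ => ?_
  rw [integral_const_mul, integral_laguerreMonomial hβ]

/-- Expanding the factor of lower degree m leaves integrals against monomials of degree at most n;
only the top one with m = n survives. -/
lemma integral_hermiteFun₁_mul_of_le {β : ℝ} (hβ : -1 < β) {n m : ℕ} (hmn : m ≤ n) :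
    ∫ x in Ioi (0 : ℝ), hermiteFun₁ β n x * hermiteFun₁ β m x = if m = n then 1 else 0 := by
  have h1 : ∀ x ∈ Ioi (0 : ℝ), hermiteFun₁ β n x * hermiteFun₁ β m x =
      ∑ j ∈ Finset.range (m + 1), √(laguerreWeight β n) * √(laguerreWeight β m) *
        laguerreCoeff β m j * (laguerrePoly β n (x ^ 2) * laguerreMonomial β j x) := by
    intro x hx
    have hx : 0 < x := hx
    have e1 : x ^ (2 * β + 1) = x ^ (β + 1 / 2) * x ^ (β + 1 / 2) := by
      rw [← Real.rpow_add hx]; ring_nf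
    have e2 : Real.exp (-x ^ 2) = Real.exp (-x ^ 2 / 2) * Real.exp (-x ^ 2 / 2) := by
      rw [← Real.exp_add]; ring_nf
    have h2 : √(2 : ℝ) * √2 = 2 := Real.mul_self_sqrt zero_le_two
    simp only [hermiteFun₁, laguerrePolyNormalized, laguerreWeight]
    rw [laguerrePoly_eq_sum_laguerreCoeff β m]
    simp only [Finset.mul_sum, Finset.sum_mul, laguerreMonomial]
    refine Finset.sum_congr rfl fun j _ => ?_
    rw [e1, e2]
    linear_combination (√(Real.Gamma (n + 1) / Real.Gamma (n + β + 1)) *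
      √(Real.Gamma (m + 1) / Real.Gamma (m + β + 1)) * laguerreCoeff β m j *
      laguerrePoly β n (x ^ 2) * (x ^ 2) ^ j * (x ^ (β + 1 / 2) * x ^ (β + 1 / 2)) *
      (Real.exp (-x ^ 2 / 2) * Real.exp (-x ^ 2 / 2))) * h2
  rw [setIntegral_congr_fun measurableSet_Ioi h1, integral_finsetSum _ fun j _ =>
    (integrableOn_laguerrePoly_mul_laguerreMonomial hβ n j).const_mul _]
  simp_rw [integral_const_mul]
  rw [Finset.sum_congr rfl fun j hj => by
    rw [integral_laguerrePoly_mul_laguerreMonomial hβ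
      ((Nat.lt_succ_iff.1 (Finset.mem_range.1 hj)).trans hmn)]]
  split_ifs with h
  · subst h
    rw [Finset.sum_range_succ, Finset.sum_eq_zero fun j hj => by
      rw [if_neg (Finset.mem_range.1 hj).ne, mul_zero], if_pos rfl, zero_add,
      Real.mul_self_sqrt (laguerreWeight_pos hβ m).le]
    have hG : 0 < Real.Gamma (m + β + 1) := Real.Gamma_pos_of_pos (by
      have := m.cast_nonneg (α := ℝ); linarith)
    have h4 : (-1 : ℝ) ^ m * (-1) ^ m = 1 := by rw [← pow_add, ← two_mul, pow_mul]; simp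
    rw [laguerreWeight, laguerreCoeff, Real.Gamma_nat_eq_factorial]
    simp only [Nat.sub_self, Nat.factorial_zero, Nat.cast_one, mul_one]
    field_simp
    linear_combination h4
  · refine Finset.sum_eq_zero fun j hj => ?_
    have := Finset.mem_range.1 hj
    rw [if_neg (by omega), mul_zero]

lemma integral_hermiteFun₁_mul {β : ℝ} (hβ : -1 < β) (n m : ℕ) :
    ∫ x in Ioi (0 : ℝ), hermiteFun₁ β n x * hermiteFun₁ β m x = if n = m then 1 else 0 := by
  rcases le_total m n with h | h
  · rw [integral_hermiteFun₁_mul_of_le hβ h]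
    simp only [eq_comm]
  · simp_rw [mul_comm (hermiteFun₁ β n _)]
    exact integral_hermiteFun₁_mul_of_le hβ h

lemma integral_hermiteFun_mul {β : Fin d → ℝ} (hβ : ∀ i, -1 < β i) (k l : Fin d → ℕ) :
    ∫ x, hermiteFun β k x * hermiteFun β l x ∂(orthantMeasure d) = if k = l then 1 else 0 := by
  rw [orthantMeasure_eq_pi]
  simp only [hermiteFun, ← Finset.prod_mul_distrib]
  rw [integral_fintype_prod_eq_prod (μ := fun _ : Fin d => volume.restrict (Ioi (0 : ℝ)))
    (f := fun i x => hermiteFun₁ (β i) (k i) x * hermiteFun₁ (β i) (l i) x)]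
  simp_rw [fun i => integral_hermiteFun₁_mul (hβ i) (k i) (l i)]
  split_ifs with h
  · subst h
    simp
  · obtain ⟨i, hi⟩ := Function.ne_iff.1 h
    exact Finset.prod_eq_zero (Finset.mem_univ i) (if_neg hi)

/-! ### The kernel in several dimensions -/

/-- Induction on d, splitting off coordinate 0; real summable series converge absolutely, so
products may be rearranged. -/
lemma hasSum_pi_prod {f : Fin d → ℕ → ℝ} {a : Fin d → ℝ} (h : ∀ i, HasSum (f i) (a i)) :
    HasSum (fun k : Fin d → ℕ => ∏ i, f i (k i)) (∏ i, a i) := by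
  induction d with
  | zero => simp
  | succ d ih =>
    set g : (Fin d → ℕ) → ℝ := fun k => ∏ i, f (Fin.succ i) (k i) with hg
    have h1 : HasSum g (∏ i : Fin d, a i.succ) := ih fun i => h i.succ
    have h2 : Summable fun p : ℕ × (Fin d → ℕ) => f 0 p.1 * g p.2 :=
      summable_mul_of_summable_norm (f := f 0) (g := g) (h 0).summable.norm h1.summable.norm
    have h3 : HasSum (fun p : ℕ × (Fin d → ℕ) => f 0 p.1 * g p.2) (a 0 * ∏ i : Fin d, a i.succ) :=
      HasSum.mul (f := f 0) (g := g) (h 0) h1 h2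
    let e : ℕ × (Fin d → ℕ) ≃ (Fin (d + 1) → ℕ) := Fin.consEquiv fun _ => ℕ
    rw [← e.hasSum_iff, Fin.prod_univ_succ]
    have h4 : (fun k : Fin (d + 1) → ℕ => ∏ i, f i (k i)) ∘ e =
        fun p : ℕ × (Fin d → ℕ) => f 0 p.1 * g p.2 := by
      funext p
      simp [e, hg, Fin.consEquiv, Fin.prod_univ_succ]
    rw [h4]
    exact h3

/-- The closed form of the heat kernel. -/
def laguerreKernel (β : Fin d → ℝ) (t : ℝ) (x y : Fin d → ℝ) : ℝ :=
  ∏ i, laguerreKernel₁ (β i) t (x i) (y i)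

lemma exp_hermiteEigenvalue (β : Fin d → ℝ) (t : ℝ) (k : Fin d → ℕ) :
    Real.exp (-t * hermiteEigenvalue β k) =
      ∏ i, Real.exp (-t * (4 * k i + 2 * β i + 2)) := by
  rw [← Real.exp_sum, hermiteEigenvalue, ← Finset.mul_sum]
  congr 2
  simp [Finset.sum_add_distrib, Finset.mul_sum, mul_comm, Finset.sum_mul]

lemma hasSum_hermiteKernelTerm {β : Fin d → ℝ} (hβ : ∀ i, -1 < β i) {t : ℝ} (ht : 0 < t)
    (x y : Fin d → ℝ) :
    HasSum (hermiteKernelTerm β t x y) (laguerreKernel β t x y) := by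
  have h := hasSum_pi_prod fun i => hasSum_laguerreKernel₁ (hβ i) ht (x i) (y i)
  have e : hermiteKernelTerm β t x y = fun k => ∏ i, Real.exp (-t * (4 * k i + 2 * β i + 2)) *
      (hermiteFun₁ (β i) (k i) (x i) * hermiteFun₁ (β i) (k i) (y i)) := by
    funext k
    simp only [hermiteKernelTerm, exp_hermiteEigenvalue, hermiteFun, Finset.prod_mul_distrib]
  rw [e]
  exact h

lemma hermiteKernel_eq {β : Fin d → ℝ} (hβ : ∀ i, -1 < β i) {t : ℝ} (ht : 0 < t)
    (x y : Fin d → ℝ) : hermiteKernel β t x y = laguerreKernel β t x y :=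
  (hasSum_hermiteKernelTerm hβ ht x y).tsum_eq

/-- This majorant justifies integrating the eigenfunction expansion of the kernel term by term. -/
lemma summable_exp_mul_hermiteFun {β : Fin d → ℝ} (hβ : ∀ i, -1 < β i) {t : ℝ} (ht : 0 < t)
    (x : Fin d → ℝ) :
    Summable fun k => Real.exp (-t * hermiteEigenvalue β k) * |hermiteFun β k x| := by
  have h : ∀ i, Summable fun n : ℕ =>
      Real.exp (-t * (4 * n + 2 * β i + 2)) * |hermiteFun₁ (β i) n (x i)| := by
    intro i
    have := (isSubexp_hermiteFun₁ (hβ i) (x i) (Real.exp (-t * 4)) (Real.exp_pos _)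
      ((Real.exp_lt_exp.2 (by linarith : -t * 4 < 0)).trans_eq Real.exp_zero)).mul_left
      (Real.exp (-t * (2 * β i + 2)))
    refine this.congr fun n => ?_
    rw [show -t * (4 * n + 2 * β i + 2) = -t * (2 * β i + 2) + n * (-t * 4) by ring, Real.exp_add,
      Real.exp_nat_mul]
    ring
  refine (hasSum_pi_prod fun i => (h i).hasSum).summable.congr fun k => ?_
  simp only [exp_hermiteEigenvalue, hermiteFun, Finset.abs_prod, Finset.prod_mul_distrib]

lemma laguerreKernel_comm (β : Fin d → ℝ) (t : ℝ) (x y : Fin d → ℝ) :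
    laguerreKernel β t x y = laguerreKernel β t y x :=
  Finset.prod_congr rfl fun _ _ => laguerreKernel₁_comm _ _ _ _

lemma laguerreKernel_nonneg {β : Fin d → ℝ} (hβ : ∀ i, -1 < β i) {t : ℝ} (ht : 0 < t)
    {x y : Fin d → ℝ} (hx : x ∈ orthant d) (hy : y ∈ orthant d) : 0 ≤ laguerreKernel β t x y :=
  Finset.prod_nonneg fun i _ => laguerreKernel₁_nonneg (hβ i) ht (hx i).le (hy i).le

lemma measurable_laguerreKernel {β : Fin d → ℝ} (hβ : ∀ i, -1 < β i) (t : ℝ) :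
    Measurable fun p : (Fin d → ℝ) × (Fin d → ℝ) => laguerreKernel β t p.1 p.2 := by
  unfold laguerreKernel
  refine Finset.measurable_fun_prod _ fun i _ => ?_
  exact (measurable_laguerreKernel₁ (hβ i) t).comp (g := fun p : ℝ × ℝ => _)
    (f := fun p : (Fin d → ℝ) × (Fin d → ℝ) => (p.1 i, p.2 i)) (by fun_prop)

lemma exists_laguerreKernel_le {β : Fin d → ℝ} (hβ : ∀ i, -1 / 2 ≤ β i) {t : ℝ} (ht : 0 < t)
    {x : Fin d → ℝ} (hx : x ∈ orthant d) :
    ∃ M, ∀ y ∈ orthant d, laguerreKernel β t x y ≤ M := by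
  choose M hM0 hM using fun i => exists_laguerreKernel₁_le (hβ i) ht (hx i)
  exact ⟨∏ i, M i, fun y hy => Finset.prod_le_prod (fun i _ => laguerreKernel₁_nonneg
    (by linarith [hβ i]) ht (hx i).le (hy i).le) fun i _ => hM i (y i) (hy i)⟩

/-- The mass of the one-dimensional kernel. -/
def laguerreKernelMass (β t x : ℝ) : ℝ≥0∞ :=
  ∫⁻ y in Ioi (0 : ℝ), ENNReal.ofReal (laguerreKernel₁ β t x y)

lemma measurableSet_orthant (d : ℕ) : MeasurableSet (orthant d) := by
  have : orthant d = ⋂ i, {x : Fin d → ℝ | 0 < x i} := by ext; simp [orthant]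
  rw [this]
  exact MeasurableSet.iInter fun i => measurableSet_lt measurable_const (measurable_pi_apply i)

lemma ae_mem_orthant (d : ℕ) : ∀ᵐ x ∂(orthantMeasure d), x ∈ orthant d :=
  ae_restrict_mem (measurableSet_orthant d)

lemma lintegral_laguerreKernel {β : Fin d → ℝ} (hβ : ∀ i, -1 / 2 ≤ β i) {t : ℝ} (ht : 0 < t)
    {x : Fin d → ℝ} (hx : x ∈ orthant d) :
    ∫⁻ y, ENNReal.ofReal (laguerreKernel β t x y) ∂(orthantMeasure d) =
      ∏ i, laguerreKernelMass (β i) t (x i) := by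
  have hβ' : ∀ i, -1 < β i := fun i => by linarith [hβ i]
  have hm : ∀ i, Measurable fun y => laguerreKernel₁ (β i) t (x i) y := fun i =>
    (measurable_laguerreKernel₁ (hβ' i) t).comp (measurable_const.prodMk measurable_id)
  -- The product formula is applied to Bochner integrals, so finiteness of the one-dimensional
  -- masses comes first.
  have hfin : ∀ i, laguerreKernelMass (β i) t (x i) ≠ ∞ := fun i => by
    obtain ⟨C, -, hC⟩ := exists_laguerreMass_le (a := β i / 2 + 1 / 4) (by linarith [hβ i])
    have hs : 0 < Real.sinh (2 * t) := Real.sinh_pos_iff.2 (by linarith)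
    have hc := Real.cosh_pos (2 * t)
    have hxi := hx i
    rw [laguerreKernelMass, lintegral_laguerreKernel₁ (hβ i) ht (hx i)]
    exact ENNReal.mul_ne_top ENNReal.ofReal_ne_top
      (ne_top_of_le_ne_top ENNReal.ofReal_ne_top (hC _ (by positivity)))
  have hn : ∀ i, 0 ≤ᵐ[volume.restrict (Ioi 0)] fun y => laguerreKernel₁ (β i) t (x i) y := fun i => by
    filter_upwards [ae_restrict_mem measurableSet_Ioi] with y hy
    exact laguerreKernel₁_nonneg (hβ' i) ht (hx i).le (le_of_lt hy)
  have hi : ∀ i, Integrable (fun y => laguerreKernel₁ (β i) t (x i) y) (volume.restrict (Ioi 0)) :=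
    fun i => ⟨(hm i).aestronglyMeasurable, by
      rw [hasFiniteIntegral_iff_ofReal (hn i)]
      exact (hfin i).lt_top⟩
  have hI : ∀ i, ENNReal.ofReal (∫ y in Ioi (0 : ℝ), laguerreKernel₁ (β i) t (x i) y) =
      laguerreKernelMass (β i) t (x i) := fun i =>
    ofReal_integral_eq_lintegral_ofReal (hi i) (hn i)
  have hint := Integrable.fintype_prod (μ := fun _ : Fin d => volume.restrict (Ioi (0 : ℝ)))
    (f := fun i y => laguerreKernel₁ (β i) t (x i) y) hi
  have hprod := integral_fintype_prod_eq_prod (μ := fun _ : Fin d => volume.restrict (Ioi (0 : ℝ)))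
    (f := fun i y => laguerreKernel₁ (β i) t (x i) y)
  rw [← orthantMeasure_eq_pi] at hint hprod
  have hnn : 0 ≤ᵐ[orthantMeasure d] fun y => ∏ i, laguerreKernel₁ (β i) t (x i) (y i) := by
    filter_upwards [ae_mem_orthant d] with y hy
    exact laguerreKernel_nonneg hβ' ht hx hy
  unfold laguerreKernel
  rw [← ofReal_integral_eq_lintegral_ofReal hint hnn, hprod,
    ENNReal.ofReal_prod_of_nonneg fun i _ => integral_nonneg_of_ae (hn i)]
  exact Finset.prod_congr rfl fun i _ => hI i

/-! ### Completeness of the Laguerre functions -/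

/-- Against normalized φ_k this gives a bound independent of k. -/
lemma MeasureTheory.MemLp.integral_abs_mul_le {X : Type*} [MeasurableSpace X] {μ : Measure X}
    {f g : X → ℝ} (hf : MemLp f 2 μ) (hg : MemLp g 2 μ) :
    ∫ x, |f x * g x| ∂μ ≤ ((∫ x, f x ^ 2 ∂μ) + ∫ x, g x ^ 2 ∂μ) / 2 := by
  rw [← integral_add hf.integrable_sq hg.integrable_sq, ← integral_div]
  refine integral_mono (hf.integrable_mul hg).abs
    ((hf.integrable_sq.add hg.integrable_sq).div_const 2) fun x => ?_
  simp only [abs_mul]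
  nlinarith [sq_nonneg (|f x| - |g x|), sq_abs (f x), sq_abs (g x)]

lemma integral_hermiteFun_sq {β : Fin d → ℝ} (hβ : ∀ i, -1 < β i) (k : Fin d → ℕ) :
    ∫ x, hermiteFun β k x ^ 2 ∂(orthantMeasure d) = 1 := by
  simp_rw [sq]
  rw [integral_hermiteFun_mul hβ, if_pos rfl]

/-- The function `∏ exp (-N i * (y i)²)` on `[0, ∞)^d`. -/
def gaussianMonomial (N : Fin d → ℕ) : BoundedContinuousFunction (Fin d → NNReal) ℝ :=
  BoundedContinuousFunction.ofNormedAddCommGroup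
    (fun y => ∏ i, Real.exp (-(N i * (y i : ℝ) ^ 2))) (by fun_prop) 1 fun y => by
      rw [Real.norm_of_nonneg (by positivity)]
      exact Finset.prod_le_one (fun i _ => by positivity) fun i _ =>
        Real.exp_le_one_iff.2 (neg_nonpos.2 (by positivity))

lemma gaussianMonomial_apply (N : Fin d → ℕ) (y : Fin d → NNReal) :
    gaussianMonomial N y = ∏ i, Real.exp (-(N i * (y i : ℝ) ^ 2)) := rfl

/-- The multiplicative monoid of the functions `gaussianMonomial N`. -/
def gaussianMonomials (d : ℕ) : Submonoid (BoundedContinuousFunction (Fin d → NNReal) ℝ) where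
  carrier := range gaussianMonomial
  one_mem' := ⟨0, by ext y; simp [gaussianMonomial_apply]⟩
  mul_mem' := by
    rintro _ _ ⟨N, rfl⟩ ⟨M, rfl⟩
    refine ⟨N + M, ?_⟩
    ext y
    rw [BoundedContinuousFunction.mul_apply, gaussianMonomial_apply, gaussianMonomial_apply,
      gaussianMonomial_apply, ← Finset.prod_mul_distrib]
    refine Finset.prod_congr rfl fun i _ => ?_
    rw [← Real.exp_add, Pi.add_apply]
    push_cast
    ring_nf

/-- The functions are closed under multiplication, so their span is an algebra of bounded continuous
functions, and such an algebra determines finite measures once it separates points. Nonnegative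
coordinates are essential: y ↦ y² must be injective. -/
lemma measure_eq_of_integral_gaussianMonomial_eq {P Q : Measure (Fin d → NNReal)}
    [IsFiniteMeasure P] [IsFiniteMeasure Q]
    (h : ∀ N, ∫ y, gaussianMonomial N y ∂P = ∫ y, gaussianMonomial N y ∂Q) : P = Q := by
  let A : StarSubalgebra ℝ (BoundedContinuousFunction (Fin d → NNReal) ℝ) :=
    { Algebra.adjoin ℝ (gaussianMonomials d : Set (BoundedContinuousFunction (Fin d → NNReal) ℝ)) with
      star_mem' := fun {a} ha => by
        have : star a = a := by ext y; simp
        rwa [this] }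
  have hsub : ∀ g, g ∈ A ↔ g ∈ Submodule.span ℝ (range (gaussianMonomial (d := d))) := by
    intro g
    have h1 := Algebra.adjoin_eq_span ℝ (gaussianMonomials d : Set (BoundedContinuousFunction (Fin d → NNReal) ℝ))
    rw [Submonoid.closure_eq] at h1
    change g ∈ Subalgebra.toSubmodule (Algebra.adjoin ℝ (gaussianMonomials d : Set (BoundedContinuousFunction (Fin d → NNReal) ℝ))) ↔ _
    rw [h1]
    rfl
  refine ext_of_forall_mem_subalgebra_integral_eq_of_pseudoEMetric_complete_countable
    (𝕜 := ℝ) (A := A) ?_ ?_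
  · intro y z hyz
    obtain ⟨i, hi⟩ := Function.ne_iff.1 hyz
    refine ⟨gaussianMonomial (Pi.single i 1), ⟨(gaussianMonomial (Pi.single i 1)).toContinuousMap,
      ⟨gaussianMonomial (Pi.single i 1),
        (hsub _).2 (Submodule.subset_span ⟨_, rfl⟩), rfl⟩, rfl⟩, ?_⟩
    have e : ∀ y : Fin d → NNReal, gaussianMonomial (Pi.single i 1) y =
        Real.exp (-(y i : ℝ) ^ 2) := by
      intro y
      rw [gaussianMonomial_apply, Finset.prod_eq_single i]
      · simp
      · intro j _ hj
        simp [hj]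
      · simp
    rw [e, e]
    intro h
    have h2 := Real.exp_injective h
    have h3 : (y i : ℝ) ^ 2 = (z i : ℝ) ^ 2 := by linarith
    rw [sq_eq_sq₀ (y i).coe_nonneg (z i).coe_nonneg] at h3
    exact hi (NNReal.coe_injective h3)
  · intro g hg
    refine Submodule.span_induction (p := fun g _ => ∫ y, g y ∂P = ∫ y, g y ∂Q) ?_ ?_ ?_ ?_
      ((hsub g).1 hg)
    · rintro _ ⟨N, rfl⟩
      exact h N
    · simp
    · intro f g _ _ hf hg
      simp only [BoundedContinuousFunction.coe_add, Pi.add_apply]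
      rw [integral_add (f.integrable P) (g.integrable P),
        integral_add (f.integrable Q) (g.integrable Q), hf, hg]
    · intro c f _ hf
      simp only [BoundedContinuousFunction.coe_smul]
      rw [integral_smul, integral_smul, hf]

/-- The positive and negative parts of v define two finite measures with the same Gaussian
integrals, so they coincide. -/
lemma ae_eq_zero_of_integral_mul_gaussian_eq_zero {v : (Fin d → ℝ) → ℝ}
    (hv : Integrable v (orthantMeasure d))
    (h : ∀ N : Fin d → ℕ,
      ∫ x, v x * ∏ i, Real.exp (-(N i * x i ^ 2)) ∂(orthantMeasure d) = 0) :
    v =ᵐ[orthantMeasure d] 0 := by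
  set μ := orthantMeasure d with hμ
  have hm1 : AEMeasurable (fun x => ENNReal.ofReal (v x)) μ := hv.aemeasurable.ennreal_ofReal
  have hm2 : AEMeasurable (fun x => ENNReal.ofReal (-v x)) μ := hv.aemeasurable.neg.ennreal_ofReal
  have hfin1 : ∫⁻ x, ENNReal.ofReal (v x) ∂μ ≠ ∞ := hv.lintegral_lt_top.ne
  have hfin2 : ∫⁻ x, ENNReal.ofReal (-v x) ∂μ ≠ ∞ := hv.neg.lintegral_lt_top.ne
  set P := μ.withDensity fun x => ENNReal.ofReal (v x) with hP
  set Q := μ.withDensity fun x => ENNReal.ofReal (-v x) with hQ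
  have : IsFiniteMeasure P := isFiniteMeasure_withDensity hfin1
  have : IsFiniteMeasure Q := isFiniteMeasure_withDensity hfin2
  -- The uniqueness result lives on [0, ∞)^d. Almost everywhere Ψ inverts Φ, so equality of the
  -- image measures can be pulled back.
  let Φ : (Fin d → ℝ) → (Fin d → NNReal) := fun x i => (x i).toNNReal
  let Ψ : (Fin d → NNReal) → (Fin d → ℝ) := fun y i => y i
  have hΦ : Measurable Φ := by fun_prop
  have hΨ : Measurable Ψ := by fun_prop
  have hgΦ : ∀ N : Fin d → ℕ, ∀ᵐ x ∂μ, gaussianMonomial N (Φ x) =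
      ∏ i, Real.exp (-(N i * x i ^ 2)) := by
    intro N
    filter_upwards [ae_mem_orthant d] with x hx
    rw [gaussianMonomial_apply]
    refine Finset.prod_congr rfl fun i _ => ?_
    rw [Real.coe_toNNReal _ (hx i).le]
  have hmap : P.map Φ = Q.map Φ := by
    refine measure_eq_of_integral_gaussianMonomial_eq fun N => ?_
    have hsm : ∀ R : Measure (Fin d → NNReal), AEStronglyMeasurable (gaussianMonomial N) R :=
      fun R => (gaussianMonomial N).continuous.aestronglyMeasurable
    rw [integral_map hΦ.aemeasurable (hsm _), integral_map hΦ.aemeasurable (hsm _), hP, hQ,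
      integral_withDensity_eq_integral_toReal_smul₀ hm1 (Eventually.of_forall fun _ => by simp),
      integral_withDensity_eq_integral_toReal_smul₀ hm2 (Eventually.of_forall fun _ => by simp),
      ← sub_eq_zero]
    have hb : ∀ x, ‖gaussianMonomial N (Φ x)‖ ≤ ‖gaussianMonomial N‖ := fun x =>
      (gaussianMonomial N).norm_coe_le_norm _
    have hsm' : AEStronglyMeasurable (fun x => gaussianMonomial N (Φ x)) μ :=
      ((gaussianMonomial N).continuous.measurable.comp hΦ).aestronglyMeasurable
    have hi1 : Integrable (fun x => (ENNReal.ofReal (v x)).toReal • gaussianMonomial N (Φ x)) μ :=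
      (integrable_toReal_of_lintegral_ne_top hm1 hfin1)
        |>.mul_bdd (c := ‖gaussianMonomial N‖) hsm' (Eventually.of_forall hb)
    have hi2 : Integrable (fun x => (ENNReal.ofReal (-v x)).toReal • gaussianMonomial N (Φ x)) μ :=
      (integrable_toReal_of_lintegral_ne_top hm2 hfin2)
        |>.mul_bdd (c := ‖gaussianMonomial N‖) hsm' (Eventually.of_forall hb)
    rw [← integral_sub hi1 hi2, ← h N]
    refine integral_congr_ae ?_
    filter_upwards [hgΦ N] with x hx
    rw [← sub_smul, hx, smul_eq_mul]
    congr 1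
    rw [ENNReal.toReal_ofReal', ENNReal.toReal_ofReal']
    exact max_zero_sub_eq_self (v x)
  have hinv : ∀ᵐ x ∂μ, (Ψ ∘ Φ) x = id x := by
    filter_upwards [ae_mem_orthant d] with x hx
    funext i
    exact Real.coe_toNNReal _ (hx i).le
  have hPQ : P = Q := by
    have h1 : (P.map Φ).map Ψ = P := by
      rw [Measure.map_map hΨ hΦ, Measure.map_congr
        ((withDensity_absolutelyContinuous μ _).ae_le hinv), Measure.map_id]
    have h2 : (Q.map Φ).map Ψ = Q := by
      rw [Measure.map_map hΨ hΦ, Measure.map_congr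
        ((withDensity_absolutelyContinuous μ _).ae_le hinv), Measure.map_id]
    rw [← h1, ← h2, hmap]
  filter_upwards [(withDensity_eq_iff hm1 hm2 hfin1).1 hPQ] with x hx
  have := congrArg ENNReal.toReal hx
  rw [ENNReal.toReal_ofReal', ENNReal.toReal_ofReal'] at this
  have h3 := max_zero_sub_eq_self (v x)
  rw [max_comm] at this
  rw [Pi.zero_apply]
  rw [← h3, max_comm, this, max_comm, sub_self]

lemma hermiteFun₁_zero {β : ℝ} (hβ : -1 < β) (x : ℝ) :
    hermiteFun₁ β 0 x = √2 * √(laguerreWeight β 0) * (x ^ (β + 1 / 2) * Real.exp (-x ^ 2 / 2)) := by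
  have : 0 < Real.Gamma (β + 1) := Real.Gamma_pos_of_pos (by linarith)
  simp [hermiteFun₁, laguerrePolyNormalized, laguerrePoly, laguerreWeight, this.ne']
  ring

lemma hermiteFun_zero_pos {β : Fin d → ℝ} (hβ : ∀ i, -1 < β i) {x : Fin d → ℝ}
    (hx : x ∈ orthant d) : 0 < hermiteFun β 0 x :=
  Finset.prod_pos fun i _ => by
    have h1 := hx i
    have h2 := laguerreWeight_pos (hβ i) 0
    rw [Pi.zero_apply, hermiteFun₁_zero (hβ i)]
    positivity

/-- The coefficients in the expansion of a Gaussian into Laguerre functions. -/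
def gaussianCoeff (β : ℝ) (N n : ℕ) : ℝ :=
  √(laguerreWeight β 0) * (1 - (N / (N + 1) : ℝ)) ^ (β + 1) *
    ((N / (N + 1) : ℝ) ^ n * √(laguerreWeight β n)⁻¹)

lemma gaussianCoeff_nonneg {β : ℝ} (N n : ℕ) : 0 ≤ gaussianCoeff β N n := by
  have h : (1 : ℝ) - N / (N + 1) = 1 / (N + 1) := by field_simp; ring
  rw [gaussianCoeff, h]
  positivity

lemma summable_gaussianCoeff {β : ℝ} (hβ : -1 < β) (N : ℕ) : Summable (gaussianCoeff β N) := by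
  refine Summable.mul_left _ ?_
  have h := (isSubexp_inv_laguerreWeight hβ).sqrt ((N + 1) / (N + 2)) (by positivity)
    (by rw [div_lt_one (by positivity)]; linarith)
  refine h.of_nonneg_of_le (fun n => by positivity) fun n => ?_
  rw [mul_comm, abs_of_nonneg (Real.sqrt_nonneg _)]
  have : (N / (N + 1) : ℝ) ≤ (N + 1) / (N + 2) := by
    rw [div_le_div_iff₀ (by positivity) (by positivity)]
    nlinarith
  gcongr

/-- The generating function at r = N/(N+1): then r/(1-r) = N, and its exponential factor is exactly
exp(-N x²). -/
lemma hasSum_gaussianCoeff {β : ℝ} (hβ : -1 < β) (N : ℕ) (x : ℝ) :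
    HasSum (fun n => gaussianCoeff β N n * hermiteFun₁ β n x)
      (hermiteFun₁ β 0 x * Real.exp (-(N * x ^ 2))) := by
  have h1 : (1 : ℝ) - N / (N + 1) = 1 / (N + 1) := by field_simp; ring
  have hr : |(N / (N + 1) : ℝ)| < 1 := by
    rw [abs_of_nonneg (by positivity), div_lt_one (by positivity)]
    linarith
  have h2 : (1 - (N / (N + 1) : ℝ)) ^ (β + 1) * (1 - (N / (N + 1) : ℝ)) ^ (-(β + 1)) = 1 := by
    rw [h1, ← Real.rpow_add (by positivity)]
    simp
  have h := (hasSum_laguerrePoly hβ (x ^ 2) hr).mul_left (√(laguerreWeight β 0) *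
    (1 - (N / (N + 1) : ℝ)) ^ (β + 1) * (√2 * x ^ (β + 1 / 2) * Real.exp (-x ^ 2 / 2)))
  convert! h using 1
  · funext n
    have h3 : √(laguerreWeight β n)⁻¹ * √(laguerreWeight β n) = 1 := by
      rw [Real.sqrt_inv]
      exact inv_mul_cancel₀ (Real.sqrt_pos.2 (laguerreWeight_pos hβ n)).ne'
    rw [gaussianCoeff, hermiteFun₁, laguerrePolyNormalized]
    rw [laguerreWeight] at h3
    rw [show laguerreWeight β n = Real.Gamma (n + 1) / Real.Gamma (n + β + 1) from rfl]
    linear_combination √(laguerreWeight β 0) * (1 - (N / (N + 1) : ℝ)) ^ (β + 1) *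
      (N / (N + 1) : ℝ) ^ n * √2 * laguerrePoly β n (x ^ 2) * x ^ (β + 1 / 2) *
      Real.exp (-x ^ 2 / 2) * h3
  · have h4 : x ^ 2 * (N / (N + 1) : ℝ) / (1 - N / (N + 1)) = N * x ^ 2 := by
      rw [h1]; field_simp
    rw [hermiteFun₁_zero hβ, h4]
    linear_combination -(√(laguerreWeight β 0) * (√2 * x ^ (β + 1 / 2) * Real.exp (-x ^ 2 / 2)) *
      Real.exp (-(N * x ^ 2))) * h2

/-- A function orthogonal to all φ_k is orthogonal to φ_0 times every Gaussian. Hence φ_0 u vanishes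
almost everywhere, and φ_0 > 0 on the orthant. -/
lemma ae_eq_zero_of_integral_hermiteFun_mul_eq_zero {β : Fin d → ℝ} (hβ : ∀ i, -1 < β i)
    {u : (Fin d → ℝ) → ℝ} (hu : MemLp u 2 (orthantMeasure d))
    (h : ∀ k, ∫ x, hermiteFun β k x * u x ∂(orthantMeasure d) = 0) :
    u =ᵐ[orthantMeasure d] 0 := by
  have hint : ∀ k, Integrable (fun x => hermiteFun β k x * u x) (orthantMeasure d) :=
    fun k => (memLp_hermiteFun hβ k).integrable_mul hu
  have key := ae_eq_zero_of_integral_mul_gaussian_eq_zero (hint 0) fun N => by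
    have hc : Summable fun k : Fin d → ℕ => ∏ i, gaussianCoeff (β i) (N i) (k i) :=
      (hasSum_pi_prod fun i => (summable_gaussianCoeff (hβ i) (N i)).hasSum).summable
    have hc0 : ∀ k : Fin d → ℕ, 0 ≤ ∏ i, gaussianCoeff (β i) (N i) (k i) := fun k =>
      Finset.prod_nonneg fun i _ => gaussianCoeff_nonneg _ _
    have hs : ∀ x, HasSum (fun k : Fin d → ℕ => (∏ i, gaussianCoeff (β i) (N i) (k i)) *
        (hermiteFun β k x * u x))
        (hermiteFun β 0 x * u x * ∏ i, Real.exp (-(N i * x i ^ 2))) := by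
      intro x
      have := (hasSum_pi_prod fun i => hasSum_gaussianCoeff (hβ i) (N i) (x i)).mul_right (u x)
      simp only [Finset.prod_mul_distrib] at this
      convert! this using 1
      · funext k
        rw [hermiteFun]
        ring
      · simp only [hermiteFun, Pi.zero_apply]
        ring
    have hsum := hasSum_integral_of_summable_integral_norm (μ := orthantMeasure d)
      (F := fun (k : Fin d → ℕ) x => (∏ i, gaussianCoeff (β i) (N i) (k i)) *
        (hermiteFun β k x * u x)) (fun k => (hint k).const_mul _) (by
      refine (hc.mul_right ((1 + ∫ x, u x ^ 2 ∂(orthantMeasure d)) / 2)).of_nonneg_of_le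
        (fun k => integral_nonneg fun x => norm_nonneg _) fun k => ?_
      simp_rw [norm_mul _ (hermiteFun β k _ * u _)]
      rw [integral_const_mul, Real.norm_of_nonneg (hc0 k)]
      refine mul_le_mul_of_nonneg_left ?_ (hc0 k)
      rw [← integral_hermiteFun_sq hβ k]
      exact (memLp_hermiteFun hβ k).integral_abs_mul_le hu)
    simp_rw [integral_const_mul, h, mul_zero, (hs _).tsum_eq] at hsum
    exact hsum.unique hasSum_zero
  filter_upwards [key, ae_mem_orthant d] with x hx hxo
  exact (mul_eq_zero.1 hx).resolve_left (hermiteFun_zero_pos hβ hxo).ne'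

section HilbertBasis

variable (𝕜 : Type*) [RCLike 𝕜]

lemma hermiteVec_eq {β : Fin d → ℝ} (hβ : ∀ i, -1 < β i) (k : Fin d → ℕ) :
    hermiteVec 𝕜 β k = (memLp_ofReal_hermiteFun 𝕜 hβ k).toLp :=
  dif_pos _

lemma coeFn_hermiteVec {β : Fin d → ℝ} (hβ : ∀ i, -1 < β i) (k : Fin d → ℕ) :
    hermiteVec 𝕜 β k =ᵐ[orthantMeasure d] fun x => (hermiteFun β k x : 𝕜) := by
  rw [hermiteVec_eq 𝕜 hβ]
  exact MemLp.coeFn_toLp _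

variable {𝕜}

lemma inner_hermiteVec {β : Fin d → ℝ} (hβ : ∀ i, -1 < β i) (k : Fin d → ℕ)
    (f : Lp 𝕜 2 (orthantMeasure d)) :
    inner 𝕜 (hermiteVec 𝕜 β k) f = ∫ x, (hermiteFun β k x : 𝕜) * f x ∂(orthantMeasure d) := by
  rw [L2.inner_def]
  refine integral_congr_ae ?_
  filter_upwards [coeFn_hermiteVec 𝕜 hβ k] with x hx
  rw [hx, RCLike.inner_apply, RCLike.conj_ofReal, mul_comm]

variable (𝕜)

lemma orthonormal_hermiteVec {β : Fin d → ℝ} (hβ : ∀ i, -1 < β i) :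
    Orthonormal 𝕜 (hermiteVec 𝕜 β) := by
  classical
  rw [orthonormal_iff_ite]
  intro k l
  rw [inner_hermiteVec hβ]
  have : ∫ x, (hermiteFun β k x : 𝕜) * hermiteVec 𝕜 β l x ∂(orthantMeasure d) =
      ∫ x, ((hermiteFun β k x * hermiteFun β l x : ℝ) : 𝕜) ∂(orthantMeasure d) := by
    refine integral_congr_ae ?_
    filter_upwards [coeFn_hermiteVec 𝕜 hβ l] with x hx
    rw [hx]
    push_cast
    rfl
  rw [this, integral_ofReal, integral_hermiteFun_mul hβ]
  split_ifs <;> simp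

lemma orthogonal_span_hermiteVec {β : Fin d → ℝ} (hβ : ∀ i, -1 < β i) :
    (Submodule.span 𝕜 (range (hermiteVec 𝕜 β)))ᗮ = ⊥ := by
  rw [eq_bot_iff]
  intro f hf
  have hf : ∀ k, ∫ x, (hermiteFun β k x : 𝕜) * f x ∂(orthantMeasure d) = 0 := fun k => by
    rw [← inner_hermiteVec hβ]
    exact (Submodule.mem_orthogonal _ _).1 hf _ (Submodule.subset_span ⟨k, rfl⟩)
  have hint : ∀ k, Integrable (fun x => (hermiteFun β k x : 𝕜) * f x) (orthantMeasure d) :=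
    fun k => (memLp_ofReal_hermiteFun 𝕜 hβ k).integrable_mul (Lp.memLp f)
  have hre := ae_eq_zero_of_integral_hermiteFun_mul_eq_zero hβ (Lp.memLp f).re fun k => by
    have := integral_re (hint k)
    simp only [hf k, RCLike.re_ofReal_mul, map_zero] at this
    exact this
  have him := ae_eq_zero_of_integral_hermiteFun_mul_eq_zero hβ (Lp.memLp f).im fun k => by
    have := integral_im (hint k)
    simp only [hf k, RCLike.im_ofReal_mul, map_zero] at this
    exact this
  rw [Submodule.mem_bot, Lp.eq_zero_iff_ae_eq_zero]
  filter_upwards [hre, him] with x h1 h2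
  exact RCLike.ext (by simpa using h1) (by simpa using h2)

/-- The Laguerre functions of Hermite type form an orthonormal basis of `L²`. -/
def hermiteBasis {β : Fin d → ℝ} (hβ : ∀ i, -1 < β i) :
    HilbertBasis (Fin d → ℕ) 𝕜 (Lp 𝕜 2 (orthantMeasure d)) :=
  HilbertBasis.mkOfOrthogonalEqBot (orthonormal_hermiteVec 𝕜 hβ) (orthogonal_span_hermiteVec 𝕜 hβ)

lemma coe_hermiteBasis {β : Fin d → ℝ} (hβ : ∀ i, -1 < β i) :
    ⇑(hermiteBasis 𝕜 hβ) = hermiteVec 𝕜 β :=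
  HilbertBasis.coe_mkOfOrthogonalEqBot _ _

end HilbertBasis

/-! ### Integral operators with bounded symmetric kernels -/

section SchurKernel

variable {X : Type*} [MeasurableSpace X] {𝕜 : Type*} [RCLike 𝕜]

/-- Cut at height 1: where |f| > 1 one has |f| ≤ |f|^p, and elsewhere f is bounded. -/
lemma MeasureTheory.MemLp.memL1AddLinfty {μ : Measure X} {p : ℝ≥0∞} (hp : 1 ≤ p) {f : X → 𝕜}
    (hf : MemLp f p μ) : MemL1AddLinfty μ f := by
  rcases eq_or_ne p ∞ with rfl | hp'
  · exact ⟨0, f, MemLp.zero, hf, by simp⟩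
  have hp0 : p ≠ 0 := (zero_lt_one.trans_le hp).ne'
  have hp1 : 1 ≤ p.toReal := by
    rw [← ENNReal.toReal_one]
    exact ENNReal.toReal_mono hp' hp
  obtain ⟨f', hf', hff'⟩ := hf.aestronglyMeasurable
  have hfp : ∫⁻ x, ‖f' x‖ₑ ^ p.toReal ∂μ < ∞ := by
    have h := (hf.ae_eq hff').eLpNorm_lt_top
    rwa [eLpNorm_lt_top_iff_lintegral_rpow_enorm_lt_top hp0 hp'] at h
  set S : Set X := {x | 1 < ‖f' x‖} with hS
  have hSm : MeasurableSet S := measurableSet_lt measurable_const hf'.norm.measurable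
  refine ⟨S.indicator f', Sᶜ.indicator f', ⟨(hf'.indicator hSm).aestronglyMeasurable, ?_⟩,
    memLp_top_of_bound (hf'.indicator hSm.compl).aestronglyMeasurable 1
      (Eventually.of_forall fun x => ?_), ?_⟩
  · rw [eLpNorm_one_eq_lintegral_enorm]
    refine (lintegral_mono fun x => ?_).trans_lt hfp
    by_cases hx : x ∈ S
    · rw [indicator_of_mem hx]
      have h1 : (1 : ℝ≥0∞) ≤ ‖f' x‖ₑ := by
        rw [← ofReal_norm, ← ENNReal.ofReal_one]
        exact ENNReal.ofReal_le_ofReal (le_of_lt hx)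
      exact ENNReal.le_rpow_self_of_one_le h1 hp1
    · simp [indicator_of_notMem hx]
  · by_cases hx : x ∈ S
    · rw [indicator_of_notMem (by simpa using hx)]
      simp
    · rw [indicator_of_mem hx]
      exact not_lt.1 hx
  · rw [indicator_self_add_compl]
    exact hff'

lemma MemL1AddLinfty.aestronglyMeasurable {μ : Measure X} {f : X → 𝕜} (hf : MemL1AddLinfty μ f) :
    AEStronglyMeasurable f μ := by
  obtain ⟨g, h, hg, hh, he⟩ := hf
  exact (hg.aestronglyMeasurable.add hh.aestronglyMeasurable).congr he.symm

/-- The integral operator with kernel `K`. -/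
def kernelOp (μ : Measure X) (K : X → X → ℝ) (f : X → 𝕜) (x : X) : 𝕜 :=
  ∫ y, (K x y : 𝕜) * f y ∂μ

/-- A nonnegative symmetric kernel with bounded sections whose integrals are at most `C`. -/
structure IsSchurKernel (μ : Measure X) (K : X → X → ℝ) (C : ℝ) : Prop where
  measurable : Measurable fun p : X × X => K p.1 p.2
  nonneg : ∀ x y, 0 ≤ K x y
  symm : ∀ x y, K x y = K y x
  lintegral_le : ∀ x, ∫⁻ y, ENNReal.ofReal (K x y) ∂μ ≤ ENNReal.ofReal C
  bdd : ∀ x, ∃ M, ∀ y, K x y ≤ M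

namespace IsSchurKernel

variable {μ : Measure X} {K : X → X → ℝ} {C : ℝ}

lemma measurable_right (hK : IsSchurKernel μ K C) (x : X) : Measurable (K x) :=
  hK.measurable.comp (measurable_const.prodMk measurable_id)

lemma measurable_ofReal (hK : IsSchurKernel μ K C) :
    Measurable fun p : X × X => ENNReal.ofReal (K p.1 p.2) :=
  hK.measurable.ennreal_ofReal

lemma aestronglyMeasurable_right (hK : IsSchurKernel μ K C) (x : X) :
    AEStronglyMeasurable (fun y => (K x y : 𝕜)) μ :=
  (RCLike.measurable_ofReal.comp (hK.measurable_right x)).aestronglyMeasurable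

lemma enorm_eq (hK : IsSchurKernel μ K C) (x y : X) :
    ‖(K x y : 𝕜)‖ₑ = ENNReal.ofReal (K x y) := by
  rw [← ofReal_norm, RCLike.norm_ofReal, abs_of_nonneg (hK.nonneg x y)]

lemma integrable_right (hK : IsSchurKernel μ K C) (x : X) : Integrable (fun y => (K x y : 𝕜)) μ := by
  refine ⟨hK.aestronglyMeasurable_right x, ?_⟩
  rw [HasFiniteIntegral]
  simp_rw [hK.enorm_eq]
  exact (hK.lintegral_le x).trans_lt ENNReal.ofReal_lt_top

/-- Boundedness of the section handles the L¹ part of f, its integrability the L^∞ part. -/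
lemma integrable_mul (hK : IsSchurKernel μ K C) (x : X) {f : X → 𝕜} (hf : MemL1AddLinfty μ f) :
    Integrable (fun y => (K x y : 𝕜) * f y) μ := by
  obtain ⟨g, h, hg, hh, he⟩ := hf
  obtain ⟨M, hM⟩ := hK.bdd x
  have h1 : Integrable (fun y => (K x y : 𝕜) * g y) μ :=
    (memLp_one_iff_integrable.1 hg).bdd_mul (c := M) (hK.aestronglyMeasurable_right x)
      (Eventually.of_forall fun y => by
        rw [RCLike.norm_ofReal, abs_of_nonneg (hK.nonneg x y)]
        exact hM y)
  have h2 : Integrable (fun y => (K x y : 𝕜) * h y) μ := (hK.integrable_right x).mul_of_top_left hh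
  refine (h1.add h2).congr ?_
  filter_upwards [he] with y hy
  rw [hy]
  simp [mul_add]

lemma kernelOp_congr_ae (K : X → X → ℝ) {f g : X → 𝕜} (h : f =ᵐ[μ] g) :
    kernelOp μ K f = kernelOp μ K g := by
  funext x
  refine integral_congr_ae ?_
  filter_upwards [h] with y hy
  rw [hy]

lemma kernelOp_add (hK : IsSchurKernel μ K C) {f g : X → 𝕜} (hf : MemL1AddLinfty μ f)
    (hg : MemL1AddLinfty μ g) : kernelOp μ K (f + g) = kernelOp μ K f + kernelOp μ K g := by
  funext x
  simp only [kernelOp, Pi.add_apply, mul_add]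
  exact integral_add (hK.integrable_mul x hf) (hK.integrable_mul x hg)

lemma kernelOp_smul (K : X → X → ℝ) (c : 𝕜) (f : X → 𝕜) :
    kernelOp μ K (c • f) = c • kernelOp μ K f := by
  funext x
  simp only [kernelOp, Pi.smul_apply, smul_eq_mul]
  rw [← integral_const_mul]
  congr 1
  funext y
  ring

lemma aestronglyMeasurable_kernelOp [SFinite μ] (hK : IsSchurKernel μ K C) {f : X → 𝕜}
    (hf : AEStronglyMeasurable f μ) : AEStronglyMeasurable (kernelOp μ K f) μ := by
  refine AEStronglyMeasurable.integral_prod_right' (f := fun p : X × X => (K p.1 p.2 : 𝕜) * f p.2) ?_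
  exact (RCLike.measurable_ofReal.comp hK.measurable).aestronglyMeasurable.mul hf.comp_snd

lemma enorm_kernelOp_le (hK : IsSchurKernel μ K C) (f : X → 𝕜) (x : X) :
    ‖kernelOp μ K f x‖ₑ ≤ ∫⁻ y, ENNReal.ofReal (K x y) * ‖f y‖ₑ ∂μ := by
  refine (enorm_integral_le_lintegral_enorm _).trans_eq ?_
  simp_rw [enorm_mul, hK.enorm_eq]

/-- Integrals against the kernel, taken in the second variable first. -/
lemma lintegral_lintegral_le [SFinite μ] (hK : IsSchurKernel μ K C) {g : X → ℝ≥0∞}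
    (hg : AEMeasurable g μ) :
    ∫⁻ x, ∫⁻ y, ENNReal.ofReal (K x y) * g y ∂μ ∂μ ≤ ENNReal.ofReal C * ∫⁻ y, g y ∂μ := by
  rw [lintegral_lintegral_swap (hK.measurable_ofReal.aemeasurable.mul hg.comp_snd),
    ← lintegral_const_mul'' _ hg]
  refine lintegral_mono fun y => ?_
  simp_rw [hK.symm _ y]
  rw [lintegral_mul_const _ (hK.measurable_right y).ennreal_ofReal]
  exact mul_le_mul_left (hK.lintegral_le y) _

/-- The Schur test. -/
theorem eLpNorm_kernelOp_le [SFinite μ] (hK : IsSchurKernel μ K C) {p : ℝ≥0∞} (hp : 1 ≤ p)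
    {f : X → 𝕜} (hf : AEStronglyMeasurable f μ) :
    eLpNorm (kernelOp μ K f) p μ ≤ ENNReal.ofReal C * eLpNorm f p μ := by
  rcases eq_or_ne p ∞ with rfl | hp'
  · rw [eLpNorm_exponent_top, eLpNorm_exponent_top]
    refine eLpNormEssSup_le_of_ae_enorm_bound (Eventually.of_forall fun x => ?_)
    refine (hK.enorm_kernelOp_le f x).trans ?_
    calc ∫⁻ y, ENNReal.ofReal (K x y) * ‖f y‖ₑ ∂μ
        ≤ ∫⁻ y, ENNReal.ofReal (K x y) * eLpNormEssSup f μ ∂μ := by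
          refine lintegral_mono_ae ?_
          filter_upwards [enorm_ae_le_eLpNormEssSup f μ] with y hy
          gcongr
      _ ≤ ENNReal.ofReal C * eLpNormEssSup f μ := by
          rw [lintegral_mul_const _ (hK.measurable_right x).ennreal_ofReal]
          exact mul_le_mul_left (hK.lintegral_le x) _
  have hp0 : p ≠ 0 := (zero_lt_one.trans_le hp).ne'
  set q := p.toReal with hq
  have hq1 : 1 ≤ q := by
    rw [← ENNReal.toReal_one]
    exact ENNReal.toReal_mono hp' hp
  have hq0 : 0 < q := zero_lt_one.trans_le hq1
  set c := ENNReal.ofReal C with hc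
  -- Hölder's inequality for the measure K(x, y) dy, whose total mass is at most C. Integrating in x
  -- then contributes the last power of C by symmetry.
  have key : ∀ x, ‖kernelOp μ K f x‖ₑ ^ q ≤
      c ^ (q - 1) * ∫⁻ y, ENNReal.ofReal (K x y) * ‖f y‖ₑ ^ q ∂μ := by
    intro x
    set ν := μ.withDensity fun y => ENNReal.ofReal (K x y) with hν
    have hkm := (hK.measurable_right x).ennreal_ofReal
    have hfν : AEStronglyMeasurable f ν := hf.mono_ac (withDensity_absolutelyContinuous _ _)
    have h1 : ∀ r : ℝ, eLpNorm' f r ν =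
        (∫⁻ y, ENNReal.ofReal (K x y) * ‖f y‖ₑ ^ r ∂μ) ^ (1 / r) := by
      intro r
      rw [eLpNorm'_eq_lintegral_enorm, hν, lintegral_withDensity_eq_lintegral_mul₀ hkm.aemeasurable
        (hf.enorm.pow_const r)]
      rfl
    have h2 : ν univ ≤ c := by
      rw [hν, withDensity_apply _ MeasurableSet.univ, Measure.restrict_univ]
      exact hK.lintegral_le x
    have h3 := eLpNorm'_le_eLpNorm'_mul_rpow_measure_univ one_pos hq1 hfν
    rw [h1, h1] at h3
    simp only [ENNReal.rpow_one, div_one] at h3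
    have h4 := (hK.enorm_kernelOp_le f x).trans h3
    calc ‖kernelOp μ K f x‖ₑ ^ q ≤ _ := ENNReal.rpow_le_rpow h4 hq0.le
      _ = (∫⁻ y, ENNReal.ofReal (K x y) * ‖f y‖ₑ ^ q ∂μ) * ν univ ^ (q - 1) := by
        rw [ENNReal.mul_rpow_of_nonneg _ _ hq0.le, ← ENNReal.rpow_mul, ← ENNReal.rpow_mul]
        congr 2
        · rw [one_div, inv_mul_cancel₀ hq0.ne', ENNReal.rpow_one]
        · field_simp
      _ ≤ _ := by
        rw [mul_comm]
        gcongr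
  rw [eLpNorm_eq_lintegral_rpow_enorm_toReal hp0 hp', eLpNorm_eq_lintegral_rpow_enorm_toReal hp0 hp',
    ← hq]
  have hcq : c ^ (q - 1) * c = c ^ q := by
    rcases eq_or_ne c 0 with h | h
    · rw [h, mul_zero, ENNReal.zero_rpow_of_pos hq0]
    · nth_rewrite 2 [← ENNReal.rpow_one c]
      rw [← ENNReal.rpow_add _ _ h ENNReal.ofReal_ne_top, sub_add_cancel]
  have hm : ∫⁻ x, ‖kernelOp μ K f x‖ₑ ^ q ∂μ ≤ c ^ q * ∫⁻ y, ‖f y‖ₑ ^ q ∂μ := by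
    refine (lintegral_mono key).trans ?_
    rw [lintegral_const_mul' _ _ (by finiteness), ← hcq, mul_assoc]
    exact mul_le_mul_right (hK.lintegral_lintegral_le (hf.enorm.pow_const q)) _
  refine (ENNReal.rpow_le_rpow hm (by positivity)).trans_eq ?_
  rw [ENNReal.mul_rpow_of_nonneg _ _ (by positivity), ← ENNReal.rpow_mul, mul_one_div_cancel hq0.ne',
    ENNReal.rpow_one]

lemma memLp_kernelOp [SFinite μ] (hK : IsSchurKernel μ K C) {p : ℝ≥0∞} (hp : 1 ≤ p)
    {f : X → 𝕜} (hf : MemLp f p μ) : MemLp (kernelOp μ K f) p μ :=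
  ⟨hK.aestronglyMeasurable_kernelOp hf.1, (hK.eLpNorm_kernelOp_le hp hf.1).trans_lt
    (ENNReal.mul_lt_top ENNReal.ofReal_lt_top hf.2)⟩

lemma lpOpNormLE [SFinite μ] (hK : IsSchurKernel μ K C) {p : ℝ≥0∞} (hp : 1 ≤ p)
    {A : (X → 𝕜) → (X → 𝕜)} (hA : ∀ f, A f =ᵐ[μ] kernelOp μ K f) : LpOpNormLE μ p A C := by
  intro f hf
  refine ⟨(memLp_congr_ae (hA f)).2 (hK.memLp_kernelOp hp hf), ?_⟩
  rw [eLpNorm_congr_ae (hA f)]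
  exact hK.eLpNorm_kernelOp_le hp hf.1

/-- The operators are symmetric on `L²`. -/
lemma integral_kernelOp_mul [SFinite μ] (hK : IsSchurKernel μ K C) {f g : X → 𝕜}
    (hf : MemLp f 2 μ) (hg : MemLp g 2 μ) :
    ∫ x, kernelOp μ K f x * g x ∂μ = ∫ x, f x * kernelOp μ K g x ∂μ := by
  have hsq : ∀ {h : X → 𝕜}, MemLp h 2 μ → ∫⁻ x, ‖h x‖ₑ ^ (2 : ℝ) ∂μ < ∞ := fun {h} hh => by
    have := hh.2
    rwa [eLpNorm_lt_top_iff_lintegral_rpow_enorm_lt_top two_ne_zero ENNReal.ofNat_ne_top] at this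
  have hint : Integrable (fun p : X × X => (K p.1 p.2 : 𝕜) * f p.2 * g p.1) (μ.prod μ) := by
    have hm : AEStronglyMeasurable (fun p : X × X => (K p.1 p.2 : 𝕜) * f p.2 * g p.1) (μ.prod μ) :=
      ((RCLike.measurable_ofReal.comp hK.measurable).aestronglyMeasurable.mul hf.1.comp_snd).mul
        hg.1.comp_fst
    refine ⟨hm, ?_⟩
    rw [HasFiniteIntegral, lintegral_prod _ hm.enorm]
    -- The crude bound |f||g| ≤ |f|² + |g|² separates the variables, so row and column integrals of
    -- K suffice for Fubini.
    have hle : ∀ x y, ‖(K x y : 𝕜) * f y * g x‖ₑ ≤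
        ENNReal.ofReal (K x y) * ‖f y‖ₑ ^ (2 : ℝ) + ENNReal.ofReal (K x y) * ‖g x‖ₑ ^ (2 : ℝ) := by
      intro x y
      rw [enorm_mul, enorm_mul, hK.enorm_eq, ← mul_add, mul_assoc, ENNReal.rpow_two, ENNReal.rpow_two]
      refine mul_le_mul_right ?_ _
      rcases le_total ‖f y‖ₑ ‖g x‖ₑ with h | h
      · exact (mul_le_mul_left h _).trans (by rw [← sq]; exact le_add_self)
      · exact (mul_le_mul_right h _).trans (by rw [← sq]; exact le_self_add)
    calc ∫⁻ x, ∫⁻ y, ‖(K x y : 𝕜) * f y * g x‖ₑ ∂μ ∂μ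
        ≤ ∫⁻ x, ((∫⁻ y, ENNReal.ofReal (K x y) * ‖f y‖ₑ ^ (2 : ℝ) ∂μ) +
          ENNReal.ofReal C * ‖g x‖ₑ ^ (2 : ℝ)) ∂μ := by
          refine lintegral_mono fun x => (lintegral_mono (hle x)).trans ?_
          rw [lintegral_add_right _ ((hK.measurable_right x).ennreal_ofReal.mul_const _),
            lintegral_mul_const _ (hK.measurable_right x).ennreal_ofReal]
          exact add_le_add le_rfl (mul_le_mul_left (hK.lintegral_le x) _)
      _ ≤ ENNReal.ofReal C * ∫⁻ y, ‖f y‖ₑ ^ (2 : ℝ) ∂μ +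
          ENNReal.ofReal C * ∫⁻ x, ‖g x‖ₑ ^ (2 : ℝ) ∂μ := by
          rw [lintegral_add_right' _ ((hg.1.enorm.pow_const _).const_mul _),
            lintegral_const_mul'' _ (hg.1.enorm.pow_const _)]
          exact add_le_add (hK.lintegral_lintegral_le (hf.1.enorm.pow_const _)) le_rfl
      _ < ∞ := ENNReal.add_lt_top.2 ⟨ENNReal.mul_lt_top ENNReal.ofReal_lt_top (hsq hf),
          ENNReal.mul_lt_top ENNReal.ofReal_lt_top (hsq hg)⟩
  simp only [kernelOp, ← integral_mul_const, ← integral_const_mul]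
  rw [integral_integral_swap hint]
  refine integral_congr_ae (Eventually.of_forall fun y => integral_congr_ae
    (Eventually.of_forall fun x => ?_))
  simp only [hK.symm x y]
  ring

/-- Composition of kernel operators. -/
lemma kernelOp_kernelOp [SFinite μ] {L M : X → X → ℝ} {C' : ℝ} (hK : IsSchurKernel μ K C)
    (hL : IsSchurKernel μ L C') (hKL : ∀ x y, ∫ z, K x z * L z y ∂μ = M x y) {f : X → 𝕜}
    (hf : MemL1AddLinfty μ f) :
    kernelOp μ K (kernelOp μ L f) = kernelOp μ M f := by
  funext x
  have hint : Integrable (fun p : X × X => (K x p.1 : 𝕜) * ((L p.1 p.2 : 𝕜) * f p.2)) (μ.prod μ) := by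
    have hmeas : ∀ {g : X → 𝕜}, AEStronglyMeasurable g μ → AEStronglyMeasurable
        (fun p : X × X => (K x p.1 : 𝕜) * ((L p.1 p.2 : 𝕜) * g p.2)) (μ.prod μ) := fun hg =>
      (hK.aestronglyMeasurable_right x).comp_fst.mul
        ((RCLike.measurable_ofReal.comp hL.measurable).aestronglyMeasurable.mul hg.comp_snd)
    have hen : ∀ (g : X → 𝕜) (z y : X), ‖(K x z : 𝕜) * ((L z y : 𝕜) * g y)‖ₑ =
        ENNReal.ofReal (K x z) * (ENNReal.ofReal (L z y) * ‖g y‖ₑ) := fun g z y => by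
      rw [enorm_mul, enorm_mul, hK.enorm_eq, hL.enorm_eq]
    -- Fubini is justified separately for the two parts: the L¹ part uses boundedness of K(x, ·) and
    -- the column integrals of L, the L^∞ part uses the row integrals of both kernels.
    obtain ⟨g, h, hg, hh, he⟩ := hf
    obtain ⟨B, hB⟩ := hK.bdd x
    have h1 : Integrable (fun p : X × X => (K x p.1 : 𝕜) * ((L p.1 p.2 : 𝕜) * g p.2)) (μ.prod μ) := by
      refine ⟨hmeas hg.1, ?_⟩
      rw [HasFiniteIntegral, lintegral_prod _ (hmeas hg.1).enorm]
      simp_rw [hen]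
      calc ∫⁻ z, ∫⁻ y, ENNReal.ofReal (K x z) * (ENNReal.ofReal (L z y) * ‖g y‖ₑ) ∂μ ∂μ
          ≤ ∫⁻ z, ENNReal.ofReal B * ∫⁻ y, ENNReal.ofReal (L z y) * ‖g y‖ₑ ∂μ ∂μ := by
            refine lintegral_mono fun z => ?_
            rw [lintegral_const_mul' _ _ ENNReal.ofReal_ne_top]
            exact mul_le_mul_left (ENNReal.ofReal_le_ofReal (hB z)) _
        _ ≤ ENNReal.ofReal B * (ENNReal.ofReal C' * ∫⁻ y, ‖g y‖ₑ ∂μ) := by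
            rw [lintegral_const_mul' _ _ ENNReal.ofReal_ne_top]
            exact mul_le_mul_right (hL.lintegral_lintegral_le hg.1.enorm) _
        _ < ∞ := by
            have := hg.2
            rw [eLpNorm_one_eq_lintegral_enorm] at this
            exact ENNReal.mul_lt_top ENNReal.ofReal_lt_top
              (ENNReal.mul_lt_top ENNReal.ofReal_lt_top this)
    have h2 : Integrable (fun p : X × X => (K x p.1 : 𝕜) * ((L p.1 p.2 : 𝕜) * h p.2)) (μ.prod μ) := by
      refine ⟨hmeas hh.1, ?_⟩
      rw [HasFiniteIntegral, lintegral_prod _ (hmeas hh.1).enorm]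
      simp_rw [hen]
      calc ∫⁻ z, ∫⁻ y, ENNReal.ofReal (K x z) * (ENNReal.ofReal (L z y) * ‖h y‖ₑ) ∂μ ∂μ
          ≤ ∫⁻ z, ENNReal.ofReal (K x z) * (ENNReal.ofReal C' * eLpNormEssSup h μ) ∂μ := by
            refine lintegral_mono fun z => ?_
            rw [lintegral_const_mul' _ _ ENNReal.ofReal_ne_top]
            refine mul_le_mul_right ?_ _
            refine (lintegral_mono_ae (g := fun y => ENNReal.ofReal (L z y) * eLpNormEssSup h μ)
              ?_).trans ?_
            · filter_upwards [enorm_ae_le_eLpNormEssSup h μ] with y hy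
              gcongr
            · rw [lintegral_mul_const _ (hL.measurable_right z).ennreal_ofReal]
              exact mul_le_mul_left (hL.lintegral_le z) _
        _ ≤ ENNReal.ofReal C * (ENNReal.ofReal C' * eLpNormEssSup h μ) := by
            rw [lintegral_mul_const _ (hK.measurable_right x).ennreal_ofReal]
            exact mul_le_mul_left (hK.lintegral_le x) _
        _ < ∞ := by
            have := hh.2
            rw [eLpNorm_exponent_top] at this
            exact ENNReal.mul_lt_top ENNReal.ofReal_lt_top
              (ENNReal.mul_lt_top ENNReal.ofReal_lt_top this)
    refine (h1.add h2).congr ?_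
    filter_upwards [Measure.quasiMeasurePreserving_snd.ae_eq_comp he] with p hp
    simp only [Function.comp_apply] at hp
    simp only [Pi.add_apply, hp]
    ring
  simp only [kernelOp, ← integral_const_mul]
  rw [integral_integral_swap hint]
  refine integral_congr_ae (Eventually.of_forall fun y => ?_)
  simp only [← mul_assoc]
  rw [integral_mul_const, ← hKL x y, ← integral_ofReal]
  congr 2
  funext z
  push_cast
  rfl

lemma kernelOp_nonneg (hK : IsSchurKernel μ K C) {f : X → 𝕜} (hf : ∀ᵐ x ∂μ, 0 ≤ f x) (x : X) :
    0 ≤ kernelOp μ K f x := by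
  refine integral_nonneg_of_ae ?_
  filter_upwards [hf] with y hy
  exact mul_nonneg (RCLike.ofReal_nonneg.2 (hK.nonneg x y)) hy

lemma kernelOp_one (hK : IsSchurKernel μ K C) (x : X) :
    kernelOp μ K (fun _ => (1 : 𝕜)) x = ((∫⁻ y, ENNReal.ofReal (K x y) ∂μ).toReal : 𝕜) := by
  simp only [kernelOp, mul_one]
  rw [integral_ofReal, integral_eq_lintegral_of_nonneg_ae (Eventually.of_forall (hK.nonneg x))
    (hK.measurable_right x).aestronglyMeasurable]

lemma kernelOp_one_le (hK : IsSchurKernel μ K C) (hC : 0 ≤ C) (x : X) :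
    kernelOp μ K (fun _ => (1 : 𝕜)) x ≤ (C : 𝕜) := by
  rw [hK.kernelOp_one, RCLike.ofReal_le_ofReal]
  exact ENNReal.toReal_le_of_le_ofReal hC (hK.lintegral_le x)

end IsSchurKernel

/-- A family of integral operators with submarkovian kernels satisfying the Chapman–Kolmogorov
equations is a submarkovian symmetric diffusion semigroup as soon as it is continuous on `L²`. -/
theorem isSubmarkovian_of_kernel {μ : Measure X} [SFinite μ] {T : ℝ → (X → 𝕜) → (X → 𝕜)}
    {K : ℝ → X → X → ℝ} (hK : ∀ t, 0 < t → IsSchurKernel μ (K t) 1) (hT0 : ∀ f, T 0 f = f)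
    (hT : ∀ t, 0 < t → ∀ f, T t f =ᵐ[μ] kernelOp μ (K t) f)
    (hCK : ∀ s t, 0 < s → 0 < t → ∀ x y, ∫ z, K s x z * K t z y ∂μ = K (s + t) x y)
    (hcont : ∀ f, MemLp f 2 μ → Tendsto (fun t => eLpNorm (T t f - f) 2 μ) (𝓝[>] 0) (𝓝 0)) :
    IsSubmarkovian μ T where
  congr_ae t ht f g _ hfg := by
    rcases ht.eq_or_lt with rfl | ht
    · rwa [hT0, hT0]
    · refine (hT t ht f).trans (EventuallyEq.trans ?_ (hT t ht g).symm)
      rw [IsSchurKernel.kernelOp_congr_ae _ hfg]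
  aestronglyMeasurable t ht f hf := by
    rcases ht.eq_or_lt with rfl | ht
    · rw [hT0]
      exact hf.aestronglyMeasurable
    · exact ((hK t ht).aestronglyMeasurable_kernelOp hf.aestronglyMeasurable).congr (hT t ht f).symm
  map_add t ht f g hf hg := by
    rcases ht.eq_or_lt with rfl | ht
    · rw [hT0, hT0, hT0]
    · filter_upwards [hT t ht (f + g), hT t ht f, hT t ht g] with x h1 h2 h3
      rw [h1, Pi.add_apply, h2, h3, (hK t ht).kernelOp_add hf hg, Pi.add_apply]
  map_smul t ht c f _ := by
    rcases ht.eq_or_lt with rfl | ht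
    · rw [hT0, hT0]
    · filter_upwards [hT t ht (c • f), hT t ht f] with x h1 h2
      rw [h1, Pi.smul_apply, h2, IsSchurKernel.kernelOp_smul, Pi.smul_apply]
  map_zero_time f _ := by rw [hT0]
  contraction p hp t ht f hf := by
    rcases ht.eq_or_lt with rfl | ht
    · rw [hT0]
    · rw [eLpNorm_congr_ae (hT t ht f)]
      simpa using (hK t ht).eLpNorm_kernelOp_le hp hf.1
  semigroup p hp s t hs ht f hf := by
    rcases hs.eq_or_lt with rfl | hs
    · rw [hT0, zero_add]
    rcases ht.eq_or_lt with rfl | ht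
    · rw [hT0, add_zero]
    filter_upwards [hT _ (add_pos hs ht) f, hT s hs (T t f)] with x h1 h2
    rw [h1, h2, IsSchurKernel.kernelOp_congr_ae _ (hT t ht f),
      (hK s hs).kernelOp_kernelOp (hK t ht) (hCK s t hs ht) (hf.memL1AddLinfty hp)]
  selfAdjoint t ht f g hf hg := by
    rcases ht.eq_or_lt with rfl | ht
    · rw [hT0, hT0]
    -- The inner product conjugates its first argument; since the kernel is real, the operator
    -- commutes with conjugation and the bilinear symmetry applies.
    have hstar : MemLp (fun x => (starRingEnd 𝕜) (f x)) 2 μ := hf.star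
    have h := (hK t ht).integral_kernelOp_mul hstar hg
    have hc : ∀ x, kernelOp μ (K t) (fun x => (starRingEnd 𝕜) (f x)) x =
        (starRingEnd 𝕜) (kernelOp μ (K t) f x) := by
      intro x
      rw [kernelOp, kernelOp, ← integral_conj]
      simp
    calc ∫ x, inner 𝕜 (T t f x) (g x) ∂μ
        = ∫ x, kernelOp μ (K t) (fun x => (starRingEnd 𝕜) (f x)) x * g x ∂μ := by
          refine integral_congr_ae ?_
          filter_upwards [hT t ht f] with x hx
          rw [hx, hc, RCLike.inner_apply, mul_comm]
      _ = ∫ x, (starRingEnd 𝕜) (f x) * kernelOp μ (K t) g x ∂μ := h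
      _ = _ := by
          refine integral_congr_ae ?_
          filter_upwards [hT t ht g] with x hx
          rw [hx, RCLike.inner_apply, mul_comm]
  continuous_zero := hcont
  positive t ht f _ h0 := by
    rcases ht.eq_or_lt with rfl | ht
    · rwa [hT0]
    · filter_upwards [hT t ht f] with x hx
      rw [hx]
      exact (hK t ht).kernelOp_nonneg h0 x
  map_one_le t ht := by
    rcases ht.eq_or_lt with rfl | ht
    · rw [hT0]
      simp
    · filter_upwards [hT t ht fun _ => 1] with x hx
      rw [hx]
      simpa using (hK t ht).kernelOp_one_le (𝕜 := 𝕜) zero_le_one x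

end SchurKernel

/-! ### The modified kernel -/

instance sigmaFinite_orthantMeasure (d : ℕ) : SigmaFinite (orthantMeasure d) := by
  unfold orthantMeasure
  infer_instance

/-- The kernel `e^{-2t} G_t^β`, extended by zero. -/
def modifiedKernel (β : Fin d → ℝ) (t : ℝ) (x y : Fin d → ℝ) : ℝ :=
  (orthant d ×ˢ orthant d).indicator
    (fun p => Real.exp (-2 * t) * laguerreKernel β t p.1 p.2) (x, y)

lemma modifiedKernel_of_mem (β : Fin d → ℝ) (t : ℝ) {x y : Fin d → ℝ} (hx : x ∈ orthant d)
    (hy : y ∈ orthant d) : modifiedKernel β t x y = Real.exp (-2 * t) * laguerreKernel β t x y :=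
  indicator_of_mem (mk_mem_prod hx hy) _

lemma modifiedKernel_of_notMem_left (β : Fin d → ℝ) (t : ℝ) {x : Fin d → ℝ} (hx : x ∉ orthant d)
    (y : Fin d → ℝ) : modifiedKernel β t x y = 0 :=
  indicator_of_notMem (fun h => hx h.1) _

lemma modifiedKernel_comm (β : Fin d → ℝ) (t : ℝ) (x y : Fin d → ℝ) :
    modifiedKernel β t x y = modifiedKernel β t y x := by
  by_cases hx : x ∈ orthant d <;> by_cases hy : y ∈ orthant d <;>
    simp [modifiedKernel, hx, hy, laguerreKernel_comm β t x y]

lemma lintegral_modifiedKernel {β : Fin d → ℝ} (hβ : ∀ i, -1 / 2 ≤ β i) {t : ℝ} (ht : 0 < t)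
    {x : Fin d → ℝ} (hx : x ∈ orthant d) :
    ∫⁻ y, ENNReal.ofReal (modifiedKernel β t x y) ∂(orthantMeasure d) =
      ENNReal.ofReal (Real.exp (-2 * t)) * ∏ i, laguerreKernelMass (β i) t (x i) := by
  rw [← lintegral_laguerreKernel hβ ht hx, ← lintegral_const_mul' _ _ ENNReal.ofReal_ne_top]
  refine lintegral_congr_ae ?_
  filter_upwards [ae_mem_orthant d] with y hy
  rw [modifiedKernel_of_mem β t hx hy, ENNReal.ofReal_mul (Real.exp_pos _).le]

lemma laguerreKernelMass_le {β : ℝ} (hβ : -1 / 2 ≤ β) {t x : ℝ} (ht : 0 < t) (hx : 0 < x) {C : ℝ}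
    (hC : ∀ w, 0 < w → laguerreMass (β / 2 + 1 / 4) w ≤ ENNReal.ofReal C) :
    laguerreKernelMass β t x ≤ ENNReal.ofReal (Real.cosh (2 * t) ^ (-1 / 2 : ℝ) * C) := by
  have hs : 0 < Real.sinh (2 * t) := Real.sinh_pos_iff.2 (by linarith)
  have hc := Real.cosh_pos (2 * t)
  rw [laguerreKernelMass, lintegral_laguerreKernel₁ hβ ht hx]
  refine (mul_le_mul' (ENNReal.ofReal_le_ofReal ?_) (hC _ ?_)).trans_eq
    (ENNReal.ofReal_mul (Real.rpow_nonneg hc.le _)).symm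
  swap
  · positivity
  refine mul_le_of_le_one_right (by positivity) ?_
  rw [Real.exp_le_one_iff, neg_nonpos]
  positivity

/-- Each coordinate contributes cosh(2t)^(-1/2) times a bound for its `laguerreMass`, whence the
power -d/2; the factor exp(-s² w) ≤ 1 has been discarded. -/
lemma isSchurKernel_modifiedKernel {β : Fin d → ℝ} (hβ : ∀ i, -1 / 2 ≤ β i) {t : ℝ} (ht : 0 < t)
    {C : Fin d → ℝ} (hC0 : ∀ i, 0 ≤ C i)
    (hC : ∀ i w, 0 < w → laguerreMass (β i / 2 + 1 / 4) w ≤ ENNReal.ofReal (C i)) :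
    IsSchurKernel (orthantMeasure d) (modifiedKernel β t)
      ((∏ i, C i) * (Real.exp (-2 * t) * Real.cosh (2 * t) ^ (-(d : ℝ) / 2))) := by
  have hβ' : ∀ i, -1 < β i := fun i => by linarith [hβ i]
  have hc := Real.cosh_pos (2 * t)
  refine ⟨?_, ?_, modifiedKernel_comm β t, ?_, ?_⟩
  · exact (measurable_const.mul (measurable_laguerreKernel hβ' t)).indicator
      ((measurableSet_orthant d).prod (measurableSet_orthant d))
  · intro x y
    exact indicator_nonneg (s := orthant d ×ˢ orthant d) (fun p hp =>
      mul_nonneg (Real.exp_pos _).le (laguerreKernel_nonneg hβ' ht hp.1 hp.2)) (x, y)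
  · intro x
    by_cases hx : x ∈ orthant d
    · rw [lintegral_modifiedKernel hβ ht hx]
      refine (mul_le_mul_right (Finset.prod_le_prod' fun i _ =>
        laguerreKernelMass_le (hβ i) ht (hx i) (hC i)) _).trans_eq ?_
      rw [← ENNReal.ofReal_prod_of_nonneg fun i _ => mul_nonneg (by positivity) (hC0 i),
        ← ENNReal.ofReal_mul (Real.exp_pos _).le, Finset.prod_mul_distrib, Finset.prod_const,
        Finset.card_univ, Fintype.card_fin, ← Real.rpow_mul_natCast hc.le]
      congr 1
      rw [show (-1 / 2 : ℝ) * d = -d / 2 by ring]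
      ring
    · simp [modifiedKernel_of_notMem_left β t hx]
  · intro x
    by_cases hx : x ∈ orthant d
    · obtain ⟨M, hM⟩ := exists_laguerreKernel_le hβ ht hx
      refine ⟨max (Real.exp (-2 * t) * M) 0, fun y => ?_⟩
      by_cases hy : y ∈ orthant d
      · rw [modifiedKernel_of_mem β t hx hy]
        exact (mul_le_mul_of_nonneg_left (hM y hy) (Real.exp_pos _).le).trans (le_max_left _ _)
      · rw [modifiedKernel_comm, modifiedKernel_of_notMem_left β t hy]
        exact le_max_right _ _
    · exact ⟨0, fun y => (modifiedKernel_of_notMem_left β t hx y).le⟩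

lemma exists_isSchurKernel_modifiedKernel {β : Fin d → ℝ} (hβ : ∀ i, -1 / 2 ≤ β i) :
    ∃ C, 1 < C ∧ ∀ t, 0 < t → IsSchurKernel (orthantMeasure d) (modifiedKernel β t)
      (C * (Real.exp (-2 * t) * Real.cosh (2 * t) ^ (-(d : ℝ) / 2))) := by
  choose C hC1 hC using fun i => exists_laguerreMass_le (a := β i / 2 + 1 / 4) (by linarith [hβ i])
  -- The product of the C i may equal 1; adding 1 makes the constant strictly larger than 1.
  refine ⟨∏ i, C i + 1, ?_, fun t ht => ?_⟩
  · have : 0 < ∏ i, C i := Finset.prod_pos fun i _ => zero_lt_one.trans_le (hC1 i)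
    linarith
  · have h := isSchurKernel_modifiedKernel hβ ht (fun i => zero_le_one.trans (hC1 i)) hC
    refine ⟨h.measurable, h.nonneg, h.symm, fun x => (h.lintegral_le x).trans ?_, h.bdd⟩
    have := Real.cosh_pos (2 * t)
    gcongr
    linarith

lemma exp_mul_cosh_rpow_lt_one {t : ℝ} (ht : 0 < t) :
    Real.exp (-2 * t) * Real.cosh (2 * t) ^ (-(d : ℝ) / 2) < 1 := by
  have h1 : Real.exp (-2 * t) < 1 := Real.exp_lt_one_iff.2 (by linarith)
  have h2 : Real.cosh (2 * t) ^ (-(d : ℝ) / 2) ≤ 1 :=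
    Real.rpow_le_one_of_one_le_of_nonpos (Real.one_le_cosh _)
      (by have := d.cast_nonneg (α := ℝ); linarith)
  have h3 : 0 < Real.cosh (2 * t) ^ (-(d : ℝ) / 2) := Real.rpow_pos_of_pos (Real.cosh_pos _) _
  nlinarith [Real.exp_pos (-2 * t)]

/-! ### Eigenfunction expansion of the kernel on L² and the Chapman–Kolmogorov equation. -/

lemma MeasureTheory.Integrable.memLp_two_of_bound {X : Type*} [MeasurableSpace X] {μ : Measure X}
    {f : X → ℝ} {M : ℝ} (hf : Integrable f μ) (hM : ∀ᵐ y ∂μ, ‖f y‖ ≤ M) : MemLp f 2 μ := by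
  rw [memLp_two_iff_integrable_sq hf.1]
  simp only [sq]
  exact hf.mul_bdd hf.1 hM

lemma memLp_laguerreKernel {β : Fin d → ℝ} (hβ : ∀ i, -1 / 2 ≤ β i) {t : ℝ} (ht : 0 < t)
    {x : Fin d → ℝ} (hx : x ∈ orthant d) :
    MemLp (fun y => laguerreKernel β t x y) 2 (orthantMeasure d) := by
  obtain ⟨M, hM⟩ := exists_laguerreKernel_le hβ ht hx
  obtain ⟨C, -, hC⟩ := exists_isSchurKernel_modifiedKernel hβ
  have h1 : Integrable (fun y => laguerreKernel β t x y) (orthantMeasure d) := by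
    refine (((hC t ht).integrable_right (𝕜 := ℝ) x).const_mul (Real.exp (-2 * t))⁻¹).congr ?_
    filter_upwards [ae_mem_orthant d] with y hy
    rw [modifiedKernel_of_mem β t hx hy]
    simp
  refine h1.memLp_two_of_bound (M := M) ?_
  filter_upwards [ae_mem_orthant d] with y hy
  rw [Real.norm_of_nonneg (laguerreKernel_nonneg (fun i => by linarith [hβ i]) ht hx hy)]
  exact hM y hy

lemma hasSum_integral_laguerreKernel_mul {β : Fin d → ℝ} (hβ : ∀ i, -1 < β i) {t : ℝ} (ht : 0 < t)
    (x : Fin d → ℝ) {h : (Fin d → ℝ) → ℝ} (hh : MemLp h 2 (orthantMeasure d)) :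
    HasSum (fun k => Real.exp (-t * hermiteEigenvalue β k) * hermiteFun β k x *
        ∫ y, hermiteFun β k y * h y ∂(orthantMeasure d))
      (∫ y, laguerreKernel β t x y * h y ∂(orthantMeasure d)) := by
  have hint : ∀ k, Integrable (fun y => hermiteFun β k y * h y) (orthantMeasure d) :=
    fun k => (memLp_hermiteFun hβ k).integrable_mul hh
  have hsum := hasSum_integral_of_summable_integral_norm (μ := orthantMeasure d)
    (F := fun (k : Fin d → ℕ) y => Real.exp (-t * hermiteEigenvalue β k) * hermiteFun β k x *
      (hermiteFun β k y * h y)) (fun k => (hint k).const_mul _) (by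
    refine ((summable_exp_mul_hermiteFun hβ ht x).mul_right
      ((1 + ∫ y, h y ^ 2 ∂(orthantMeasure d)) / 2)).of_nonneg_of_le
      (fun k => integral_nonneg fun y => norm_nonneg _) fun k => ?_
    simp_rw [norm_mul _ (hermiteFun β k _ * h _)]
    rw [integral_const_mul, norm_mul, Real.norm_of_nonneg (Real.exp_pos _).le, Real.norm_eq_abs]
    refine mul_le_mul_of_nonneg_left ?_ (by positivity)
    rw [← integral_hermiteFun_sq hβ k]
    exact (memLp_hermiteFun hβ k).integral_abs_mul_le hh)
  simp_rw [integral_const_mul] at hsum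
  convert! hsum using 1
  refine integral_congr_ae (Eventually.of_forall fun y => ?_)
  refine (((hasSum_hermiteKernelTerm hβ ht x y).mul_right (h y)).tsum_eq.symm.trans ?_)
  refine tsum_congr fun k => ?_
  rw [hermiteKernelTerm]
  ring

lemma integral_laguerreKernel_mul_hermiteFun {β : Fin d → ℝ} (hβ : ∀ i, -1 < β i) {t : ℝ}
    (ht : 0 < t) (x : Fin d → ℝ) (k : Fin d → ℕ) :
    ∫ y, laguerreKernel β t x y * hermiteFun β k y ∂(orthantMeasure d) =
      Real.exp (-t * hermiteEigenvalue β k) * hermiteFun β k x := by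
  have h := hasSum_integral_laguerreKernel_mul hβ ht x (memLp_hermiteFun hβ k)
  refine h.unique ?_
  simp_rw [integral_hermiteFun_mul hβ]
  convert! hasSum_single (f := fun l => Real.exp (-t * hermiteEigenvalue β l) * hermiteFun β l x *
    if l = k then 1 else 0) k (fun l hl => by simp [hl]) using 1
  simp

/-- Expand the kernel at time s; each φ_k is an eigenfunction of the kernel at time t, and the
exponentials multiply to the expansion at time s + t. -/
lemma integral_laguerreKernel_mul_laguerreKernel {β : Fin d → ℝ} (hβ : ∀ i, -1 / 2 ≤ β i)
    {s t : ℝ} (hs : 0 < s) (ht : 0 < t) (x : Fin d → ℝ) {y : Fin d → ℝ} (hy : y ∈ orthant d) :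
    ∫ z, laguerreKernel β s x z * laguerreKernel β t z y ∂(orthantMeasure d) =
      laguerreKernel β (s + t) x y := by
  have hβ' : ∀ i, -1 < β i := fun i => by linarith [hβ i]
  simp_rw [laguerreKernel_comm β t _ y]
  refine (hasSum_integral_laguerreKernel_mul hβ' hs x (memLp_laguerreKernel hβ ht hy)).unique ?_
  convert! hasSum_hermiteKernelTerm hβ' (add_pos hs ht) x y using 1
  funext k
  simp_rw [mul_comm (hermiteFun β k _) (laguerreKernel β t y _)]
  rw [integral_laguerreKernel_mul_hermiteFun hβ' ht, hermiteKernelTerm,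
    show -(s + t) * hermiteEigenvalue β k = -s * hermiteEigenvalue β k +
      -t * hermiteEigenvalue β k by ring, Real.exp_add]
  ring

lemma integral_modifiedKernel_mul_modifiedKernel {β : Fin d → ℝ} (hβ : ∀ i, -1 / 2 ≤ β i)
    {s t : ℝ} (hs : 0 < s) (ht : 0 < t) (x y : Fin d → ℝ) :
    ∫ z, modifiedKernel β s x z * modifiedKernel β t z y ∂(orthantMeasure d) =
      modifiedKernel β (s + t) x y := by
  by_cases hx : x ∈ orthant d
  swap
  · simp [modifiedKernel_of_notMem_left _ _ hx]
  by_cases hy : y ∈ orthant d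
  swap
  · simp_rw [modifiedKernel_comm β _ _ y]
    simp [modifiedKernel_of_notMem_left _ _ hy]
  rw [modifiedKernel_of_mem β _ hx hy, ← integral_laguerreKernel_mul_laguerreKernel hβ hs ht x hy,
    ← integral_const_mul]
  refine integral_congr_ae ?_
  filter_upwards [ae_mem_orthant d] with z hz
  rw [modifiedKernel_of_mem β s hx hz, modifiedKernel_of_mem β t hz hy,
    show -2 * (s + t) = -2 * s + -2 * t by ring, Real.exp_add]
  ring

/-! ### The modified semigroup -/

section Semigroup

variable {𝕜 : Type*} [RCLike 𝕜]

lemma modifiedHermiteSemigroup_zero (α : Fin d → ℝ) (j : Fin d) (f : (Fin d → ℝ) → 𝕜) :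
    modifiedHermiteSemigroup α j 0 f = f := by
  funext x
  simp [modifiedHermiteSemigroup]

lemma modifiedHermiteSemigroup_ae_eq {α : Fin d → ℝ} {j : Fin d}
    (hβ : ∀ i, -1 / 2 ≤ (α + Pi.single j 1 : Fin d → ℝ) i) {t : ℝ} (ht : 0 < t)
    (f : (Fin d → ℝ) → 𝕜) :
    modifiedHermiteSemigroup α j t f =ᵐ[orthantMeasure d]
      kernelOp (orthantMeasure d) (modifiedKernel (α + Pi.single j 1) t) f := by
  filter_upwards [ae_mem_orthant d] with x hx
  rw [modifiedHermiteSemigroup, if_neg ht.ne', kernelOp, ← integral_const_mul]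
  refine integral_congr_ae ?_
  filter_upwards [ae_mem_orthant d] with y hy
  rw [hermiteKernel_eq (fun i => by linarith [hβ i]) ht, modifiedKernel_of_mem _ _ hx hy]
  push_cast
  ring

lemma integrable_hermiteKernel_mul {β : Fin d → ℝ} (hβ : ∀ i, -1 / 2 ≤ β i) {t : ℝ} (ht : 0 < t)
    {f : (Fin d → ℝ) → 𝕜} (hf : MemL1AddLinfty (orthantMeasure d) f) {x : Fin d → ℝ}
    (hx : x ∈ orthant d) :
    Integrable (fun y => (hermiteKernel β t x y : 𝕜) * f y) (orthantMeasure d) := by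
  obtain ⟨C, -, hC⟩ := exists_isSchurKernel_modifiedKernel hβ
  refine (((hC t ht).integrable_mul x hf).const_mul ((Real.exp (-2 * t) : ℝ) : 𝕜)⁻¹).congr ?_
  filter_upwards [ae_mem_orthant d] with y hy
  have h0 : ((Real.exp (-2 * t) : ℝ) : 𝕜) ≠ 0 := RCLike.ofReal_ne_zero.2 (Real.exp_pos _).ne'
  rw [hermiteKernel_eq (fun i => by linarith [hβ i]) ht, modifiedKernel_of_mem _ _ hx hy,
    RCLike.ofReal_mul]
  field_simp

lemma hermiteEigenvalue_nonneg {β : Fin d → ℝ} (hβ : ∀ i, -1 / 2 ≤ β i) (k : Fin d → ℕ) :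
    0 ≤ hermiteEigenvalue β k := by
  have h1 : (0 : ℝ) ≤ ∑ i, (k i : ℝ) := Finset.sum_nonneg fun i _ => (k i).cast_nonneg
  have h2 : ∑ _i : Fin d, (-1 / 2 : ℝ) ≤ ∑ i, β i := Finset.sum_le_sum fun i _ => hβ i
  rw [Finset.sum_const, Finset.card_univ, Fintype.card_fin, nsmul_eq_mul] at h2
  have := d.cast_nonneg (α := ℝ)
  rw [hermiteEigenvalue]
  linarith

lemma kernelOp_hermiteFun {β : Fin d → ℝ} (hβ : ∀ i, -1 < β i) {t : ℝ} (ht : 0 < t)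
    (k : Fin d → ℕ) :
    kernelOp (orthantMeasure d) (modifiedKernel β t) (fun x => (hermiteFun β k x : 𝕜))
      =ᵐ[orthantMeasure d] fun x =>
        (Real.exp (-t * (hermiteEigenvalue β k + 2)) : 𝕜) * hermiteFun β k x := by
  filter_upwards [ae_mem_orthant d] with x hx
  have h : kernelOp (orthantMeasure d) (modifiedKernel β t) (fun x => (hermiteFun β k x : 𝕜)) x =
      ∫ y, ((Real.exp (-2 * t) * (laguerreKernel β t x y * hermiteFun β k y) : ℝ) : 𝕜)
        ∂(orthantMeasure d) := by
    refine integral_congr_ae ?_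
    filter_upwards [ae_mem_orthant d] with y hy
    rw [modifiedKernel_of_mem _ _ hx hy]
    push_cast
    ring
  rw [h, integral_ofReal, integral_const_mul, integral_laguerreKernel_mul_hermiteFun hβ ht,
    show -t * (hermiteEigenvalue β k + 2) = -2 * t + -t * hermiteEigenvalue β k by ring,
    Real.exp_add]
  push_cast
  ring

lemma modifiedHermiteHeat_eq_tsum (α : Fin d → ℝ) (j : Fin d) (t : ℝ)
    (f : Lp 𝕜 2 (orthantMeasure d)) :
    modifiedHermiteHeat α j t f = ∑' k, ((Real.exp (-t * (hermiteEigenvalue (α + Pi.single j 1) k + 2)) : 𝕜) *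
      inner 𝕜 (hermiteVec 𝕜 (α + Pi.single j 1) k) f) • hermiteVec 𝕜 (α + Pi.single j 1) k := by
  rw [modifiedHermiteHeat, hermiteHeat, ← tsum_const_smul'']
  refine tsum_congr fun k => ?_
  rw [show -t * (hermiteEigenvalue (α + Pi.single j 1) k + 2) =
    -2 * t + -t * hermiteEigenvalue (α + Pi.single j 1) k by ring, Real.exp_add, smul_smul]
  push_cast
  rw [mul_assoc]

lemma modifiedHermiteHeat_zero {α : Fin d → ℝ} {j : Fin d}
    (hβ : ∀ i, -1 < (α + Pi.single j 1 : Fin d → ℝ) i) (f : Lp 𝕜 2 (orthantMeasure d)) :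
    modifiedHermiteHeat α j 0 f = f := by
  rw [modifiedHermiteHeat_eq_tsum]
  have h := ((hermiteBasis 𝕜 hβ).hasSum_repr f).tsum_eq
  simp only [HilbertBasis.repr_apply_apply, coe_hermiteBasis] at h
  simpa using h

/-- Symmetry moves the operator onto φ_k, which is an eigenfunction. -/
lemma inner_hermiteVec_toLp_kernelOp {β : Fin d → ℝ} (hβ : ∀ i, -1 < β i) {t : ℝ} (ht : 0 < t)
    (f : Lp 𝕜 2 (orthantMeasure d)) {C : ℝ}
    (hK : IsSchurKernel (orthantMeasure d) (modifiedKernel β t) C) (k : Fin d → ℕ) :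
    inner 𝕜 (hermiteVec 𝕜 β k) (hK.memLp_kernelOp one_le_two (Lp.memLp f)).toLp =
      (Real.exp (-t * (hermiteEigenvalue β k + 2)) : 𝕜) * inner 𝕜 (hermiteVec 𝕜 β k) f := by
  rw [inner_hermiteVec hβ, inner_hermiteVec hβ]
  calc _ = ∫ x, (hermiteFun β k x : 𝕜) * kernelOp (orthantMeasure d) (modifiedKernel β t) f x
          ∂(orthantMeasure d) := by
        refine integral_congr_ae ?_
        filter_upwards [(hK.memLp_kernelOp one_le_two (Lp.memLp f)).coeFn_toLp] with x hx
        rw [hx]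
    _ = ∫ x, kernelOp (orthantMeasure d) (modifiedKernel β t)
          (fun x => (hermiteFun β k x : 𝕜)) x * f x ∂(orthantMeasure d) :=
        (hK.integral_kernelOp_mul (memLp_ofReal_hermiteFun 𝕜 hβ k) (Lp.memLp f)).symm
    _ = _ := by
        rw [← integral_const_mul]
        refine integral_congr_ae ?_
        filter_upwards [kernelOp_hermiteFun (𝕜 := 𝕜) hβ ht k] with x hx
        rw [hx, mul_assoc]

/-- The spectral series is the basis expansion of the kernel operator's image, since the
coefficients agree. -/
lemma modifiedHermiteHeat_eq_toLp {α : Fin d → ℝ} {j : Fin d}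
    (hβ : ∀ i, -1 < (α + Pi.single j 1 : Fin d → ℝ) i) {t : ℝ} (ht : 0 < t)
    (f : Lp 𝕜 2 (orthantMeasure d)) {C : ℝ}
    (hK : IsSchurKernel (orthantMeasure d) (modifiedKernel (α + Pi.single j 1) t) C) :
    modifiedHermiteHeat α j t f = (hK.memLp_kernelOp one_le_two (Lp.memLp f)).toLp := by
  rw [modifiedHermiteHeat_eq_tsum]
  have h := ((hermiteBasis 𝕜 hβ).hasSum_repr
    (hK.memLp_kernelOp one_le_two (Lp.memLp f)).toLp).tsum_eq
  simp only [HilbertBasis.repr_apply_apply, coe_hermiteBasis,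
    inner_hermiteVec_toLp_kernelOp hβ ht f hK] at h
  exact h

lemma modifiedHermiteHeat_ae_eq {α : Fin d → ℝ} {j : Fin d}
    (hβ : ∀ i, -1 / 2 ≤ (α + Pi.single j 1 : Fin d → ℝ) i) {t : ℝ} (ht : 0 ≤ t)
    (f : Lp 𝕜 2 (orthantMeasure d)) :
    modifiedHermiteHeat α j t f =ᵐ[orthantMeasure d] modifiedHermiteSemigroup α j t f := by
  rcases ht.eq_or_lt with rfl | ht
  · rw [modifiedHermiteHeat_zero fun i => by linarith [hβ i], modifiedHermiteSemigroup_zero]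
  obtain ⟨C, -, hC⟩ := exists_isSchurKernel_modifiedKernel hβ
  rw [modifiedHermiteHeat_eq_toLp (fun i => by linarith [hβ i]) ht f (hC t ht)]
  exact (MemLp.coeFn_toLp _).trans (modifiedHermiteSemigroup_ae_eq hβ ht f).symm

lemma inner_hermiteVec_modifiedHermiteHeat {α : Fin d → ℝ} {j : Fin d}
    (hβ : ∀ i, -1 / 2 ≤ (α + Pi.single j 1 : Fin d → ℝ) i) {t : ℝ} (ht : 0 < t)
    (f : Lp 𝕜 2 (orthantMeasure d)) (k : Fin d → ℕ) :
    inner 𝕜 (hermiteVec 𝕜 (α + Pi.single j 1) k) (modifiedHermiteHeat α j t f) =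
      (Real.exp (-t * (hermiteEigenvalue (α + Pi.single j 1) k + 2)) : 𝕜) *
        inner 𝕜 (hermiteVec 𝕜 (α + Pi.single j 1) k) f := by
  have hβ' : ∀ i, -1 < (α + Pi.single j 1 : Fin d → ℝ) i := fun i => by linarith [hβ i]
  obtain ⟨C, -, hC⟩ := exists_isSchurKernel_modifiedKernel hβ
  rw [modifiedHermiteHeat_eq_toLp hβ' ht f (hC t ht), inner_hermiteVec_toLp_kernelOp hβ' ht f (hC t ht)]

/-- By Parseval the squared error is a series in (1 - e^(-t m_k))² |⟨φ_k, f⟩|². As m_k ≥ 0 it is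
dominated by |⟨φ_k, f⟩|², and dominated convergence applies. -/
lemma tendsto_modifiedHermiteHeat {α : Fin d → ℝ} {j : Fin d}
    (hβ : ∀ i, -1 / 2 ≤ (α + Pi.single j 1 : Fin d → ℝ) i) (f : Lp 𝕜 2 (orthantMeasure d)) :
    Tendsto (fun t => modifiedHermiteHeat α j t f) (𝓝[>] 0) (𝓝 f) := by
  have hβ' : ∀ i, -1 < (α + Pi.single j 1 : Fin d → ℝ) i := fun i => by linarith [hβ i]
  set b := hermiteBasis 𝕜 hβ' with hb
  set c : (Fin d → ℕ) → ℝ := fun k => ‖inner 𝕜 (b k) f‖ with hc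
  set m : (Fin d → ℕ) → ℝ := fun k => hermiteEigenvalue (α + Pi.single j 1) k + 2 with hm
  have hm0 : ∀ k, 0 ≤ m k := fun k => by
    have := hermiteEigenvalue_nonneg hβ k
    simp only [hm]
    linarith
  have hpars : ∀ g : Lp 𝕜 2 (orthantMeasure d),
      HasSum (fun k => ‖inner 𝕜 (b k) g‖ ^ 2) (‖g‖ ^ 2) := by
    intro g
    have h := RCLike.hasSum_re 𝕜 (b.hasSum_inner_mul_inner g g)
    rw [inner_self_eq_norm_sq] at h
    convert! h using 1
    funext k
    rw [inner_mul_symm_re_eq_norm, norm_mul, norm_inner_symm g, sq]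
  have hdiff : ∀ t, 0 < t → ‖modifiedHermiteHeat α j t f - f‖ ^ 2 =
      ∑' k, ((1 - Real.exp (-t * m k)) * c k) ^ 2 := by
    intro t ht
    rw [← (hpars _).tsum_eq]
    refine tsum_congr fun k => ?_
    have h1 := inner_hermiteVec_modifiedHermiteHeat hβ ht f k
    rw [← coe_hermiteBasis 𝕜 hβ'] at h1
    have h2 : Real.exp (-t * m k) ≤ 1 := Real.exp_le_one_iff.2 (by nlinarith [hm0 k])
    rw [inner_sub_right, h1, ← hb]
    simp only [hc]
    have h3 : (Real.exp (-t * (hermiteEigenvalue (α + Pi.single j 1) k + 2)) : 𝕜) *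
        inner 𝕜 (b k) f - inner 𝕜 (b k) f =
        ((Real.exp (-t * m k) - 1 : ℝ) : 𝕜) * inner 𝕜 (b k) f := by
      push_cast
      ring
    rw [h3, norm_mul, RCLike.norm_ofReal, abs_sub_comm, abs_of_nonneg (by linarith)]
  have hlim : Tendsto (fun t => ∑' k, ((1 - Real.exp (-t * m k)) * c k) ^ 2) (𝓝[>] 0)
      (𝓝 (∑' _k : Fin d → ℕ, (0 : ℝ))) := by
    refine tendsto_tsum_of_dominated_convergence (hpars f).summable (fun k => ?_) ?_
    · have : Continuous fun t : ℝ => ((1 - Real.exp (-t * m k)) * c k) ^ 2 := by fun_prop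
      have h := this.tendsto 0
      simp only [neg_zero, zero_mul, Real.exp_zero, sub_self] at h
      rw [zero_pow two_ne_zero] at h
      exact h.mono_left nhdsWithin_le_nhds
    · filter_upwards [self_mem_nhdsWithin] with t ht k
      have ht : 0 < t := ht
      have h2 : Real.exp (-t * m k) ≤ 1 := Real.exp_le_one_iff.2 (by nlinarith [hm0 k])
      have h3 := Real.exp_pos (-t * m k)
      rw [Real.norm_of_nonneg (sq_nonneg _), mul_pow]
      refine mul_le_of_le_one_left (sq_nonneg _) ?_
      rw [sq_le_one_iff_abs_le_one, abs_le]
      constructor <;> linarith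
  rw [tsum_zero] at hlim
  rw [tendsto_iff_norm_sub_tendsto_zero]
  have h := hlim.sqrt
  rw [Real.sqrt_zero] at h
  refine h.congr' ?_
  filter_upwards [self_mem_nhdsWithin] with t ht
  rw [← hdiff t ht, Real.sqrt_sq (norm_nonneg _)]

lemma tendsto_eLpNorm_modifiedHermiteSemigroup {α : Fin d → ℝ} {j : Fin d}
    (hβ : ∀ i, -1 / 2 ≤ (α + Pi.single j 1 : Fin d → ℝ) i) {f : (Fin d → ℝ) → 𝕜}
    (hf : MemLp f 2 (orthantMeasure d)) :
    Tendsto (fun t => eLpNorm (modifiedHermiteSemigroup α j t f - f) 2 (orthantMeasure d))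
      (𝓝[>] 0) (𝓝 0) := by
  have h := tendsto_iff_edist_tendsto_0.1 (tendsto_modifiedHermiteHeat hβ hf.toLp)
  refine h.congr' ?_
  filter_upwards [self_mem_nhdsWithin] with t ht
  have ht : 0 < t := ht
  rw [Lp.edist_def]
  refine eLpNorm_congr_ae ?_
  have h1 : modifiedHermiteSemigroup α j t hf.toLp =ᵐ[orthantMeasure d]
      modifiedHermiteSemigroup α j t f := by
    refine (modifiedHermiteSemigroup_ae_eq hβ ht _).trans ?_
    rw [IsSchurKernel.kernelOp_congr_ae _ hf.coeFn_toLp]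
    exact (modifiedHermiteSemigroup_ae_eq hβ ht _).symm
  filter_upwards [modifiedHermiteHeat_ae_eq hβ ht.le hf.toLp, h1, hf.coeFn_toLp] with x h1 h2 h3
  rw [Pi.sub_apply, Pi.sub_apply, h1, h2, h3]

theorem isSubmarkovian_modifiedHermiteSemigroup {α : Fin d → ℝ} {j : Fin d}
    (hβ : ∀ i, -1 / 2 ≤ (α + Pi.single j 1 : Fin d → ℝ) i)
    (hK : ∀ t, 0 < t → IsSchurKernel (orthantMeasure d) (modifiedKernel (α + Pi.single j 1) t) 1) :
    IsSubmarkovian (𝕜 := 𝕜) (orthantMeasure d) (modifiedHermiteSemigroup α j) :=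
  isSubmarkovian_of_kernel hK (modifiedHermiteSemigroup_zero α j)
    (fun _ ht f => modifiedHermiteSemigroup_ae_eq hβ ht f)
    (fun _ _ hs ht x y => integral_modifiedKernel_mul_modifiedKernel hβ hs ht x y)
    fun _ hf => tendsto_eLpNorm_modifiedHermiteSemigroup hβ hf

end Semigroup

/-! ### Failure of contractivity -/

/-- By positivity, Tonelli and symmetry, so mass exceeding 1 on E contradicts L¹-contractivity. -/
lemma IsSchurKernel.eLpNorm_one_kernelOp_indicator {X : Type*} [MeasurableSpace X] {𝕜 : Type*}
    [RCLike 𝕜] {μ : Measure X} [SFinite μ] {K : X → X → ℝ} {C : ℝ} (hK : IsSchurKernel μ K C)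
    {E : Set X} (hE : MeasurableSet E) :
    eLpNorm (kernelOp μ K (E.indicator fun _ => (1 : 𝕜))) 1 μ =
      ∫⁻ y in E, ∫⁻ x, ENNReal.ofReal (K y x) ∂μ ∂μ := by
  have h : ∀ x, ‖kernelOp μ K (E.indicator fun _ => (1 : 𝕜)) x‖ₑ =
      ∫⁻ y in E, ENNReal.ofReal (K y x) ∂μ := by
    intro x
    have h1 : kernelOp μ K (E.indicator fun _ => (1 : 𝕜)) x =
        ((∫ y in E, K x y ∂μ : ℝ) : 𝕜) := by
      rw [← integral_ofReal, ← integral_indicator hE]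
      refine integral_congr_ae (Eventually.of_forall fun y => ?_)
      by_cases hy : y ∈ E <;> simp [hy]
    have h0 : 0 ≤ ∫ y in E, K x y ∂μ := integral_nonneg fun y => hK.nonneg x y
    have hi : Integrable (K x) μ := by simpa using hK.integrable_right (𝕜 := ℝ) x
    rw [h1, ← ofReal_norm, RCLike.norm_ofReal, abs_of_nonneg h0,
      ofReal_integral_eq_lintegral_ofReal hi.integrableOn (Eventually.of_forall (hK.nonneg x))]
    simp_rw [hK.symm x]
  rw [eLpNorm_one_eq_lintegral_enorm, lintegral_congr h]
  exact lintegral_lintegral_swap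
    (hK.measurable_ofReal.comp measurable_swap).aemeasurable

lemma isOpen_orthant (d : ℕ) : IsOpen (orthant d) := by
  have : orthant d = univ.pi fun _ => Ioi (0 : ℝ) := by
    ext x
    simp [orthant]
  rw [this]
  exact isOpen_set_pi finite_univ fun _ _ => isOpen_Ioi

lemma orthantMeasure_ne_zero (d : ℕ) : orthantMeasure d ≠ 0 := by
  rw [orthantMeasure, Ne, Measure.restrict_eq_zero]
  exact ((isOpen_orthant d).measure_pos _ ⟨1, fun _ => one_pos⟩).ne'

/-- The mass of the kernel is large on a box if the functions `laguerreMass` are. -/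
lemma le_lintegral_modifiedKernel {β : Fin d → ℝ} (hβ : ∀ i, -1 / 2 ≤ β i) {A B h : Fin d → ℝ}
    (h0 : ∀ i, 0 ≤ h i)
    (hh : ∀ i, ∀ w ∈ Icc (A i) (B i), ENNReal.ofReal (h i) ≤ laguerreMass (β i / 2 + 1 / 4) w)
    {t : ℝ} (ht : 0 < t) {x : Fin d → ℝ} (hx : x ∈ orthant d)
    (hxw : ∀ i, x i ^ 2 / (2 * Real.sinh (2 * t) * Real.cosh (2 * t)) ∈ Icc (A i) (B i)) :
    ENNReal.ofReal (Real.exp (-2 * t) * ∏ i, (Real.cosh (2 * t) ^ (-1 / 2 : ℝ) *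
        Real.exp (-(Real.sinh (2 * t) ^ 2 * B i)) * h i)) ≤
      ∫⁻ y, ENNReal.ofReal (modifiedKernel β t x y) ∂(orthantMeasure d) := by
  have hc := Real.cosh_pos (2 * t)
  rw [lintegral_modifiedKernel hβ ht hx, ENNReal.ofReal_mul (Real.exp_pos _).le,
    ENNReal.ofReal_prod_of_nonneg fun i _ => mul_nonneg (by positivity) (h0 i)]
  refine mul_le_mul_right (Finset.prod_le_prod' fun i _ => ?_) _
  rw [laguerreKernelMass, lintegral_laguerreKernel₁ (hβ i) ht (hx i), ENNReal.ofReal_mul (by positivity)]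
  refine mul_le_mul' (ENNReal.ofReal_le_ofReal ?_) (hh i _ (hxw i))
  have := (hxw i).2
  gcongr

/-- The coordinate with β in (-1/2, 1/2) contributes a fixed factor η > 1; the others contribute 1 -
ε, with ε so small that the product stays above 1. -/
lemma exists_le_laguerreMass_prod_gt_one {β : Fin d → ℝ} (hβ : ∀ i, -1 / 2 ≤ β i)
    (hβ0 : ∃ i, -1 / 2 < β i ∧ β i < 1 / 2) :
    ∃ A B h : Fin d → ℝ, (∀ i, 0 < A i) ∧ (∀ i, A i < B i) ∧ (∀ i, 0 ≤ h i) ∧ (1 < ∏ i, h i) ∧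
      ∀ i, ∀ w ∈ Icc (A i) (B i), ENNReal.ofReal (h i) ≤ laguerreMass (β i / 2 + 1 / 4) w := by
  obtain ⟨i₀, h1, h2⟩ := hβ0
  obtain ⟨η, A₀, B₀, hη, hA₀, hAB₀, hm₀⟩ := exists_Icc_lt_laguerreMass (a := β i₀ / 2 + 1 / 4)
    (by linarith) (by linarith)
  have hcont : Tendsto (fun ε : ℝ => ∏ i, if i = i₀ then η else 1 - ε) (𝓝[>] 0)
      (𝓝 (∏ i, if i = i₀ then η else 1 - (0 : ℝ))) := by
    refine Tendsto.mono_left ?_ nhdsWithin_le_nhds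
    refine tendsto_finsetProd _ fun i _ => ?_
    split_ifs
    · exact tendsto_const_nhds
    · exact tendsto_const_nhds.sub tendsto_id
  have hval : (∏ i, if i = i₀ then η else 1 - (0 : ℝ)) = η := by simp
  rw [hval] at hcont
  obtain ⟨ε, hε, hε1, hε0⟩ := ((hcont.eventually_const_lt hη).and
    ((Ioo_mem_nhdsGT (zero_lt_one (α := ℝ))))).exists
  have hex : ∀ i, ∃ A B : ℝ, 0 < A ∧ A < B ∧ ∀ w ∈ Icc A B,
      ENNReal.ofReal (if i = i₀ then η else 1 - ε) ≤ laguerreMass (β i / 2 + 1 / 4) w := by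
    intro i
    by_cases hi : i = i₀
    · subst hi
      exact ⟨A₀, B₀, hA₀, hAB₀, by simpa using hm₀⟩
    · simp only [hi, if_false]
      exact exists_Icc_le_laguerreMass (by linarith [hβ i]) hε1
  choose A B hA hAB hm using hex
  refine ⟨A, B, _, hA, hAB, fun i => ?_, hε, hm⟩
  split_ifs <;> linarith

/-- With the range of w fixed, every factor that depends on t is continuous and equals 1 at t = 0.
-/
lemma tendsto_mass_lower_bound (B h : Fin d → ℝ) :
    Tendsto (fun t => Real.exp (-2 * t) * ∏ i, (Real.cosh (2 * t) ^ (-1 / 2 : ℝ) *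
        Real.exp (-(Real.sinh (2 * t) ^ 2 * B i)) * h i)) (𝓝[>] 0) (𝓝 (∏ i, h i)) := by
  have hc : Continuous fun t : ℝ => Real.exp (-2 * t) * ∏ i, (Real.cosh (2 * t) ^ (-1 / 2 : ℝ) *
      Real.exp (-(Real.sinh (2 * t) ^ 2 * B i)) * h i) := by
    refine (by fun_prop : Continuous fun t : ℝ => Real.exp (-2 * t)).mul
      (continuous_finsetProd _ fun i _ => ?_)
    refine (Continuous.mul ?_ (by fun_prop)).mul continuous_const
    exact (by fun_prop : Continuous fun t : ℝ => Real.cosh (2 * t)).rpow_const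
      fun t => Or.inl (Real.cosh_pos _).ne'
  have := (hc.tendsto 0).mono_left (nhdsWithin_le_nhds (s := Ioi 0))
  simpa using this

theorem not_isLpContractive_modifiedHermiteHeat {𝕜 : Type*} [RCLike 𝕜] {α : Fin d → ℝ} {j : Fin d}
    (hβ : ∀ i, -1 / 2 ≤ (α + Pi.single j 1 : Fin d → ℝ) i)
    (hβ0 : ∃ i, -1 / 2 < (α + Pi.single j 1 : Fin d → ℝ) i ∧
      (α + Pi.single j 1 : Fin d → ℝ) i < 1 / 2) :
    ¬ IsLpContractive (𝕜 := 𝕜) (orthantMeasure d) (modifiedHermiteHeat α j) := by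
  intro hcontr
  obtain ⟨A, B, h, hA, hAB, h0, hprod, hm⟩ := exists_le_laguerreMass_prod_gt_one hβ hβ0
  obtain ⟨t, hgt, ht⟩ := (((tendsto_mass_lower_bound B h).eventually_const_lt hprod).and
    self_mem_nhdsWithin).exists
  have ht : 0 < t := ht
  set r := 2 * Real.sinh (2 * t) * Real.cosh (2 * t) with hr
  have hr0 : 0 < r := by
    have := Real.sinh_pos_iff.2 (by linarith : 0 < 2 * t)
    have := Real.cosh_pos (2 * t)
    positivity
  -- This box consists of the points for which every w_i = x_i²/r lies in [A i, B i]. It shrinks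
  -- with t but has positive finite measure, and L¹-contractivity fails for its indicator.
  set E : Set (Fin d → ℝ) := Icc (fun i => √(r * A i)) (fun i => √(r * B i)) with hE
  have hEm : MeasurableSet E := measurableSet_Icc
  have hEx : ∀ x ∈ E, x ∈ orthant d ∧ ∀ i, x i ^ 2 / r ∈ Icc (A i) (B i) := by
    intro x hx
    have hpos : ∀ i, 0 < x i := fun i =>
      (Real.sqrt_pos.2 (mul_pos hr0 (hA i))).trans_le (hx.1 i)
    refine ⟨hpos, fun i => ⟨?_, ?_⟩⟩
    · rw [le_div_iff₀ hr0, mul_comm]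
      exact (Real.sqrt_le_left (hpos i).le).1 (hx.1 i)
    · rw [div_le_iff₀ hr0, mul_comm]
      exact (Real.le_sqrt (hpos i).le (mul_pos hr0 ((hA i).trans (hAB i))).le).1 (hx.2 i)
  have hμE : orthantMeasure d E = ∏ i, ENNReal.ofReal (√(r * B i) - √(r * A i)) := by
    rw [orthantMeasure, Measure.restrict_apply hEm, inter_eq_left.2 fun x hx => (hEx x hx).1,
      hE, Real.volume_Icc_pi]
  have hμE0 : orthantMeasure d E ≠ 0 := by
    rw [hμE, Finset.prod_ne_zero_iff]
    intro i _
    rw [Ne, ENNReal.ofReal_eq_zero, not_le, sub_pos]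
    exact Real.sqrt_lt_sqrt (mul_pos hr0 (hA i)).le (mul_lt_mul_of_pos_left (hAB i) hr0)
  have hμE1 : orthantMeasure d E ≠ ∞ := by
    rw [hμE]
    exact ENNReal.prod_ne_top fun i _ => ENNReal.ofReal_ne_top
  have hf : ∀ p, MemLp (E.indicator fun _ => (1 : 𝕜)) p (orthantMeasure d) := fun p =>
    memLp_indicator_const p hEm 1 (Or.inr hμE1)
  obtain ⟨C, -, hC⟩ := exists_isSchurKernel_modifiedKernel hβ
  have h1 : eLpNorm (modifiedHermiteHeat α j t (hf 2).toLp) 1 (orthantMeasure d) =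
      ∫⁻ y in E, ∫⁻ x, ENNReal.ofReal (modifiedKernel (α + Pi.single j 1) t y x)
        ∂(orthantMeasure d) ∂(orthantMeasure d) := by
    rw [eLpNorm_congr_ae ((modifiedHermiteHeat_ae_eq hβ ht.le _).trans
      (modifiedHermiteSemigroup_ae_eq hβ ht _)),
      IsSchurKernel.kernelOp_congr_ae _ (hf 2).coeFn_toLp, (hC t ht).eLpNorm_one_kernelOp_indicator hEm]
  have h2 := hcontr 1 le_rfl t ht.le (hf 2).toLp ((memLp_congr_ae (hf 2).coeFn_toLp).2 (hf 1))
  rw [h1, eLpNorm_congr_ae (hf 2).coeFn_toLp, eLpNorm_indicator_const hEm one_ne_zero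
    ENNReal.one_ne_top] at h2
  simp only [enorm_one, ENNReal.toReal_one, div_one, ENNReal.rpow_one, one_mul] at h2
  have h3 := setLIntegral_mono' (μ := orthantMeasure d) hEm fun x hx =>
    le_lintegral_modifiedKernel hβ h0 hm ht (hEx x hx).1 (hEx x hx).2
  rw [setLIntegral_const] at h3
  have h4 := ENNReal.mul_lt_mul_left hμE0 hμE1 (ENNReal.one_lt_ofReal.2 hgt)
  rw [one_mul] at h4
  exact absurd (h3.trans h2) (not_le.2 h4)

/-- At time 1 the total mass is at most C < 1, so the constant function 1 is not preserved. -/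
lemma modifiedHermiteSemigroup_not_isMarkovian {𝕜 : Type*} [RCLike 𝕜] {α : Fin d → ℝ} {j : Fin d}
    (hβ : ∀ i, -1 / 2 ≤ (α + Pi.single j 1 : Fin d → ℝ) i) {C : ℝ} (hC0 : 0 ≤ C) (hC1 : C < 1)
    (hK : IsSchurKernel (orthantMeasure d) (modifiedKernel (α + Pi.single j 1) 1) C) :
    ¬ IsMarkovian (𝕜 := 𝕜) (orthantMeasure d) (modifiedHermiteSemigroup α j) := by
  intro hM
  have : (ae (orthantMeasure d)).NeBot := ae_neBot.2 (orthantMeasure_ne_zero d)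
  obtain ⟨x, h1, h2⟩ := ((hM.map_one 1 zero_le_one).and
    (modifiedHermiteSemigroup_ae_eq (𝕜 := 𝕜) hβ one_pos fun _ => 1)).exists
  have h3 := hK.kernelOp_one_le (𝕜 := 𝕜) hC0 x
  rw [← h2, h1, ← RCLike.ofReal_one, RCLike.ofReal_le_ofReal] at h3
  linarith

end

theorem mainTheorem6 {𝕜 : Type*} [RCLike 𝕜] {d : ℕ} (j : Fin d) (α : Fin d → ℝ)
    (hα : α ∈ hermiteAdmissible j) :
    -- the kernel series and the integrals converge, and the integral operators extend the semigroup
    -- given on `L²` by the spectral theorem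
    ((∀ t : ℝ, 0 < t → ∀ x ∈ orthant d, ∀ y ∈ orthant d,
        Summable (hermiteKernelTerm (α + Pi.single j 1) t x y)) ∧
      (∀ t : ℝ, 0 < t → ∀ f : (Fin d → ℝ) → 𝕜, MemL1AddLinfty (orthantMeasure d) f →
        ∀ x ∈ orthant d, Integrable
          (fun y => (hermiteKernel (α + Pi.single j 1) t x y : 𝕜) * f y) (orthantMeasure d)) ∧
      (∀ t : ℝ, 0 ≤ t → ∀ f : Lp 𝕜 2 (orthantMeasure d),
        modifiedHermiteHeat α j t f =ᵐ[orthantMeasure d] modifiedHermiteSemigroup α j t f)) ∧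
    -- the contractive case
    ((α j = -3 / 2 ∨ -1 / 2 ≤ α j) ∧ (∀ i, i ≠ j → α i = -1 / 2 ∨ 1 / 2 ≤ α i) →
      IsSubmarkovian (𝕜 := 𝕜) (orthantMeasure d) (modifiedHermiteSemigroup α j) ∧
      ¬ IsMarkovian (𝕜 := 𝕜) (orthantMeasure d) (modifiedHermiteSemigroup α j) ∧
      ∀ p : ℝ≥0∞, 1 ≤ p → ∀ t : ℝ, 0 < t →
        LpOpNormLE (𝕜 := 𝕜) (orthantMeasure d) p (modifiedHermiteSemigroup α j t)
          (Real.exp (-2 * t) * Real.cosh (2 * t) ^ (-(d : ℝ) / 2))) ∧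
    -- the remaining case
    (¬ (α j = -3 / 2 ∨ -1 / 2 ≤ α j) ∨ (∃ i, i ≠ j ∧ ¬ (α i = -1 / 2 ∨ 1 / 2 ≤ α i)) →
      ¬ IsLpContractive (𝕜 := 𝕜) (orthantMeasure d) (modifiedHermiteHeat α j) ∧
      ∃ c : ℝ, 1 < c ∧ ∀ p : ℝ≥0∞, 1 ≤ p → ∀ t : ℝ, 0 < t →
        LpOpNormLE (𝕜 := 𝕜) (orthantMeasure d) p (modifiedHermiteSemigroup α j t)
          (c * (Real.exp (-2 * t) * Real.cosh (2 * t) ^ (-(d : ℝ) / 2)))) := by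
  -- Shifting by e_j makes coordinate j like the others: α_j = -3/2 becomes β_j = -1/2 and α_j ≥
  -- -1/2 becomes β_j ≥ 1/2.
  have hj : (α + Pi.single j 1 : Fin d → ℝ) j = α j + 1 := by simp
  have hi : ∀ i, i ≠ j → (α + Pi.single j 1 : Fin d → ℝ) i = α i := fun i h => by simp [h]
  have hβ : ∀ i, -1 / 2 ≤ (α + Pi.single j 1 : Fin d → ℝ) i := by
    intro i
    rcases eq_or_ne i j with rfl | h
    · rw [hj]
      linarith [hα.1]
    · rw [hi i h]
      exact hα.2 i h
  have hβ' : ∀ i, -1 < (α + Pi.single j 1 : Fin d → ℝ) i := fun i => by linarith [hβ i]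
  refine ⟨⟨fun t ht x _ y _ => (hasSum_hermiteKernelTerm hβ' ht x y).summable,
    fun t ht f hf x hx => integrable_hermiteKernel_mul hβ ht hf hx,
    fun t ht f => modifiedHermiteHeat_ae_eq hβ ht f⟩, ?_, ?_⟩
  · rintro ⟨h1, h2⟩
    -- In terms of a = β_i/2 + 1/4, the contractive case means a = 0 or a ≥ 1/2, exactly where the
    -- mass is known to be at most 1.
    have hmass : ∀ i w, 0 < w →
        laguerreMass ((α + Pi.single j 1 : Fin d → ℝ) i / 2 + 1 / 4) w ≤ ENNReal.ofReal 1 := by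
      intro i w hw
      have hcase : (α + Pi.single j 1 : Fin d → ℝ) i = -1 / 2 ∨
          1 / 2 ≤ (α + Pi.single j 1 : Fin d → ℝ) i := by
        rcases eq_or_ne i j with rfl | h
        · rw [hj]
          exact h1.imp (fun h => by linarith) fun h => by linarith
        · rw [hi i h]
          exact h2 i h
      rw [ENNReal.ofReal_one]
      rcases hcase with h | h
      · rw [h, show (-1 / 2 : ℝ) / 2 + 1 / 4 = 0 by norm_num, laguerreMass_zero hw.le]
      · exact laguerreMass_le_one (by linarith) hw
    have hK : ∀ t, 0 < t → IsSchurKernel (orthantMeasure d) (modifiedKernel (α + Pi.single j 1) t)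
        (Real.exp (-2 * t) * Real.cosh (2 * t) ^ (-(d : ℝ) / 2)) := fun t ht => by
      simpa using isSchurKernel_modifiedKernel hβ ht (C := fun _ => 1) (fun _ => zero_le_one) hmass
    refine ⟨isSubmarkovian_modifiedHermiteSemigroup hβ fun t ht => ?_,
      modifiedHermiteSemigroup_not_isMarkovian hβ (by positivity) (exp_mul_cosh_rpow_lt_one one_pos)
        (hK 1 one_pos),
      fun p hp t ht => (hK t ht).lpOpNormLE hp fun f => modifiedHermiteSemigroup_ae_eq hβ ht f⟩
    exact ⟨(hK t ht).measurable, (hK t ht).nonneg, (hK t ht).symm, fun x =>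
      ((hK t ht).lintegral_le x).trans (ENNReal.ofReal_le_ofReal (exp_mul_cosh_rpow_lt_one ht).le),
      (hK t ht).bdd⟩
  · intro h
    refine ⟨not_isLpContractive_modifiedHermiteHeat hβ ?_, ?_⟩
    · rcases h with h | ⟨i, hij, h⟩
      · rw [not_or, not_le] at h
        refine ⟨j, ?_, ?_⟩ <;> rw [hj]
        · have := lt_of_le_of_ne hα.1 (Ne.symm h.1)
          linarith
        · linarith
      · rw [not_or, not_le] at h
        exact ⟨i, by rw [hi i hij]; exact lt_of_le_of_ne (hα.2 i hij) (Ne.symm h.1),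
          by rw [hi i hij]; exact h.2⟩
    · obtain ⟨c, hc, hK⟩ := exists_isSchurKernel_modifiedKernel hβ
      exact ⟨c, hc, fun p hp t ht =>
        (hK t ht).lpOpNormLE hp fun f => modifiedHermiteSemigroup_ae_eq hβ ht f⟩
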